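/- \textbf{Setting.} Let $L=\bigoplus_{n\in\mathbb Z}L_n$ be a $\mathbb Z$-graded complex Lie algebra with $\dim L_n<\infty$, with a basis $(e_i)_{i\in\mathbb Z}$ of homogeneous elements such that $(e_i)_{i\le 0}$ spans $L_{\le 0}=\bigoplus_{n\le 0}L_n$, $(e_i)_{i>0}$ spans $L_+=\bigoplus_{n>0}L_n$, and $e_i\in L_m$ implies $e_{i+1}\in L_m$ or $e_{i+1}\in L_{m+1}$. Let $L^*=\bigoplus_n L^*_n$, $L_n^*=\mathrm{Hom}(L_{-n},\mathbb C)$, be the restricted dual, $(e_i^*)$ the dual basis, and fix $\beta\in L_0^*$. Let $cl(L)=\iota(L)\oplus\varepsilon(L^*)\oplus\mathbb CK$ be the graded Lie superalgebra with $\iota(L)\oplus\varepsilon(L^*)$ odd (copies of $L$ and $L^*$), $K$ even, central and of degree $0$, $[\iota(x),\iota(y)]=[\varepsilon(f),\varepsilon(g)]=0$ and $[\iota(x),\varepsilon(f)]=f(x)K$. For a graded Lie superalgebra $\mathfrak a$ containing such a $K$, let $U_1(\mathfrak a)=U(\mathfrak a)/(K-1)$, and let $U_1(\mathfrak a)^{com}$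 be its completion for the topology in which the left ideals generated by the elements of degree $\ge N$ ($N\to\infty$) are the neighbourhoods of $0$. Normal ordering $:\ :$ moves the annihilation operators $\iota(e_k)$ ($k>0$) and $\varepsilon(e_j^*)$ ($j\le 0$) to the right, with the sign of the permutation. Put $$\rho^\beta(x)=\sum_{i}:\iota([x,e_i])\varepsilon(e_i^*):+\beta(x)\in U_1(cl(L))^{com},\qquad \gamma^\beta(x,y)=[\rho^\beta(x),\rho^\beta(y)]-\rho^\beta([x,y]),$$ where $\gamma^\beta(x,y)$ is a constant. Let $\ker\gamma^\beta=\{x\in L:\gamma^\beta(x,L)=0\}$, let $F_\beta$ be a graded complement of $\ker\gamma^\beta$ in $L$, let $\epsilon(F_\beta)$ be an even copy of $F_\beta$, and for $x\in L$ let $\epsilon(x)\in\epsilon(F_\beta)$ be the projection of $x$ along $\ker\gamma^\beta$. Let $s(L)=L\oplus c(L)$ with $c(L)=cl(L)\oplus\epsilon(F_\beta)$, where $L$, $cl(L)$, $\epsilon(F_\beta)$ commute with each other, $L$ and $cl(L)$ keep their brackets, and $[\epsilon(x),\epsilon(y)]=-\gamma^\beta(x,y)K$ for $x,y\in F_\beta$.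 Give $\varepsilon(L^*)$ charge degree $1$, $\iota(L)$ charge degree $-1$, and $L,\epsilon(F_\beta),K$ charge degree $0$. In $U_1(s(L))^{com}$ put $\bar\theta^\beta(x)=x+\rho^\beta(x)+\epsilon(x)$, $$d^\beta=\sum_i e_i\varepsilon(e_i^*)-\sum_{i<j}:\iota([e_i,e_j])\varepsilon(e_i^*)\varepsilon(e_j^*):+\varepsilon(\beta),\qquad \bar d^\beta=d^\beta+\sum_i\varepsilon(e_i^*)\epsilon(e_i).$$ An $L$-module $M$ is smooth if each $m\in M$ satisfies $U(L)_n m=0$ for all sufficiently large $n$. Let $\Lambda^{\infty/2+\bullet}L^*$ be the space of semi-infinite forms, i.e. the span of the monomials $e_{i_1}^*\wedge e_{i_2}^*\wedge\cdots$ with $i_{k+1}=i_k-1$ for $k\gg 0$, on which $\varepsilon(e_i^*)$ acts by exterior multiplication, $\iota(e_i)$ by contraction and $K$ by $1$. Let $\mathfrak F_\beta$ be the module over $\epsilon(F_\beta)\oplus\mathbb CK$ induced from the one-dimensional module of $\bigoplus_{n>0}\epsilon(F_\beta)_n\oplus\mathbb CK$ on which $\epsilon(F_\beta)_n$ ($n>0$)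 acts by $0$ and $K$ by $1$. \textbf{Theorem.} Assume $[L,L]\subseteq\ker\gamma^\beta$. Then $\gamma^\beta(x,y)$ is indeed a constant for all $x,y\in L$, all the series above converge, and $(\bar d^\beta)^2=0$ in $U_1(s(L))^{com}$. Moreover, $\bar d^\beta$ is the unique element of charge degree $1$ in $U_1(s(L))^{com}$ with $[\bar d^\beta,\iota(x)]=\bar\theta^\beta(x)$ for all $x\in L$ (superbracket of odd elements, i.e. anticommutator). For every smooth $L$-module $M$, the $s(L)$-module $M\otimes\Lambda^{\infty/2+\bullet}L^*\otimes\mathfrak F_\beta$ is smooth, so that $\bar d^\beta$ acts on it, and this operator squares to zero. -/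

import Mathlib

noncomputable section

namespace SemiInf

open scoped TensorProduct

universe u v w

/-! ### Lie superalgebras, enveloping algebras and their completions -/

/-- The Koszul sign `(-1)^{pq}` for parities `p, q`. -/
def koszul (p q : ZMod 2) : ℂ := if p = 1 ∧ q = 1 then -1 else 1

/-- A `ℤ`-graded complex Lie superalgebra on the vector space `V`. -/
structure GradedLieSuper (V : Type u) [AddCommGroup V] [Module ℂ V] where
  part : ZMod 2 → Submodule ℂ V
  deg : ℤ → Submodule ℂ V
  bracket : V →ₗ[ℂ] V →ₗ[ℂ] V
  isCompl_part : IsCompl (part 0) (part 1)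
  deg_internal : DirectSum.IsInternal deg
  deg_part : ∀ n, deg n ≤ (deg n ⊓ part 0) ⊔ (deg n ⊓ part 1)
  bracket_part : ∀ p q x y, x ∈ part p → y ∈ part q → bracket x y ∈ part (p + q)
  bracket_deg : ∀ m n x y, x ∈ deg m → y ∈ deg n → bracket x y ∈ deg (m + n)
  skew : ∀ p q x y, x ∈ part p → y ∈ part q → bracket x y = -(koszul p q • bracket y x)
  jacobi : ∀ p q x y z, x ∈ part p → y ∈ part q →
    bracket x (bracket y z) = bracket (bracket x y) z + koszul p q • bracket y (bracket x z)

/-- For a map `j` from `V` to an algebra and a family `g` of subspaces of `V`, the span of all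
products `j v₁ * ⋯ * j v_r` with `v_s ∈ g (n_s)` and `n₁ + ⋯ + n_r = n`. -/
def wordSpan {V : Type u} {A : Type v} [AddCommGroup V] [Module ℂ V] [Ring A] [Algebra ℂ A]
    (j : V → A) (g : ℤ → Submodule ℂ V) (n : ℤ) : Submodule ℂ A :=
  Submodule.span ℂ {a | ∃ l : List (ℤ × V), (∀ p ∈ l, p.2 ∈ g p.1) ∧
    (l.map Prod.fst).sum = n ∧ a = (l.map fun p => j p.2).prod}

namespace GradedLieSuper

variable {V : Type u} [AddCommGroup V] [Module ℂ V] (𝔤 : GradedLieSuper V)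

/-- The relations `x y - (-1)^{|x||y|} y x = [x, y]`. -/
inductive Rel : TensorAlgebra ℂ V → TensorAlgebra ℂ V → Prop
  | bracket (p q : ZMod 2) (x y : V) (hx : x ∈ 𝔤.part p) (hy : y ∈ 𝔤.part q) :
      Rel (TensorAlgebra.ι ℂ x * TensorAlgebra.ι ℂ y
          - koszul p q • (TensorAlgebra.ι ℂ y * TensorAlgebra.ι ℂ x))
        (TensorAlgebra.ι ℂ (𝔤.bracket x y))

/-- The universal enveloping algebra of a Lie superalgebra. -/
def U : Type u := RingQuot 𝔤.Rel

instance : Ring 𝔤.U := inferInstanceAs (Ring (RingQuot 𝔤.Rel))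
instance : Algebra ℂ 𝔤.U := inferInstanceAs (Algebra ℂ (RingQuot 𝔤.Rel))

/-- The quotient map from the tensor algebra. -/
def mkU : TensorAlgebra ℂ V →ₐ[ℂ] 𝔤.U := RingQuot.mkAlgHom ℂ 𝔤.Rel

/-- The canonical map into the enveloping algebra. -/
def toU : V →ₗ[ℂ] 𝔤.U := 𝔤.mkU.toLinearMap ∘ₗ TensorAlgebra.ι ℂ

theorem toU_rel (p q : ZMod 2) (x y : V) (hx : x ∈ 𝔤.part p) (hy : y ∈ 𝔤.part q) :
    𝔤.toU x * 𝔤.toU y - koszul p q • (𝔤.toU y * 𝔤.toU x) = 𝔤.toU (𝔤.bracket x y) := by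
  have h : 𝔤.mkU _ = 𝔤.mkU _ := RingQuot.mkAlgHom_rel ℂ (Rel.bracket (𝔤 := 𝔤) p q x y hx hy)
  rw [map_sub, map_smul, map_mul, map_mul] at h
  exact h

/-- The algebra homomorphism out of `U(𝔤)` given by a representation of `𝔤`. -/
def liftU {A : Type v} [Ring A] [Algebra ℂ A] (f : V →ₗ[ℂ] A)
    (hf : ∀ p q x y, x ∈ 𝔤.part p → y ∈ 𝔤.part q →
      f x * f y - koszul p q • (f y * f x) = f (𝔤.bracket x y)) : 𝔤.U →ₐ[ℂ] A :=
  RingQuot.liftAlgHom ℂ ⟨TensorAlgebra.lift ℂ f, by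
    rintro _ _ ⟨p, q, x, y, hx, hy⟩
    simpa using hf p q x y hx hy⟩

theorem liftU_toU {A : Type v} [Ring A] [Algebra ℂ A] (f : V →ₗ[ℂ] A)
    (hf : ∀ p q x y, x ∈ 𝔤.part p → y ∈ 𝔤.part q →
      f x * f y - koszul p q • (f y * f x) = f (𝔤.bracket x y)) (x : V) :
    𝔤.liftU f hf (𝔤.toU x) = f x := by
  refine (RingQuot.liftAlgHom_mkAlgHom_apply ℂ (TensorAlgebra.lift ℂ f) _ _).trans ?_
  rw [TensorAlgebra.lift_ι_apply]

variable (K : V)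

/-- The relation `K = 1`. -/
inductive KRel : 𝔤.U → 𝔤.U → Prop
  | K_eq_one : KRel (𝔤.toU K) 1

/-- `U₁(𝔤) = U(𝔤)/(K - 1)`. -/
def U₁ : Type u := RingQuot (𝔤.KRel K)

instance : Ring (𝔤.U₁ K) := inferInstanceAs (Ring (RingQuot (𝔤.KRel K)))
instance : Algebra ℂ (𝔤.U₁ K) := inferInstanceAs (Algebra ℂ (RingQuot (𝔤.KRel K)))

/-- The quotient map `U(𝔤) → U₁(𝔤)`. -/
def mkU₁ : 𝔤.U →ₐ[ℂ] 𝔤.U₁ K := RingQuot.mkAlgHom ℂ (𝔤.KRel K)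

/-- The canonical map `𝔤 → U₁(𝔤)`. -/
def toU₁ : V →ₗ[ℂ] 𝔤.U₁ K := (𝔤.mkU₁ K).toLinearMap ∘ₗ 𝔤.toU

/-- The algebra homomorphism out of `U₁(𝔤)` given by a representation of `𝔤` with `K ↦ 1`. -/
def liftU₁ {A : Type v} [Ring A] [Algebra ℂ A] (f : V →ₗ[ℂ] A)
    (hf : ∀ p q x y, x ∈ 𝔤.part p → y ∈ 𝔤.part q →
      f x * f y - koszul p q • (f y * f x) = f (𝔤.bracket x y)) (hK : f K = 1) :
    𝔤.U₁ K →ₐ[ℂ] A :=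
  RingQuot.liftAlgHom ℂ ⟨𝔤.liftU f hf, by
    rintro _ _ ⟨⟩
    rw [liftU_toU, hK, map_one]⟩

/-- The component of degree `n` of `U₁(𝔤)`. -/
def degU₁ (n : ℤ) : Submodule ℂ (𝔤.U₁ K) := wordSpan (𝔤.toU₁ K) 𝔤.deg n

/-- The left ideal of `U₁(𝔤)` generated by all elements of degree at least `N`; it is spanned by
the products `u v` with `v` of degree at least `N`. -/
def tail (N : ℤ) : Submodule (𝔤.U₁ K) (𝔤.U₁ K) :=
  Submodule.span (𝔤.U₁ K) {a | ∃ n, N ≤ n ∧ a ∈ 𝔤.degU₁ K n}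

theorem tail_anti {M N : ℤ} (h : M ≤ N) : 𝔤.tail K N ≤ 𝔤.tail K M :=
  Submodule.span_mono fun _ ⟨n, hn, ha⟩ => ⟨n, h.trans hn, ha⟩

theorem degU₁_mul (n d : ℤ) (x : V) (hx : x ∈ 𝔤.deg d) (a : 𝔤.U₁ K) (ha : a ∈ 𝔤.degU₁ K n) :
    a * 𝔤.toU₁ K x ∈ 𝔤.degU₁ K (n + d) := by
  unfold degU₁ wordSpan at ha
  induction ha using Submodule.span_induction with
  | mem a ha =>
    obtain ⟨l, hl, hn, rfl⟩ := ha
    refine Submodule.subset_span ⟨l ++ [(d, x)], ?_, ?_, ?_⟩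
    · intro p hp
      rcases List.mem_append.1 hp with hp | hp
      · exact hl p hp
      · rw [List.mem_singleton.1 hp]; exact hx
    · simp [hn]
    · simp
  | zero => simp
  | add a b _ _ ha hb => rw [add_mul]; exact add_mem ha hb
  | smul c a _ ha => rw [smul_mul_assoc]; exact Submodule.smul_mem _ _ ha

theorem tail_mul (N d : ℤ) (x : V) (hx : x ∈ 𝔤.deg d) (a : 𝔤.U₁ K) (ha : a ∈ 𝔤.tail K (N - d)) :
    a * 𝔤.toU₁ K x ∈ 𝔤.tail K N := by
  unfold tail at ha
  induction ha using Submodule.span_induction with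
  | mem a ha =>
    obtain ⟨n, hn, ha⟩ := ha
    exact Submodule.subset_span ⟨n + d, by omega, 𝔤.degU₁_mul K n d x hx a ha⟩
  | zero => simp
  | add a b _ _ ha hb => rw [add_mul]; exact add_mem ha hb
  | smul c a _ ha =>
    rw [smul_eq_mul, mul_assoc, ← smul_eq_mul]; exact Submodule.smul_mem _ _ ha

theorem exists_tail_mul (x : 𝔤.U₁ K) :
    ∀ N : ℤ, ∃ M : ℤ, ∀ a ∈ 𝔤.tail K M, a * x ∈ 𝔤.tail K N := by
  obtain ⟨y, rfl⟩ := RingQuot.mkAlgHom_surjective ℂ (𝔤.KRel K) x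
  obtain ⟨t, rfl⟩ := RingQuot.mkAlgHom_surjective ℂ 𝔤.Rel y
  change ∀ N : ℤ, ∃ M : ℤ, ∀ a ∈ 𝔤.tail K M, a * ((𝔤.mkU₁ K).comp 𝔤.mkU t) ∈ 𝔤.tail K N
  induction t using TensorAlgebra.induction with
  | algebraMap r =>
    intro N
    refine ⟨N, fun a ha => ?_⟩
    rw [AlgHom.commutes, ← Algebra.commutes, ← smul_eq_mul]
    exact Submodule.smul_mem _ _ ha
  | ι v =>
    have hv : v ∈ ⨆ n, 𝔤.deg n := by
      rw [𝔤.deg_internal.submodule_iSup_eq_top]; trivial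
    change ∀ N : ℤ, ∃ M : ℤ, ∀ a ∈ 𝔤.tail K M, a * 𝔤.toU₁ K v ∈ 𝔤.tail K N
    induction hv using Submodule.iSup_induction' with
    | mem d x hx => exact fun N => ⟨N - d, 𝔤.tail_mul K N d x hx⟩
    | zero => exact fun N => ⟨N, by simp⟩
    | add x y _ _ hx hy =>
      intro N
      obtain ⟨M, hM⟩ := hx N
      obtain ⟨M', hM'⟩ := hy N
      refine ⟨max M M', fun a ha => ?_⟩
      rw [map_add, mul_add]
      exact add_mem (hM a (𝔤.tail_anti K (le_max_left _ _) ha))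
        (hM' a (𝔤.tail_anti K (le_max_right _ _) ha))
  | mul s t hs ht =>
    intro N
    obtain ⟨M, hM⟩ := ht N
    obtain ⟨M', hM'⟩ := hs M
    refine ⟨M', fun a ha => ?_⟩
    rw [map_mul, ← mul_assoc]
    exact hM _ (hM' a ha)
  | add s t hs ht =>
    intro N
    obtain ⟨M, hM⟩ := hs N
    obtain ⟨M', hM'⟩ := ht N
    refine ⟨max M M', fun a ha => ?_⟩
    rw [map_add, mul_add]
    exact add_mem (hM a (𝔤.tail_anti K (le_max_left _ _) ha))
      (hM' a (𝔤.tail_anti K (le_max_right _ _) ha))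

theorem tail_basis : RingSubgroupsBasis fun N : ℤ => (𝔤.tail K N).toAddSubgroup where
  inter i j := ⟨max i j, le_inf (𝔤.tail_anti K (le_max_left _ _))
    (𝔤.tail_anti K (le_max_right _ _))⟩
  mul i := ⟨i, by
    rintro _ ⟨a, _, b, hb, rfl⟩
    exact Submodule.smul_mem (𝔤.tail K i) a hb⟩
  leftMul x i := ⟨i, fun b hb => Submodule.smul_mem (𝔤.tail K i) x hb⟩
  rightMul x i := 𝔤.exists_tail_mul K x i

/-- The linear topology on `U₁(𝔤)` in which the left ideals `tail N` are a basis of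
neighbourhoods of `0`. -/
instance : TopologicalSpace (𝔤.U₁ K) := (𝔤.tail_basis K).topology

instance : IsTopologicalRing (𝔤.U₁ K) :=
  (𝔤.tail_basis K).toRingFilterBasis.isTopologicalRing

instance : UniformSpace (𝔤.U₁ K) := IsTopologicalAddGroup.rightUniformSpace (𝔤.U₁ K)

instance : IsUniformAddGroup (𝔤.U₁ K) := isUniformAddGroup_of_addCommGroup

/-- The completion `U₁(𝔤)^com`: infinite sums `∑ uᵢ vᵢ` are allowed if for every `N` only
finitely many of the `vᵢ` have degree less than `N`. -/
abbrev U₁com : Type u := UniformSpace.Completion (𝔤.U₁ K)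

/-- For a second grading `g` of `𝔤`, the subspace of `U₁(𝔤)^com` of elements of degree `n`
for that grading: (infinite) sums of products of generators of total degree `n`. -/
def comPiece (g : ℤ → Submodule ℂ V) (n : ℤ) : Set (𝔤.U₁com K) :=
  closure ((fun a : 𝔤.U₁ K => (a : 𝔤.U₁com K)) '' (wordSpan (𝔤.toU₁ K) g n : Set (𝔤.U₁ K)))

/-- A representation of `U₁(𝔤)` is smooth if every vector is killed by all elements of
sufficiently high degree. -/
def IsSmooth {W : Type v} [AddCommGroup W] [Module ℂ W]
    (Φ : 𝔤.U₁ K →ₐ[ℂ] Module.End ℂ W) : Prop :=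
  ∀ x : W, ∃ N : ℤ, ∀ n, N ≤ n → ∀ a ∈ 𝔤.degU₁ K n, Φ a x = 0

/-- The action of the completion on a smooth representation: the continuous extension of
`a ↦ Φ a x`, where `W` is discrete. -/
def act {W : Type v} [AddCommGroup W] [Module ℂ W]
    (Φ : 𝔤.U₁ K →ₐ[ℂ] Module.End ℂ W) (a : 𝔤.U₁com K) (x : W) : W :=
  letI : UniformSpace W := ⊥
  UniformSpace.Completion.extension (fun b : 𝔤.U₁ K => Φ b x) a

end GradedLieSuper

/-! ### Quasi-finite graded Lie algebras -/

theorem isInternal_prod {V : Type u} {W : Type v} [AddCommGroup V] [Module ℂ V]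
    [AddCommGroup W] [Module ℂ W] {g : ℤ → Submodule ℂ V} {h : ℤ → Submodule ℂ W}
    (hg : DirectSum.IsInternal g) (hh : DirectSum.IsInternal h) :
    DirectSum.IsInternal fun n => (g n).prod (h n) := by
  rw [DirectSum.isInternal_submodule_iff_iSupIndep_and_iSup_eq_top] at *
  refine ⟨?_, ?_⟩
  · rw [iSupIndep_iff_finsetSum_eq_zero_imp_eq_zero]
    intro s v hv hs i hi
    have h1 := (iSupIndep_iff_finsetSum_eq_zero_imp_eq_zero g).1 hg.1 s
      (fun i => (v i).1) (fun i hi => (hv i hi).1)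
      (by simpa [Prod.fst_sum] using congrArg Prod.fst hs) i hi
    have h2 := (iSupIndep_iff_finsetSum_eq_zero_imp_eq_zero h).1 hh.1 s
      (fun i => (v i).2) (fun i hi => (hv i hi).2)
      (by simpa [Prod.snd_sum] using congrArg Prod.snd hs) i hi
    exact Prod.ext h1 h2
  · rw [eq_top_iff]
    rintro ⟨a, b⟩ -
    have ha : a ∈ ⨆ n, g n := hg.2 ▸ Submodule.mem_top
    have hb : b ∈ ⨆ n, h n := hh.2 ▸ Submodule.mem_top
    have h1 : (a, (0 : W)) ∈ ⨆ n, (g n).prod (h n) := by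
      have := Submodule.mem_map_of_mem (f := LinearMap.inl ℂ V W) ha
      rw [Submodule.map_iSup] at this
      refine (iSup_mono (fun n => ?_) : _ ≤ ⨆ n, (g n).prod (h n)) this
      rintro _ ⟨x, hx, rfl⟩
      exact ⟨hx, zero_mem _⟩
    have h2 : ((0 : V), b) ∈ ⨆ n, (g n).prod (h n) := by
      have := Submodule.mem_map_of_mem (f := LinearMap.inr ℂ V W) hb
      rw [Submodule.map_iSup] at this
      refine (iSup_mono (fun n => ?_) : _ ≤ ⨆ n, (g n).prod (h n)) this
      rintro _ ⟨x, hx, rfl⟩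
      exact ⟨zero_mem _, hx⟩
    simpa using add_mem h1 h2

theorem isInternal_comap {V : Type u} [AddCommGroup V] [Module ℂ V] {g : ℤ → Submodule ℂ V}
    (hg : iSupIndep g) (F : Submodule ℂ V) (hF : F ≤ ⨆ n, F ⊓ g n) :
    DirectSum.IsInternal fun n => (g n).comap F.subtype := by
  rw [DirectSum.isInternal_submodule_iff_iSupIndep_and_iSup_eq_top]
  refine ⟨?_, ?_⟩
  · rw [iSupIndep_iff_finsetSum_eq_zero_imp_eq_zero]
    intro s v hv hs i hi
    have h1 := (iSupIndep_iff_finsetSum_eq_zero_imp_eq_zero g).1 hg s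
      (fun i => (v i : V)) (fun i hi => hv i hi) (by simpa using congrArg F.subtype hs) i hi
    exact Subtype.ext h1
  · apply Submodule.map_injective_of_injective F.injective_subtype
    rw [Submodule.map_iSup, Submodule.map_top, Submodule.range_subtype]
    simp only [Submodule.map_comap_subtype]
    exact le_antisymm (iSup_le fun n => inf_le_left) hF

/-- The trivial grading of `ℂ`, concentrated in degree `0`. -/
def scalarDeg (n : ℤ) : Submodule ℂ ℂ := if n = 0 then ⊤ else ⊥

theorem isInternal_scalarDeg : DirectSum.IsInternal scalarDeg := by
  rw [DirectSum.isInternal_submodule_iff_iSupIndep_and_iSup_eq_top]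
  refine ⟨?_, eq_top_iff.2 (le_trans (by simp [scalarDeg]) (le_iSup scalarDeg 0))⟩
  rw [iSupIndep_iff_finsetSum_eq_zero_imp_eq_zero]
  intro s v hv hs i hi
  have h0 : ∀ j ∈ s, j ≠ 0 → v j = 0 := fun j hj h => by
    simpa [scalarDeg, h] using hv j hj
  by_cases h : i = 0
  · subst h
    rw [← hs]
    exact (Finset.sum_eq_single_of_mem 0 hi h0).symm
  · exact h0 i hi h

/-- A quasi-finite `ℤ`-graded complex Lie algebra `L = ⨁ L_n` together with a homogeneous basis
`(e_i)_{i ∈ ℤ}`, ordered by degree with steps at most one, such that `(e_i)_{i ≤ 0}` spans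
`L_{≤ 0}` and `(e_i)_{i > 0}` spans `L_+`. -/
structure QuasiFinite (L : Type u) [LieRing L] [LieAlgebra ℂ L] where
  gr : ℤ → Submodule ℂ L
  internal : DirectSum.IsInternal gr
  finite : ∀ n, FiniteDimensional ℂ (gr n)
  lie_mem : ∀ m n x y, x ∈ gr m → y ∈ gr n → ⁅x, y⁆ ∈ gr (m + n)
  e : Module.Basis ℤ ℂ L
  edeg : ℤ → ℤ
  e_mem : ∀ i, e i ∈ gr (edeg i)
  edeg_succ : ∀ i, edeg (i + 1) = edeg i ∨ edeg (i + 1) = edeg i + 1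
  edeg_nonpos : ∀ i, edeg i ≤ 0 ↔ i ≤ 0

namespace QuasiFinite

variable {L : Type u} [LieRing L] [LieAlgebra ℂ L] (Q : QuasiFinite L)

/-- `L^*_n = Hom(L_{-n}, ℂ)`, as the space of functionals on `L` vanishing on `L_m`
for all `m ≠ -n`. -/
def dualGr (n : ℤ) : Submodule ℂ (Module.Dual ℂ L) where
  carrier := {f | ∀ m, m ≠ -n → ∀ x ∈ Q.gr m, f x = 0}
  add_mem' := fun hf hg m hm x hx => by simp [hf m hm x hx, hg m hm x hx]
  zero_mem' := fun _ _ _ _ => rfl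
  smul_mem' := fun c f hf m hm x hx => by simp [hf m hm x hx]

/-- The restricted dual `L^* = ⨁ L^*_n`. -/
def rdual : Submodule ℂ (Module.Dual ℂ L) := ⨆ n, Q.dualGr n

theorem ext_of_gr {f : Module.Dual ℂ L} (h : ∀ n, ∀ x ∈ Q.gr n, f x = 0) : f = 0 := by
  have : (⨆ n, Q.gr n) ≤ LinearMap.ker f := iSup_le fun n x hx => h n x hx
  rw [Q.internal.submodule_iSup_eq_top] at this
  exact LinearMap.ker_eq_top.1 (top_le_iff.1 this)

theorem dualGr_indep : iSupIndep Q.dualGr := by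
  rw [iSupIndep_iff_finsetSum_eq_zero_imp_eq_zero]
  intro s v hv hs i hi
  refine Q.ext_of_gr fun n x hx => ?_
  by_cases h : n = -i
  · have h0 := LinearMap.congr_fun hs x
    rw [LinearMap.sum_apply, Finset.sum_eq_single_of_mem i hi] at h0
    · exact h0
    · intro j hj hji
      exact hv j hj n (by omega) x hx
  · exact hv i hi n h x hx

theorem rdual_internal :
    DirectSum.IsInternal fun n => (Q.dualGr n).comap Q.rdual.subtype :=
  isInternal_comap Q.dualGr_indep _
    (iSup_le fun n => le_iSup_of_le n (le_inf (le_iSup Q.dualGr n) le_rfl))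

theorem finite_edeg (n : ℤ) : {i | Q.edeg i = n}.Finite := by
  have := Q.finite n
  have hm : ∀ i : {i | Q.edeg i = n}, Q.e i ∈ Q.gr n := fun ⟨i, hi⟩ => by
    have h : Q.edeg i = n := hi
    exact h ▸ Q.e_mem i
  have h : LinearIndependent ℂ fun i : {i | Q.edeg i = n} => (⟨Q.e i, hm i⟩ : Q.gr n) := by
    apply LinearIndependent.of_comp (Q.gr n).subtype
    exact Q.e.linearIndependent.comp _ Subtype.val_injective
  have := h.finite
  exact Set.toFinite _

theorem repr_eq_zero {m i : ℤ} (hi : Q.edeg i ≠ m) {x : L} (hx : x ∈ Q.gr m) :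
    Q.e.repr x i = 0 := by
  classical
  set S := (Q.e.repr x).support
  set v : ℤ → L := fun n => (∑ j ∈ S with Q.edeg j = n, Q.e.repr x j • Q.e j)
    - if n = m then x else 0
  have hv := (iSupIndep_iff_finsetSum_eq_zero_imp_eq_zero Q.gr).1
    Q.internal.submodule_iSupIndep (insert m (S.image Q.edeg)) v (by
      intro n _
      refine sub_mem (sum_mem fun j hj => ?_) ?_
      · rw [← (Finset.mem_filter.1 hj).2]
        exact Submodule.smul_mem _ _ (Q.e_mem j)
      · split_ifs with h
        · exact h ▸ hx
        · exact zero_mem _) (by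
      simp only [v]
      rw [Finset.sum_sub_distrib, Finset.sum_fiberwise_of_maps_to
        (fun j hj => Finset.mem_insert_of_mem (Finset.mem_image_of_mem _ hj)),
        Finset.sum_ite_eq', if_pos (Finset.mem_insert_self _ _), sub_eq_zero]
      exact Q.e.linearCombination_repr x)
  by_contra h
  have hS : i ∈ S := Finsupp.mem_support_iff.2 h
  have h1 := hv (Q.edeg i) (Finset.mem_insert_of_mem (Finset.mem_image_of_mem _ hS))
  simp only [v, if_neg hi, sub_zero] at h1
  exact h (linearIndependent_iff'.1 Q.e.linearIndependent _ _ h1 i (by simp [hS]))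

theorem finite_support (f : Q.rdual) : (Function.support fun i => f.1 (Q.e i)).Finite := by
  obtain ⟨f, hf⟩ := f
  unfold rdual at hf
  induction hf using Submodule.iSup_induction' with
  | mem n f hf =>
    refine (Q.finite_edeg (-n)).subset fun i hi => ?_
    by_contra h
    exact hi (hf _ h _ (Q.e_mem i))
  | zero => simp
  | add f g _ _ hf hg =>
    refine (hf.union hg).subset fun i hi => ?_
    by_contra h
    simp only [Set.mem_union, Function.mem_support, not_or, not_not] at h
    exact hi (by simp [h.1, h.2])

/-- The coordinates `f ↦ (f (e_i))_i` of elements of the restricted dual in the dual basis. -/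
def coords : Q.rdual →ₗ[ℂ] (ℤ →₀ ℂ) where
  toFun f := Finsupp.ofSupportFinite _ (Q.finite_support f)
  map_add' _ _ := by ext; rfl
  map_smul' _ _ := by ext; rfl

theorem coords_apply (f : Q.rdual) (i : ℤ) : Q.coords f i = f.1 (Q.e i) := rfl

/-- The dual basis element `e_i^*`. -/
def estar (i : ℤ) : Q.rdual :=
  ⟨Q.e.coord i, by
    refine Submodule.mem_iSup_of_mem (-Q.edeg i) fun m hm x hx => ?_
    exact Q.repr_eq_zero (by omega) hx⟩

/-! ### The Lie superalgebra `cl(L)` -/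

/-- The underlying space `ι(L) ⊕ ε(L^*) ⊕ ℂ K` of `cl(L)`. -/
abbrev Cl : Type u := L × Q.rdual × ℂ

/-- The bracket `[ι x + ε f + a K, ι y + ε g + b K] = (g x + f y) K`. -/
def clBracket : Q.Cl →ₗ[ℂ] Q.Cl →ₗ[ℂ] Q.Cl :=
  LinearMap.mk₂ ℂ (fun a b => (0, 0, b.2.1.1 a.1 + a.2.1.1 b.1))
    (fun a b c => by ext <;> simp; ring) (fun c a b => by ext <;> simp; ring)
    (fun a b c => by ext <;> simp; ring) (fun c a b => by ext <;> simp; ring)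

theorem clBracket_apply (a b : Q.Cl) :
    Q.clBracket a b = (0, 0, b.2.1.1 a.1 + a.2.1.1 b.1) := rfl

/-- The odd part `ι(L) ⊕ ε(L^*)` and the even part `ℂ K` of `cl(L)`. -/
def clPart (p : ZMod 2) : Submodule ℂ Q.Cl :=
  if p = 0 then (⊥ : Submodule ℂ L).prod ((⊥ : Submodule ℂ Q.rdual).prod ⊤)
  else (⊤ : Submodule ℂ L).prod ((⊤ : Submodule ℂ Q.rdual).prod ⊥)

/-- `cl(L)_n`, with `ι(L_n)` and `ε(L^*_n)` in degree `n` and `K` in degree `0`. -/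
def clDeg (n : ℤ) : Submodule ℂ Q.Cl :=
  (Q.gr n).prod (((Q.dualGr n).comap Q.rdual.subtype).prod (scalarDeg n))

theorem parity (p : ZMod 2) : p = 0 ∨ p = 1 := by revert p; decide

theorem mem_clPart_zero {a : Q.Cl} : a ∈ Q.clPart 0 ↔ a.1 = 0 ∧ a.2.1 = 0 := by
  simp [clPart, Submodule.mem_prod]

theorem mem_clPart_one {a : Q.Cl} : a ∈ Q.clPart 1 ↔ a.2.2 = 0 := by
  simp [clPart, Submodule.mem_prod]

theorem mem_scalarDeg {n : ℤ} {c : ℂ} : c ∈ scalarDeg n ↔ (n ≠ 0 → c = 0) := by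
  by_cases h : n = 0 <;> simp [scalarDeg, h]

theorem mem_clDeg {n : ℤ} {a : Q.Cl} :
    a ∈ Q.clDeg n ↔ a.1 ∈ Q.gr n ∧ a.2.1.1 ∈ Q.dualGr n ∧ (n ≠ 0 → a.2.2 = 0) := by
  simp [clDeg, Submodule.mem_prod, mem_scalarDeg]

theorem clBracket_deg (m n : ℤ) (a b : Q.Cl) (ha : a ∈ Q.clDeg m) (hb : b ∈ Q.clDeg n) :
    Q.clBracket a b ∈ Q.clDeg (m + n) := by
  rw [mem_clDeg] at *
  refine ⟨zero_mem _, zero_mem _, fun h => ?_⟩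
  rw [clBracket_apply]
  simp only
  rw [hb.2.1 m (by omega) _ ha.1, ha.2.1 n (by omega) _ hb.1, add_zero]

/-- The Lie superalgebra `cl(L)`. -/
def cl : GradedLieSuper Q.Cl where
  part := Q.clPart
  deg := Q.clDeg
  bracket := Q.clBracket
  isCompl_part := by
    rw [isCompl_iff, disjoint_iff, codisjoint_iff, eq_bot_iff, eq_top_iff]
    refine ⟨fun a ha => ?_, fun a _ => ?_⟩
    · obtain ⟨h0, h1⟩ := Submodule.mem_inf.1 ha
      rw [mem_clPart_zero] at h0
      rw [mem_clPart_one] at h1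
      exact Prod.ext h0.1 (Prod.ext h0.2 h1)
    · refine Submodule.mem_sup.2 ⟨(0, 0, a.2.2), Q.mem_clPart_zero.2 ⟨rfl, rfl⟩,
        (a.1, a.2.1, 0), Q.mem_clPart_one.2 rfl, by ext <;> simp⟩
  deg_internal := isInternal_prod Q.internal (isInternal_prod Q.rdual_internal isInternal_scalarDeg)
  deg_part n a ha := by
    rw [mem_clDeg] at ha
    refine Submodule.mem_sup.2 ⟨(0, 0, a.2.2), ⟨Q.mem_clDeg.2 ⟨zero_mem _, zero_mem _, ha.2.2⟩,
      Q.mem_clPart_zero.2 ⟨rfl, rfl⟩⟩, (a.1, a.2.1, 0),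
      ⟨Q.mem_clDeg.2 ⟨ha.1, ha.2.1, fun _ => rfl⟩, Q.mem_clPart_one.2 rfl⟩, by ext <;> simp⟩
  bracket_part p q a b ha hb := by
    rcases parity p with rfl | rfl <;> rcases parity q with rfl | rfl
    · exact Q.mem_clPart_zero.2 ⟨rfl, rfl⟩
    · rw [mem_clPart_zero] at ha
      refine Q.mem_clPart_one.2 ?_
      simp [clBracket_apply, ha.1, ha.2]
    · rw [mem_clPart_zero] at hb
      refine Q.mem_clPart_one.2 ?_
      simp [clBracket_apply, hb.1, hb.2]
    · exact Q.mem_clPart_zero.2 ⟨rfl, rfl⟩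
  bracket_deg := Q.clBracket_deg
  skew p q a b ha hb := by
    rcases parity p with rfl | rfl
    · rw [mem_clPart_zero] at ha
      ext <;> simp [clBracket_apply, ha.1, ha.2]
    · rcases parity q with rfl | rfl
      · rw [mem_clPart_zero] at hb
        ext <;> simp [clBracket_apply, hb.1, hb.2]
      · ext <;> simp [clBracket_apply, koszul, add_comm]
  jacobi p q a b c ha hb := by
    ext <;> simp [clBracket_apply]

/-- The central element `K` of `cl(L)`. -/
def clK : Q.Cl := (0, 0, 1)

/-! ### Normally ordered sums -/

section NormalOrder

variable {A : Type v} [Ring A] [Algebra ℂ A] (i : L →ₗ[ℂ] A) (ε : Q.rdual →ₗ[ℂ] A)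

/-- The normally ordered product `:ι(e_k) ε(e_j^*):`. -/
def normal₂ (k j : ℤ) : A :=
  if k = j ∧ 0 < k then -(ε (Q.estar j) * i (Q.e k)) else i (Q.e k) * ε (Q.estar j)

/-- The normally ordered product `:ι(e_k) ε(e_j^*) ε(e_l^*):`. (The annihilation operators are the
`ι(e_k)` with `k > 0` and the `ε(e_j^*)` with `j ≤ 0`; operators `ε` anticommute, so only the
place of `ι(e_k)` matters.) -/
def normal₃ (k j l : ℤ) : A :=
  if 0 < k then ε (Q.estar j) * ε (Q.estar l) * i (Q.e k)
  else i (Q.e k) * ε (Q.estar j) * ε (Q.estar l)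

/-- The term `:ι([x, e_j]) ε(e_j^*):`, by linearity of normal ordering. -/
def rhoTerm (x : L) (j : ℤ) : A :=
  (Q.e.repr ⁅x, Q.e j⁆).sum fun k c => c • Q.normal₂ i ε k j

/-- The term `:ι([e_j, e_l]) ε(e_j^*) ε(e_l^*):`, by linearity of normal ordering. -/
def cubicTerm (j l : ℤ) : A :=
  (Q.e.repr ⁅Q.e j, Q.e l⁆).sum fun k c => c • Q.normal₃ i ε k j l

variable [UniformSpace A] [IsTopologicalRing A] [IsUniformAddGroup A]

/-- `ρ^β(x) = ∑_j :ι([x, e_j]) ε(e_j^*): + β(x)` in the completion of `A`. -/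
def rho (β : Module.Dual ℂ L) (x : L) : UniformSpace.Completion A :=
  (∑' j : ℤ, ((Q.rhoTerm i ε x j : A) : UniformSpace.Completion A))
    + ((algebraMap ℂ A (β x) : A) : UniformSpace.Completion A)

end NormalOrder

/-! ### The cocycle `γ^β` -/

/-- An alternating bilinear form on `L` with `g(L_m, L_n) = 0` for `m + n ≠ 0`. -/
structure Form where
  form : L →ₗ[ℂ] L →ₗ[ℂ] ℂ
  alt : ∀ x, form x x = 0
  deg : ∀ m n, m + n ≠ 0 → ∀ x ∈ Q.gr m, ∀ y ∈ Q.gr n, form x y = 0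

/-- The map `ι : L → U₁(cl(L))`. -/
def clI : L →ₗ[ℂ] Q.cl.U₁ Q.clK := Q.cl.toU₁ Q.clK ∘ₗ LinearMap.inl ℂ _ _

/-- The map `ε : L^* → U₁(cl(L))`. -/
def clE : Q.rdual →ₗ[ℂ] Q.cl.U₁ Q.clK :=
  Q.cl.toU₁ Q.clK ∘ₗ LinearMap.inr ℂ _ _ ∘ₗ LinearMap.inl ℂ _ _

/-- `ρ^β(x)` as an element of `U₁(cl(L))^com`. -/
def rhoCl (β : Module.Dual ℂ L) (x : L) : Q.cl.U₁com Q.clK := Q.rho Q.clI Q.clE β x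

/-- `g` is the form `γ^β`: `[ρ^β(x), ρ^β(y)] - ρ^β([x, y])` is the constant `g(x, y)`
in `U₁(cl(L))^com`. -/
def IsGamma (β : Module.Dual ℂ L) (g : Q.Form) : Prop :=
  ∀ x y, Q.rhoCl β x * Q.rhoCl β y - Q.rhoCl β y * Q.rhoCl β x - Q.rhoCl β ⁅x, y⁆
    = (algebraMap ℂ (Q.cl.U₁ Q.clK) (g.form x y) : Q.cl.U₁com Q.clK)

open Classical in
/-- The 2-cocycle `γ^β(x, y) = [ρ^β(x), ρ^β(y)] - ρ^β([x, y])`. -/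
def gamma (β : Module.Dual ℂ L) : Q.Form :=
  if h : ∃ g, Q.IsGamma β g then h.choose
  else ⟨0, fun _ => rfl, fun _ _ _ _ _ _ _ => rfl⟩

/-- The radical `ker γ = {x | γ(x, L) = 0}`. -/
def Form.radical {Q : QuasiFinite L} (g : Q.Form) : Submodule ℂ L := LinearMap.ker g.form

/-- A graded complement `F_β` of `ker γ^β` in `L`. -/
structure Complement (β : Module.Dual ℂ L) where
  F : Submodule ℂ L
  graded : F ≤ ⨆ n, F ⊓ Q.gr n
  isCompl : IsCompl F (Q.gamma β).radical

/-! ### The Lie superalgebras `ϵ(F_β) ⊕ ℂ K` and `s(L)` -/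

end QuasiFinite

namespace QuasiFinite.Complement

open QuasiFinite

variable {L : Type u} [LieRing L] [LieAlgebra ℂ L] {Q : QuasiFinite L} {β : Module.Dual ℂ L}
  (C : Q.Complement β)

/-- The projection `L → F_β` along `ker γ^β`. -/
def proj : L →ₗ[ℂ] C.F := C.F.projectionOnto (Q.gamma β).radical C.isCompl

/-- The form `γ^β` on `F_β`. -/
def form : C.F →ₗ[ℂ] C.F →ₗ[ℂ] ℂ := (Q.gamma β).form.domRestrict₁₂ C.F C.F

theorem form_apply (x y : C.F) : C.form x y = (Q.gamma β).form x y := rfl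

theorem form_skew (x y : C.F) : C.form x y = -C.form y x := by
  have h := (Q.gamma β).alt ((x : L) + y)
  simp only [map_add, LinearMap.add_apply, (Q.gamma β).alt, zero_add, add_zero] at h
  rw [form_apply, form_apply]
  linear_combination h

/-- The grading of `F_β`. -/
def FDeg (n : ℤ) : Submodule ℂ C.F := (Q.gr n).comap C.F.subtype

theorem FDeg_internal : DirectSum.IsInternal C.FDeg :=
  isInternal_comap Q.internal.submodule_iSupIndep C.F C.graded

theorem form_deg (m n : ℤ) (h : m + n ≠ 0) (x y : C.F) (hx : x ∈ C.FDeg m) (hy : y ∈ C.FDeg n) :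
    C.form x y = 0 :=
  (Q.gamma β).deg m n h x hx y hy

/-- The bracket `[ϵ x + a K, ϵ y + b K] = -γ^β(x, y) K` on `ϵ(F_β) ⊕ ℂ K`. -/
def heisBracket : (C.F × ℂ) →ₗ[ℂ] (C.F × ℂ) →ₗ[ℂ] (C.F × ℂ) :=
  LinearMap.mk₂ ℂ (fun a b => (0, -C.form a.1 b.1))
    (fun a b c => by ext <;> simp; ring) (fun c a b => by ext <;> simp)
    (fun a b c => by ext <;> simp; ring) (fun c a b => by ext <;> simp)

theorem heisBracket_apply (a b : C.F × ℂ) : C.heisBracket a b = (0, -C.form a.1 b.1) := rfl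

/-- The purely even graded Lie superalgebra `ϵ(F_β) ⊕ ℂ K`. -/
def heis : GradedLieSuper (C.F × ℂ) where
  part p := if p = 0 then ⊤ else ⊥
  deg n := (C.FDeg n).prod (scalarDeg n)
  bracket := C.heisBracket
  isCompl_part := by simpa using isCompl_top_bot
  deg_internal := isInternal_prod C.FDeg_internal isInternal_scalarDeg
  deg_part n := by simp
  bracket_part p q a b ha hb := by
    rcases parity p with rfl | rfl <;> rcases parity q with rfl | rfl <;>
      simp_all [heisBracket_apply]
  bracket_deg m n a b ha hb := by
    refine ⟨zero_mem _, mem_scalarDeg.2 fun h => ?_⟩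
    change -C.form a.1 b.1 = 0
    rw [C.form_deg m n h _ _ ha.1 hb.1, neg_zero]
  skew p q a b ha hb := by
    rw [heisBracket_apply, heisBracket_apply, C.form_skew]
    rcases parity p with rfl | rfl
    · simp [koszul]
    · have ha' : a = 0 := by simpa using ha
      simp [ha']
  jacobi p q a b c ha hb := by
    ext <;> simp [heisBracket_apply]

/-- The underlying space `L ⊕ cl(L) ⊕ ϵ(F_β)` of `s(L)`. -/
abbrev S : Type u := L × Q.Cl × C.F

/-- The bracket of `s(L) = L ⊕ c(L)`, where `c(L) = cl(L) ⊕ ϵ(F_β)`: the summands `L`, `cl(L)`,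
`ϵ(F_β)` commute with each other and `[ϵ x, ϵ y] = -γ^β(x, y) K`. -/
def sBracket : C.S →ₗ[ℂ] C.S →ₗ[ℂ] C.S :=
  LinearMap.mk₂ ℂ (fun a b => (⁅a.1, b.1⁆, Q.clBracket a.2.1 b.2.1 - C.form a.2.2 b.2.2 • Q.clK, 0))
    (fun a b c => by refine Prod.ext (by simp) (Prod.ext ?_ (by simp)); simp [add_smul]; abel)
    (fun c a b => by refine Prod.ext (by simp) (Prod.ext ?_ (by simp)); simp [mul_smul, smul_sub])
    (fun a b c => by refine Prod.ext (by simp) (Prod.ext ?_ (by simp)); simp [add_smul]; abel)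
    (fun c a b => by refine Prod.ext (by simp) (Prod.ext ?_ (by simp)); simp [mul_smul, smul_sub])

theorem sBracket_apply (a b : C.S) : C.sBracket a b =
    (⁅a.1, b.1⁆, Q.clBracket a.2.1 b.2.1 - C.form a.2.2 b.2.2 • Q.clK, 0) := rfl

/-- The parity of `s(L)`: `L` and `ϵ(F_β)` are even. -/
def sPart (p : ZMod 2) : Submodule ℂ C.S :=
  if p = 0 then (⊤ : Submodule ℂ L).prod ((Q.clPart 0).prod ⊤)
  else (⊥ : Submodule ℂ L).prod ((Q.clPart 1).prod ⊥)

/-- The degree `n` component of `s(L)`. -/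
def sDeg (n : ℤ) : Submodule ℂ C.S := (Q.gr n).prod ((Q.clDeg n).prod (C.FDeg n))

theorem mem_sPart_zero {a : C.S} : a ∈ C.sPart 0 ↔ a.2.1 ∈ Q.clPart 0 := by
  simp [sPart, Submodule.mem_prod]

theorem mem_sPart_one {a : C.S} : a ∈ C.sPart 1 ↔ a.1 = 0 ∧ a.2.1 ∈ Q.clPart 1 ∧ a.2.2 = 0 := by
  simp [sPart, Submodule.mem_prod]

theorem clBracket_clK (a : Q.Cl) (c : ℂ) : Q.clBracket a (c • Q.clK) = 0 := by
  ext <;> simp [clBracket_apply, clK]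

theorem clBracket_clK' (a : Q.Cl) (c : ℂ) : Q.clBracket (c • Q.clK) a = 0 := by
  ext <;> simp [clBracket_apply, clK]

theorem clBracket_clBracket (a b c : Q.Cl) : Q.clBracket a (Q.clBracket b c) = 0 := by
  ext <;> simp [clBracket_apply]

theorem clBracket_clBracket' (a b c : Q.Cl) : Q.clBracket (Q.clBracket b c) a = 0 := by
  ext <;> simp [clBracket_apply]

/-- The Lie superalgebra `s(L)`. -/
def s : GradedLieSuper C.S where
  part := C.sPart
  deg := C.sDeg
  bracket := C.sBracket
  isCompl_part := by
    rw [isCompl_iff, disjoint_iff, codisjoint_iff, eq_bot_iff, eq_top_iff]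
    refine ⟨fun a ha => ?_, fun a _ => ?_⟩
    · obtain ⟨h0, h1⟩ := Submodule.mem_inf.1 ha
      rw [mem_sPart_zero] at h0
      rw [mem_sPart_one] at h1
      have h : a.2.1 ∈ Q.clPart 0 ⊓ Q.clPart 1 := ⟨h0, h1.2.1⟩
      have h' : Q.clPart 0 ⊓ Q.clPart 1 = ⊥ := Q.cl.isCompl_part.inf_eq_bot
      rw [h'] at h
      exact Prod.ext h1.1 (Prod.ext h h1.2.2)
    · have h : a.2.1 ∈ Q.clPart 0 ⊔ Q.clPart 1 := by
        have h' : Q.clPart 0 ⊔ Q.clPart 1 = ⊤ := Q.cl.isCompl_part.sup_eq_top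
        rw [h']; trivial
      obtain ⟨b, hb, c, hc, h⟩ := Submodule.mem_sup.1 h
      exact Submodule.mem_sup.2 ⟨(a.1, b, a.2.2), C.mem_sPart_zero.2 hb,
        (0, c, 0), C.mem_sPart_one.2 ⟨rfl, hc, rfl⟩, by
          refine Prod.ext (by simp) (Prod.ext h (by simp))⟩
  deg_internal := isInternal_prod Q.internal (isInternal_prod Q.cl.deg_internal C.FDeg_internal)
  deg_part n a ha := by
    obtain ⟨b, hb, c, hc, h⟩ := Submodule.mem_sup.1 (Q.cl.deg_part n ha.2.1)
    exact Submodule.mem_sup.2 ⟨(a.1, b, a.2.2), ⟨⟨ha.1, hb.1, ha.2.2⟩, C.mem_sPart_zero.2 hb.2⟩,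
        (0, c, 0), ⟨⟨zero_mem _, hc.1, zero_mem _⟩, C.mem_sPart_one.2 ⟨rfl, hc.2, rfl⟩⟩, by
          refine Prod.ext (by simp) (Prod.ext h (by simp))⟩
  bracket_part p q a b ha hb := by
    have hK : ∀ c : ℂ, c • Q.clK ∈ Q.clPart 0 := fun c => Q.mem_clPart_zero.2 ⟨by simp [clK],
      by simp [clK]⟩
    rcases parity p with rfl | rfl <;> rcases parity q with rfl | rfl
    · rw [mem_sPart_zero] at ha hb
      exact C.mem_sPart_zero.2 (sub_mem (Q.cl.bracket_part 0 0 _ _ ha hb) (hK _))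
    · rw [mem_sPart_zero] at ha
      rw [mem_sPart_one] at hb
      refine C.mem_sPart_one.2 ⟨by simp [sBracket_apply, hb.1], ?_, rfl⟩
      have : Q.clBracket a.2.1 b.2.1 ∈ Q.clPart 1 := Q.cl.bracket_part 0 1 _ _ ha hb.2.1
      simpa [sBracket_apply, hb.2.2] using this
    · rw [mem_sPart_zero] at hb
      rw [mem_sPart_one] at ha
      refine C.mem_sPart_one.2 ⟨by simp [sBracket_apply, ha.1], ?_, rfl⟩
      have : Q.clBracket a.2.1 b.2.1 ∈ Q.clPart 1 := Q.cl.bracket_part 1 0 _ _ ha.2.1 hb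
      simpa [sBracket_apply, ha.2.2] using this
    · rw [mem_sPart_one] at ha hb
      exact C.mem_sPart_zero.2 (sub_mem (Q.cl.bracket_part 1 1 _ _ ha.2.1 hb.2.1) (hK _))
  bracket_deg m n a b ha hb := by
    refine ⟨Q.lie_mem m n _ _ ha.1 hb.1, sub_mem (Q.clBracket_deg m n _ _ ha.2.1 hb.2.1) ?_,
      zero_mem _⟩
    by_cases h : m + n = 0
    · exact Q.mem_clDeg.2 ⟨by simp [clK], by simp [clK], fun h' => absurd h h'⟩
    · rw [C.form_deg m n h _ _ ha.2.2 hb.2.2, zero_smul]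
      exact zero_mem _
  skew p q a b ha hb := by
    rcases parity p with rfl | rfl <;> rcases parity q with rfl | rfl
    · rw [mem_sPart_zero] at ha hb
      have := Q.cl.skew 0 0 _ _ ha hb
      change Q.clBracket _ _ = -(koszul 0 0 • Q.clBracket _ _) at this
      rw [sBracket_apply, sBracket_apply, this, C.form_skew]
      refine Prod.ext (by simp [koszul]) (Prod.ext ?_ (by simp))
      simp only [koszul, zero_ne_one, and_self, if_false, one_smul, Prod.fst_neg, Prod.snd_neg]
      module
    · rw [mem_sPart_zero] at ha
      rw [mem_sPart_one] at hb
      have := Q.cl.skew 0 1 _ _ ha hb.2.1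
      change Q.clBracket _ _ = -(koszul 0 1 • Q.clBracket _ _) at this
      rw [sBracket_apply, sBracket_apply, this, hb.1, hb.2.2]
      refine Prod.ext (by simp) (Prod.ext ?_ (by simp))
      simp
    · rw [mem_sPart_zero] at hb
      rw [mem_sPart_one] at ha
      have := Q.cl.skew 1 0 _ _ ha.2.1 hb
      change Q.clBracket _ _ = -(koszul 1 0 • Q.clBracket _ _) at this
      rw [sBracket_apply, sBracket_apply, this, ha.1, ha.2.2]
      refine Prod.ext (by simp) (Prod.ext ?_ (by simp))
      simp
    · rw [mem_sPart_one] at ha hb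
      have := Q.cl.skew 1 1 _ _ ha.2.1 hb.2.1
      change Q.clBracket _ _ = -(koszul 1 1 • Q.clBracket _ _) at this
      rw [sBracket_apply, sBracket_apply, this, ha.1, ha.2.2, hb.1, hb.2.2]
      refine Prod.ext (by simp) (Prod.ext ?_ (by simp))
      simp
  jacobi p q a b c ha hb := by
    refine Prod.ext ?_ (Prod.ext ?_ ?_)
    · rcases parity p with rfl | rfl
      · simp [sBracket_apply, koszul]
      · rw [mem_sPart_one] at ha
        simp [sBracket_apply, ha.1]
    · simp only [sBracket_apply, Prod.snd_add, Prod.fst_add, Prod.smul_snd, Prod.smul_fst, map_sub,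
        LinearMap.sub_apply, clBracket_clK, clBracket_clK', clBracket_clBracket,
        clBracket_clBracket', map_zero, LinearMap.zero_apply, zero_smul, sub_zero, smul_zero,
        add_zero]
    · simp [sBracket_apply]

/-- The central element `K` of `s(L)`. -/
def sK : C.S := (0, Q.clK, 0)

/-- The charge grading of `s(L)`: `ε(L^*)` has charge `1`, `ι(L)` has charge `-1`, and `K`, `L`
and `ϵ(F_β)` have charge `0`. -/
def charge (n : ℤ) : Submodule ℂ C.S :=
  (if n = 0 then ⊤ else ⊥ : Submodule ℂ L).prod
    (((if n = -1 then ⊤ else ⊥ : Submodule ℂ L).prod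
      ((if n = 1 then ⊤ else ⊥ : Submodule ℂ Q.rdual).prod (scalarDeg n))).prod
    (if n = 0 then ⊤ else ⊥ : Submodule ℂ C.F))

/-! ### The differential in `U₁(s(L))^com` -/

/-- `U₁(s(L))`. -/
abbrev A : Type u := C.s.U₁ C.sK

/-- `U₁(s(L))^com`. -/
abbrev Acom : Type u := C.s.U₁com C.sK

/-- The elements of charge degree `n` in `U₁(s(L))^com`. -/
def chargeCom (n : ℤ) : Set C.Acom := C.s.comPiece C.sK C.charge n

/-- The map `L → U₁(s(L))`. -/
def ell : L →ₗ[ℂ] C.A := C.s.toU₁ C.sK ∘ₗ LinearMap.inl ℂ _ _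

/-- The map `cl(L) → U₁(s(L))`. -/
def clA : Q.Cl →ₗ[ℂ] C.A := C.s.toU₁ C.sK ∘ₗ LinearMap.inr ℂ _ _ ∘ₗ LinearMap.inl ℂ _ _

/-- The map `ι : L → U₁(s(L))`. -/
def iot : L →ₗ[ℂ] C.A := C.clA ∘ₗ LinearMap.inl ℂ _ _

/-- The map `ε : L^* → U₁(s(L))`. -/
def eps : Q.rdual →ₗ[ℂ] C.A := C.clA ∘ₗ LinearMap.inr ℂ _ _ ∘ₗ LinearMap.inl ℂ _ _

/-- The map `ϵ : L → U₁(s(L))`, through the projection `L → F_β`. -/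
def gho : L →ₗ[ℂ] C.A :=
  C.s.toU₁ C.sK ∘ₗ LinearMap.inr ℂ _ _ ∘ₗ LinearMap.inr ℂ _ _ ∘ₗ C.proj

/-- `θ̄^β(x) = x + ρ^β(x) + ϵ(x)`. -/
def thetaBar (x : L) : C.Acom :=
  (C.ell x : C.Acom) + Q.rho C.iot C.eps β x + (C.gho x : C.Acom)

/-- `d^β = ∑_j e_j ε(e_j^*) - ∑_{j < l} :ι([e_j, e_l]) ε(e_j^*) ε(e_l^*): + ε(β)`. -/
def d (hβ : β ∈ Q.dualGr 0) : C.Acom :=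
  (∑' j : ℤ, ((C.ell (Q.e j) * C.eps (Q.estar j) : C.A) : C.Acom))
    - (∑' p : {p : ℤ × ℤ // p.1 < p.2}, ((Q.cubicTerm C.iot C.eps p.1.1 p.1.2 : C.A) : C.Acom))
    + (C.eps ⟨β, Submodule.mem_iSup_of_mem 0 hβ⟩ : C.Acom)

/-- `d̄^β = d^β + ∑_j ε(e_j^*) ϵ(e_j)`. -/
def dBar (hβ : β ∈ Q.dualGr 0) : C.Acom :=
  C.d hβ + ∑' j : ℤ, ((C.eps (Q.estar j) * C.gho (Q.e j) : C.A) : C.Acom)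

/-- All the series in the definitions of `ρ^β`, `d^β` and `d̄^β` converge. -/
def SeriesConverge : Prop :=
  (∀ x, Summable fun j : ℤ => ((Q.rhoTerm Q.clI Q.clE x j : Q.cl.U₁ Q.clK) : Q.cl.U₁com Q.clK)) ∧
  (∀ x, Summable fun j : ℤ => ((Q.rhoTerm C.iot C.eps x j : C.A) : C.Acom)) ∧
  (Summable fun j : ℤ => ((C.ell (Q.e j) * C.eps (Q.estar j) : C.A) : C.Acom)) ∧
  (Summable fun p : {p : ℤ × ℤ // p.1 < p.2} =>
    ((Q.cubicTerm C.iot C.eps p.1.1 p.1.2 : C.A) : C.Acom)) ∧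
  (Summable fun j : ℤ => ((C.eps (Q.estar j) * C.gho (Q.e j) : C.A) : C.Acom))

end QuasiFinite.Complement
/-! ### Semi-infinite forms -/

/-- The index sets `{i₁ > i₂ > ⋯}` of semi-infinite monomials `e_{i₁}^* ∧ e_{i₂}^* ∧ ⋯` with
`i_{k+1} = i_k - 1` for large `k`: finitely many positive integers belong to the set and finitely
many nonpositive integers do not. -/
def Maya : Type := {S : Set ℤ // (S ∩ Set.Ioi 0).Finite ∧ (Set.Iic 0 \ S).Finite}

namespace Maya

/-- Insertion of an index. -/
def ins (S : Maya) (j : ℤ) : Maya :=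
  ⟨insert j S.1, (S.2.1.insert j).subset (by
      rintro x ⟨rfl | hx, h⟩
      · exact Or.inl rfl
      · exact Or.inr ⟨hx, h⟩),
    S.2.2.subset fun _ hx => ⟨hx.1, fun h => hx.2 (Or.inr h)⟩⟩

/-- Removal of an index. -/
def del (S : Maya) (j : ℤ) : Maya :=
  ⟨S.1 \ {j}, S.2.1.subset fun _ hx => ⟨hx.1.1, hx.2⟩,
    (S.2.2.insert j).subset (by
      intro x hx
      by_cases h : x = j
      · exact Or.inl h
      · exact Or.inr ⟨hx.1, fun hS => hx.2 ⟨hS, h⟩⟩)⟩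

/-- The number of indices of the monomial larger than `j`. -/
def cnt (S : Maya) (j : ℤ) : ℕ := (S.1 ∩ Set.Ioi j).ncard

theorem finite_Ioi (S : Maya) (j : ℤ) : (S.1 ∩ Set.Ioi j).Finite := by
  refine (S.2.1.union (Set.finite_Icc j 0)).subset fun x hx => ?_
  by_cases h : 0 < x
  · exact Or.inl ⟨hx.1, h⟩
  · exact Or.inr ⟨le_of_lt hx.2, not_lt.1 h⟩

theorem cnt_ins_lt (S : Maya) {i j : ℤ} (h : i < j) : (S.ins i).cnt j = S.cnt j := by
  unfold cnt ins
  congr 1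
  ext x
  simp only [Set.mem_inter_iff, Set.mem_insert_iff, Set.mem_Ioi]
  constructor
  · rintro ⟨rfl | h1, h2⟩
    · omega
    · exact ⟨h1, h2⟩
  · exact fun ⟨h1, h2⟩ => ⟨Or.inr h1, h2⟩

theorem cnt_ins_gt (S : Maya) {i j : ℤ} (h : j < i) (hi : i ∉ S.1) :
    (S.ins i).cnt j = S.cnt j + 1 := by
  unfold cnt ins
  rw [← Set.ncard_insert_of_notMem (fun h => hi h.1) (S.finite_Ioi j)]
  congr 1
  ext x
  simp only [Set.mem_inter_iff, Set.mem_insert_iff, Set.mem_Ioi]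
  constructor
  · rintro ⟨rfl | h1, h2⟩
    · exact Or.inl rfl
    · exact Or.inr ⟨h1, h2⟩
  · rintro (rfl | ⟨h1, h2⟩)
    · exact ⟨Or.inl rfl, h⟩
    · exact ⟨Or.inr h1, h2⟩

theorem ins_del (S : Maya) {j : ℤ} (h : j ∈ S.1) : (S.del j).ins j = S := by
  apply Subtype.ext
  simp [ins, del, Set.insert_eq_of_mem h]

theorem del_ins (S : Maya) {j : ℤ} (h : j ∉ S.1) : (S.ins j).del j = S := by
  apply Subtype.ext
  simp [ins, del, h]

theorem cnt_del_lt (S : Maya) {i j : ℤ} (h : i < j) : (S.del i).cnt j = S.cnt j := by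
  by_cases hi : i ∈ S.1
  · conv_rhs => rw [← S.ins_del hi]
    rw [cnt_ins_lt _ h]
  · congr 1
    exact Subtype.ext (Set.sdiff_singleton_eq_self hi)

theorem cnt_del_gt (S : Maya) {i j : ℤ} (h : j < i) (hi : i ∈ S.1) :
    S.cnt j = (S.del i).cnt j + 1 := by
  conv_lhs => rw [← S.ins_del hi]
  exact cnt_ins_gt _ h (by simp [del])

theorem cnt_ins_self (S : Maya) (j : ℤ) : (S.ins j).cnt j = S.cnt j := by
  unfold cnt ins
  congr 1
  ext x
  simp only [Set.mem_inter_iff, Set.mem_insert_iff, Set.mem_Ioi]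
  constructor
  · rintro ⟨rfl | h1, h2⟩
    · omega
    · exact ⟨h1, h2⟩
  · exact fun ⟨h1, h2⟩ => ⟨Or.inr h1, h2⟩

theorem cnt_del_self (S : Maya) (j : ℤ) : (S.del j).cnt j = S.cnt j := by
  by_cases hj : j ∈ S.1
  · conv_rhs => rw [← S.ins_del hj]
    rw [cnt_ins_self]
  · congr 1
    exact Subtype.ext (Set.sdiff_singleton_eq_self hj)

theorem ins_ins (S : Maya) (i j : ℤ) : (S.ins i).ins j = (S.ins j).ins i :=
  Subtype.ext (Set.insert_comm _ _ _)

theorem del_del (S : Maya) (i j : ℤ) : (S.del i).del j = (S.del j).del i :=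
  Subtype.ext (Set.sdiff_sdiff_comm)

theorem ins_del_comm (S : Maya) {i j : ℤ} (h : i ≠ j) : (S.ins i).del j = (S.del j).ins i :=
  Subtype.ext (Set.insert_sdiff_singleton_comm h _).symm

theorem mem_ins (S : Maya) {i j : ℤ} : j ∈ (S.ins i).1 ↔ j = i ∨ j ∈ S.1 := Iff.rfl

theorem mem_del (S : Maya) {i j : ℤ} : j ∈ (S.del i).1 ↔ j ∈ S.1 ∧ j ≠ i := Iff.rfl

end Maya

/-- The space `Λ^{∞/2+•} L^*` of semi-infinite forms, with basis the semi-infinite monomials. -/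
def Forms : Type := Maya →₀ ℂ

instance : AddCommGroup Forms := inferInstanceAs (AddCommGroup (Maya →₀ ℂ))
instance : Module ℂ Forms := inferInstanceAs (Module ℂ (Maya →₀ ℂ))

/-- The scalar multiple `c e_{i₁}^* ∧ e_{i₂}^* ∧ ⋯` of a monomial. -/
def mono (S : Maya) (c : ℂ) : Forms := Finsupp.single S c

/-- The linear map with prescribed values on the monomials. -/
def ofMono (f : Maya → Forms) : Module.End ℂ Forms :=
  (Finsupp.linearCombination ℂ f : (Maya →₀ ℂ) →ₗ[ℂ] Forms)

theorem ofMono_mono (f : Maya → Forms) (S : Maya) (c : ℂ) : ofMono f (mono S c) = c • f S :=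
  Finsupp.linearCombination_single ℂ c S

theorem smul_mono (S : Maya) (c d : ℂ) : c • mono S d = mono S (c * d) :=
  Finsupp.smul_single c S d

theorem mono_add (S : Maya) (c d : ℂ) : mono S (c + d) = mono S c + mono S d :=
  Finsupp.single_add S c d

theorem mono_zero (S : Maya) : mono S 0 = 0 := Finsupp.single_zero S

open Classical in
/-- Exterior multiplication by `e_j^*`. -/
def ext (j : ℤ) : Module.End ℂ Forms :=
  ofMono fun S => if j ∈ S.1 then 0 else mono (S.ins j) ((-1) ^ S.cnt j)

open Classical in
/-- Contraction with `e_j`. -/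
def con (j : ℤ) : Module.End ℂ Forms :=
  ofMono fun S => if j ∈ S.1 then mono (S.del j) ((-1) ^ S.cnt j) else 0

theorem ext_mem {S : Maya} {j : ℤ} (h : j ∈ S.1) (c : ℂ) : ext j (mono S c) = 0 := by
  rw [ext, ofMono_mono, if_pos h, smul_zero]

theorem ext_not {S : Maya} {j : ℤ} (h : j ∉ S.1) (c : ℂ) :
    ext j (mono S c) = mono (S.ins j) (c * (-1) ^ S.cnt j) := by
  rw [ext, ofMono_mono, if_neg h, smul_mono]

theorem con_mem {S : Maya} {j : ℤ} (h : j ∈ S.1) (c : ℂ) :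
    con j (mono S c) = mono (S.del j) (c * (-1) ^ S.cnt j) := by
  rw [con, ofMono_mono, if_pos h, smul_mono]

theorem con_not {S : Maya} {j : ℤ} (h : j ∉ S.1) (c : ℂ) : con j (mono S c) = 0 := by
  rw [con, ofMono_mono, if_neg h, smul_zero]

theorem end_ext {f g : Module.End ℂ Forms} (h : ∀ S : Maya, f (mono S 1) = g (mono S 1)) :
    f = g := by
  refine LinearMap.ext fun x => ?_
  refine Finsupp.induction_linear (motive := fun x : Maya →₀ ℂ =>
    f (id x : Forms) = g (id x : Forms)) x ((map_zero f).trans (map_zero g).symm)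
    (fun x y hx hy => (map_add f (id x : Forms) (id y)).trans
      ((congrArg₂ (· + ·) hx hy).trans (map_add g (id x : Forms) (id y)).symm)) fun S c => ?_
  have h' : mono S c = c • mono S 1 := by rw [smul_mono, mul_one]
  change f (mono S c) = g (mono S c)
  rw [h', map_smul, map_smul, h]

theorem ext_ext (i j : ℤ) : ext i * ext j + ext j * ext i = 0 := by
  wlog hij : i ≤ j generalizing i j
  · rw [add_comm]; exact this j i (le_of_not_ge hij)
  refine end_ext fun S => ?_
  simp only [LinearMap.add_apply, Module.End.mul_apply, LinearMap.zero_apply]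
  rcases hij.eq_or_lt with rfl | hij
  · by_cases hi : i ∈ S.1
    · simp [ext_mem hi]
    · rw [ext_not hi, ext_mem (S.mem_ins.2 (Or.inl rfl)), add_zero]
  by_cases hi : i ∈ S.1
  · rw [ext_mem hi]
    by_cases hj : j ∈ S.1
    · simp [ext_mem hj]
    · rw [ext_not hj, ext_mem (S.mem_ins.2 (Or.inr hi))]; simp
  by_cases hj : j ∈ S.1
  · rw [ext_mem hj, ext_not hi, ext_mem (S.mem_ins.2 (Or.inr hj))]; simp
  have h1 : i ∉ (S.ins j).1 := fun h => by
    rcases S.mem_ins.1 h with h | h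
    · omega
    · exact hi h
  have h2 : j ∉ (S.ins i).1 := fun h => by
    rcases S.mem_ins.1 h with h | h
    · omega
    · exact hj h
  rw [ext_not hj, ext_not hi, ext_not h1, ext_not h2, S.cnt_ins_gt hij hj, S.cnt_ins_lt hij,
    S.ins_ins i j, ← mono_add]
  refine (congrArg (mono _) ?_).trans (mono_zero _)
  ring

theorem con_con (i j : ℤ) : con i * con j + con j * con i = 0 := by
  wlog hij : i ≤ j generalizing i j
  · rw [add_comm]; exact this j i (le_of_not_ge hij)
  refine end_ext fun S => ?_
  simp only [LinearMap.add_apply, Module.End.mul_apply, LinearMap.zero_apply]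
  rcases hij.eq_or_lt with rfl | hij
  · by_cases hi : i ∈ S.1
    · rw [con_mem hi, con_not fun h => (S.mem_del.1 h).2 rfl, add_zero]
    · simp [con_not hi]
  by_cases hi : i ∈ S.1
  swap
  · rw [con_not hi]
    by_cases hj : j ∈ S.1
    · rw [con_mem hj, con_not fun h => hi (S.mem_del.1 h).1]; simp
    · simp [con_not hj]
  by_cases hj : j ∈ S.1
  swap
  · rw [con_not hj, con_mem hi, con_not fun h => hj (S.mem_del.1 h).1]; simp
  rw [con_mem hj, con_mem hi, con_mem (S.mem_del.2 ⟨hi, by omega⟩),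
    con_mem (S.mem_del.2 ⟨hj, by omega⟩), S.cnt_del_lt hij, S.cnt_del_gt hij hj,
    S.del_del i j, ← mono_add]
  refine (congrArg (mono _) ?_).trans (mono_zero _)
  ring

theorem con_ext (i j : ℤ) : con i * ext j + ext j * con i = if i = j then 1 else 0 := by
  refine end_ext fun S => ?_
  simp only [LinearMap.add_apply, Module.End.mul_apply]
  split_ifs with hij
  · subst hij
    simp only [Module.End.one_apply]
    by_cases hi : i ∈ S.1
    · rw [ext_mem hi, con_mem hi, ext_not fun h => (S.mem_del.1 h).2 rfl, S.ins_del hi,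
        S.cnt_del_self, one_mul, ← mul_pow]
      simp
    · rw [con_not hi, ext_not hi, con_mem (S.mem_ins.2 (Or.inl rfl)), S.del_ins hi,
        S.cnt_ins_self, one_mul, ← mul_pow]
      simp
  simp only [LinearMap.zero_apply]
  by_cases hi : i ∈ S.1
  swap
  · rw [con_not hi, map_zero, add_zero]
    by_cases hj : j ∈ S.1
    · rw [ext_mem hj, map_zero]
    · rw [ext_not hj, con_not fun h => (S.mem_ins.1 h).elim hij hi]
  by_cases hj : j ∈ S.1
  · rw [ext_mem hj, con_mem hi, ext_mem (S.mem_del.2 ⟨hj, Ne.symm hij⟩)]; simp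
  rw [ext_not hj, con_mem hi, con_mem (S.mem_ins.2 (Or.inr hi)),
    ext_not fun h => hj (S.mem_del.1 h).1, S.ins_del_comm (Ne.symm hij), ← mono_add]
  refine (congrArg (mono _) ?_).trans (mono_zero _)
  rcases lt_or_gt_of_ne hij with h | h
  · rw [S.cnt_ins_gt h hj, S.cnt_del_lt h]; ring
  · rw [S.cnt_ins_lt h, S.cnt_del_gt h hi]; ring

namespace QuasiFinite

variable {L : Type u} [LieRing L] [LieAlgebra ℂ L] (Q : QuasiFinite L)

/-- The action of `ι(x)` on semi-infinite forms. -/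
def conOp : L →ₗ[ℂ] Module.End ℂ Forms :=
  Finsupp.linearCombination ℂ con ∘ₗ Q.e.repr.toLinearMap

/-- The action of `ε(f)` on semi-infinite forms. -/
def extOp : Q.rdual →ₗ[ℂ] Module.End ℂ Forms := Finsupp.linearCombination ℂ ext ∘ₗ Q.coords

theorem extOp_extOp (f g : Q.rdual) :
    Q.extOp f * Q.extOp g + Q.extOp g * Q.extOp f = 0 := by
  have : ∀ a b : ℤ →₀ ℂ, Finsupp.linearCombination ℂ ext a * Finsupp.linearCombination ℂ ext b
      + Finsupp.linearCombination ℂ ext b * Finsupp.linearCombination ℂ ext a = 0 := by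
    intro a b
    induction a using Finsupp.induction_linear with
    | zero => simp
    | add a a' ha ha' =>
      rw [map_add, add_mul, mul_add, add_add_add_comm, ha, ha', add_zero]
    | single i c =>
      induction b using Finsupp.induction_linear with
      | zero => simp
      | add b b' hb hb' =>
        rw [map_add, add_mul, mul_add, add_add_add_comm, hb, hb', add_zero]
      | single j d =>
        simp only [Finsupp.linearCombination_single, smul_mul_smul_comm]
        rw [mul_comm d c, ← smul_add, ext_ext, smul_zero]
  exact this _ _

theorem conOp_conOp (x y : L) : Q.conOp x * Q.conOp y + Q.conOp y * Q.conOp x = 0 := by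
  have : ∀ a b : ℤ →₀ ℂ, Finsupp.linearCombination ℂ con a * Finsupp.linearCombination ℂ con b
      + Finsupp.linearCombination ℂ con b * Finsupp.linearCombination ℂ con a = 0 := by
    intro a b
    induction a using Finsupp.induction_linear with
    | zero => simp
    | add a a' ha ha' =>
      rw [map_add, add_mul, mul_add, add_add_add_comm, ha, ha', add_zero]
    | single i c =>
      induction b using Finsupp.induction_linear with
      | zero => simp
      | add b b' hb hb' =>
        rw [map_add, add_mul, mul_add, add_add_add_comm, hb, hb', add_zero]
      | single j d =>
        simp only [Finsupp.linearCombination_single, smul_mul_smul_comm]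
        rw [mul_comm d c, ← smul_add, con_con, smul_zero]
  exact this _ _

theorem conOp_extOp (x : L) (f : Q.rdual) :
    Q.conOp x * Q.extOp f + Q.extOp f * Q.conOp x = f.1 x • 1 := by
  have key : ∀ (i : ℤ) (b : ℤ →₀ ℂ), con i * Finsupp.linearCombination ℂ ext b
      + Finsupp.linearCombination ℂ ext b * con i = b i • 1 := by
    intro i b
    induction b using Finsupp.induction_linear with
    | zero => simp
    | add b b' hb hb' =>
      rw [map_add, add_mul, mul_add, add_add_add_comm, hb, hb', Finsupp.add_apply, add_smul]
    | single j d =>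
      rw [Finsupp.linearCombination_single, mul_smul_comm, smul_mul_assoc, ← smul_add, con_ext,
        Finsupp.single_apply]
      by_cases h : i = j
      · simp [h]
      · simp [h, Ne.symm h]
  have hx : x ∈ Submodule.span ℂ (Set.range Q.e) := Q.e.mem_span x
  induction hx using Submodule.span_induction with
  | zero => simp
  | add x y _ _ hx hy =>
    rw [map_add, add_mul, mul_add, add_add_add_comm, hx, hy, map_add, add_smul]
  | smul c x _ hx =>
    rw [map_smul, smul_mul_assoc, mul_smul_comm, ← smul_add, hx, map_smul, smul_smul, smul_eq_mul]
  | mem x hx =>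
    obtain ⟨i, rfl⟩ := hx
    have : Q.conOp (Q.e i) = con i := by simp [conOp]
    rw [this]
    exact key i _

/-- The action of `cl(L)` on semi-infinite forms, with `K` acting as the identity. -/
def clOp : Q.Cl →ₗ[ℂ] Module.End ℂ Forms :=
  Q.conOp.coprod (Q.extOp.coprod (LinearMap.toSpanSingleton ℂ (Module.End ℂ Forms) 1))

theorem clOp_apply (a : Q.Cl) : Q.clOp a = Q.conOp a.1 + (Q.extOp a.2.1 + a.2.2 • 1) := rfl

theorem clOp_even (a b : Q.Cl) (ha : a ∈ Q.clPart 0) :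
    Q.clOp a * Q.clOp b - Q.clOp b * Q.clOp a = Q.clOp (Q.clBracket a b) := by
  rw [mem_clPart_zero] at ha
  simp [clOp_apply, ha.1, ha.2, clBracket_apply]

theorem clOp_odd (a b : Q.Cl) (ha : a ∈ Q.clPart 1) (hb : b ∈ Q.clPart 1) :
    Q.clOp a * Q.clOp b + Q.clOp b * Q.clOp a = Q.clOp (Q.clBracket a b) := by
  rw [mem_clPart_one] at ha hb
  simp only [clOp_apply, ha, hb, clBracket_apply, zero_smul, add_zero, map_zero, zero_add,
    add_smul]
  rw [← Q.conOp_extOp, ← Q.conOp_extOp]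
  have h1 := Q.conOp_conOp a.1 b.1
  have h2 := Q.extOp_extOp a.2.1 b.2.1
  calc _ = (Q.conOp a.1 * Q.conOp b.1 + Q.conOp b.1 * Q.conOp a.1)
        + (Q.extOp a.2.1 * Q.extOp b.2.1 + Q.extOp b.2.1 * Q.extOp a.2.1)
        + (Q.conOp a.1 * Q.extOp b.2.1 + Q.extOp b.2.1 * Q.conOp a.1
        + (Q.conOp b.1 * Q.extOp a.2.1 + Q.extOp a.2.1 * Q.conOp b.1)) := by noncomm_ring
    _ = _ := by rw [h1, h2, zero_add, zero_add]

end QuasiFinite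
/-- A module over the graded Lie algebra `L` is smooth if every vector is killed by `U(L)_n` for
all sufficiently large `n`. -/
def QuasiFinite.IsSmoothModule {L : Type u} [LieRing L] [LieAlgebra ℂ L] (Q : QuasiFinite L)
    (M : Type w) [AddCommGroup M] [Module ℂ M] [LieRingModule L M] [LieModule ℂ L M] : Prop :=
  ∀ m : M, ∃ N : ℤ, ∀ n, N ≤ n →
    ∀ a ∈ wordSpan (UniversalEnvelopingAlgebra.ι ℂ : L → UniversalEnvelopingAlgebra ℂ L) Q.gr n,
      UniversalEnvelopingAlgebra.lift ℂ (LieModule.toEnd ℂ L M) a m = 0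

section Triple

variable (X : Type u) (Y : Type v) (Z : Type w) [AddCommGroup X] [Module ℂ X] [AddCommGroup Y]
  [Module ℂ Y] [AddCommGroup Z] [Module ℂ Z]

/-- The tensor product of three vector spaces. -/
def Triple : Type (max u v w) := X ⊗[ℂ] (Y ⊗[ℂ] Z)

instance : AddCommGroup (Triple X Y Z) := inferInstanceAs (AddCommGroup (X ⊗[ℂ] (Y ⊗[ℂ] Z)))
instance : Module ℂ (Triple X Y Z) := inferInstanceAs (Module ℂ (X ⊗[ℂ] (Y ⊗[ℂ] Z)))

/-- Operators on the first tensor factor. -/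
def on₁ : Module.End ℂ X →ₐ[ℂ] Module.End ℂ (Triple X Y Z) :=
  Module.End.rTensorAlgHom ℂ X (Y ⊗[ℂ] Z)

/-- Operators on the second tensor factor. -/
def on₂ : Module.End ℂ Y →ₐ[ℂ] Module.End ℂ (Triple X Y Z) :=
  (Module.End.lTensorAlgHom ℂ (Y ⊗[ℂ] Z) X).comp (Module.End.rTensorAlgHom ℂ Y Z)

/-- Operators on the third tensor factor. -/
def on₃ : Module.End ℂ Z →ₐ[ℂ] Module.End ℂ (Triple X Y Z) :=
  (Module.End.lTensorAlgHom ℂ (Y ⊗[ℂ] Z) X).comp (Module.End.lTensorAlgHom ℂ Z Y)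

variable {X Y Z}

theorem on₁_on₂ (f : Module.End ℂ X) (g : Module.End ℂ Y) :
    on₁ X Y Z f * on₂ X Y Z g = on₂ X Y Z g * on₁ X Y Z f :=
  TensorProduct.ext' fun _ _ => rfl

theorem on₁_on₃ (f : Module.End ℂ X) (g : Module.End ℂ Z) :
    on₁ X Y Z f * on₃ X Y Z g = on₃ X Y Z g * on₁ X Y Z f :=
  TensorProduct.ext' fun _ _ => rfl

theorem on₂_on₃ (f : Module.End ℂ Y) (g : Module.End ℂ Z) :
    on₂ X Y Z f * on₃ X Y Z g = on₃ X Y Z g * on₂ X Y Z f :=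
  TensorProduct.ext_threefold' fun _ _ _ => rfl

end Triple

theorem algHom_comm {A : Type u} {B : Type v} [Ring A] [Algebra ℂ A] [Ring B] [Algebra ℂ B]
    (f : A →ₐ[ℂ] B) {a b c : A} (h : a * b - b * a = c) : f a * f b - f b * f a = f c := by
  rw [← h, map_sub, map_mul, map_mul]

theorem algHom_anticomm {A : Type u} {B : Type v} [Ring A] [Algebra ℂ A] [Ring B] [Algebra ℂ B]
    (f : A →ₐ[ℂ] B) {a b c : A} (h : a * b + b * a = c) : f a * f b + f b * f a = f c := by
  rw [← h, map_add, map_mul, map_mul]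

theorem comm_sum {R : Type u} [Ring R] {l l' c c' f f' : R} (h1 : l * c' = c' * l)
    (h2 : l * f' = f' * l) (h3 : c * f' = f' * c) (h4 : l' * c = c * l') (h5 : l' * f = f * l')
    (h6 : c' * f = f * c') :
    (l + (c + f)) * (l' + (c' + f')) - (l' + (c' + f')) * (l + (c + f))
      = (l * l' - l' * l) + ((c * c' - c' * c) + (f * f' - f' * f)) := by
  simp only [mul_add, add_mul, h1, h2, h3, h4, h5, h6]
  abel

namespace QuasiFinite.Complement

variable {L : Type u} [LieRing L] [LieAlgebra ℂ L] {Q : QuasiFinite L} {β : Module.Dual ℂ L}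
  (C : Q.Complement β)

/-! ### The Fock module -/

/-- The left ideal of `U(ϵ(F_β) ⊕ ℂ K)` generated by `ϵ(F_β)_n`, `n > 0`, and `K - 1`. -/
def fockIdeal : Submodule C.heis.U C.heis.U :=
  Submodule.span C.heis.U ({a | ∃ n : ℤ, 0 < n ∧ ∃ x ∈ C.FDeg n, a = C.heis.toU (x, 0)} ∪
    {C.heis.toU (0, 1) - 1})

/-- The Fock module `𝔉_β`, induced from the one-dimensional module of
`⨁_{n > 0} ϵ(F_β)_n ⊕ ℂ K` on which `ϵ(F_β)_n`, `n > 0`, acts by `0` and `K` by `1`. -/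
def Fock : Type u := C.heis.U ⧸ C.fockIdeal

instance : AddCommGroup C.Fock := inferInstanceAs (AddCommGroup (C.heis.U ⧸ C.fockIdeal))
instance : Module C.heis.U C.Fock := inferInstanceAs (Module C.heis.U (C.heis.U ⧸ C.fockIdeal))
instance : Module ℂ C.Fock := inferInstanceAs (Module ℂ (C.heis.U ⧸ C.fockIdeal))
instance : IsScalarTower ℂ C.heis.U C.Fock :=
  inferInstanceAs (IsScalarTower ℂ C.heis.U (C.heis.U ⧸ C.fockIdeal))

/-- The action of `ϵ(F_β) ⊕ ℂ K` on the Fock module. -/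
def fockOp : (C.F × ℂ) →ₗ[ℂ] Module.End ℂ C.Fock :=
  (Algebra.lsmul ℂ ℂ C.Fock).toLinearMap ∘ₗ C.heis.toU

theorem fockOp_K : C.fockOp (0, 1) = 1 := by
  refine LinearMap.ext fun x => ?_
  obtain ⟨u, rfl⟩ := Submodule.Quotient.mk_surjective _ x
  change C.heis.toU (0, 1) • (Submodule.Quotient.mk u : C.heis.U ⧸ C.fockIdeal)
    = Submodule.Quotient.mk u
  rw [← Submodule.Quotient.mk_smul, Submodule.Quotient.eq, smul_eq_mul]
  have hcomm : C.heis.toU (0, 1) * u = u * C.heis.toU (0, 1) := by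
    obtain ⟨t, rfl⟩ := RingQuot.mkAlgHom_surjective ℂ C.heis.Rel u
    change C.heis.toU (0, 1) * C.heis.mkU t = C.heis.mkU t * C.heis.toU (0, 1)
    induction t using TensorAlgebra.induction with
    | algebraMap r => rw [AlgHom.commutes, Algebra.commutes]
    | ι v =>
      have h := C.heis.toU_rel 0 0 (0, 1) v (by simp [heis]) (by simp [heis])
      have hb : C.heis.bracket (0, 1) v = 0 := by
        change C.heisBracket (0, 1) v = 0
        simp [heisBracket_apply]
      rw [hb, map_zero, sub_eq_zero] at h
      have hk : koszul 0 0 = 1 := by simp [koszul]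
      rw [hk, one_smul] at h
      exact h
    | mul a b ha hb => rw [map_mul, ← mul_assoc, ha, mul_assoc, hb, mul_assoc]
    | add a b ha hb => rw [map_add, mul_add, add_mul, ha, hb]
  rw [hcomm]
  have h : u * C.heis.toU (0, 1) - u = u • (C.heis.toU (0, 1) - 1) := by
    rw [smul_eq_mul, mul_sub, mul_one]
  rw [h]
  exact Submodule.smul_mem _ _ (Submodule.subset_span (Or.inr rfl))

theorem fockOp_comm (x y : C.F) :
    C.fockOp (x, 0) * C.fockOp (y, 0) - C.fockOp (y, 0) * C.fockOp (x, 0)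
      = -(C.form x y • (1 : Module.End ℂ C.Fock)) := by
  have h := congrArg (Algebra.lsmul ℂ ℂ C.Fock)
    (C.heis.toU_rel 0 0 (x, 0) (y, 0) (by simp [heis]) (by simp [heis]))
  have hb : C.heis.bracket (x, 0) (y, 0) = -(C.form x y • ((0 : C.F), (1 : ℂ))) := by
    change C.heisBracket _ _ = _
    ext <;> simp [heisBracket_apply]
  rw [hb, map_sub, map_smul, map_mul, map_mul, map_neg, map_smul, map_neg, map_smul] at h
  have hk : koszul 0 0 = 1 := by simp [koszul]
  rw [hk, one_smul] at h
  rw [← C.fockOp_K]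
  exact h

/-! ### The module `M ⊗ Λ^{∞/2+•} L^* ⊗ 𝔉_β` -/

section Rep

variable (M : Type w) [AddCommGroup M] [Module ℂ M]

/-- `M ⊗ Λ^{∞/2+•} L^* ⊗ 𝔉_β`. -/
abbrev Feigin : Type (max u w) := Triple M Forms C.Fock

/-- The action of `cl(L)` on the second tensor factor. -/
def opCl : Q.Cl →ₗ[ℂ] Module.End ℂ (C.Feigin M) :=
  (on₂ M Forms C.Fock).toLinearMap ∘ₗ Q.clOp

/-- The action of `ϵ(F_β)` on the third tensor factor. -/
def opF : C.F →ₗ[ℂ] Module.End ℂ (C.Feigin M) :=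
  (on₃ M Forms C.Fock).toLinearMap ∘ₗ
    C.fockOp ∘ₗ LinearMap.inl ℂ _ _

theorem opCl_even (a b : Q.Cl) (ha : a ∈ Q.clPart 0) :
    C.opCl M a * C.opCl M b - C.opCl M b * C.opCl M a = C.opCl M (Q.clBracket a b) :=
  algHom_comm (on₂ M Forms C.Fock) (Q.clOp_even a b ha)

theorem opCl_odd (a b : Q.Cl) (ha : a ∈ Q.clPart 1) (hb : b ∈ Q.clPart 1) :
    C.opCl M a * C.opCl M b + C.opCl M b * C.opCl M a = C.opCl M (Q.clBracket a b) :=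
  algHom_anticomm (on₂ M Forms C.Fock) (Q.clOp_odd a b ha hb)

theorem opCl_K : C.opCl M Q.clK = 1 := by
  have h1 : Q.clOp Q.clK = 1 := by simp [clOp_apply, clK]
  exact (congrArg (on₂ M Forms C.Fock) h1).trans (map_one (on₂ M Forms C.Fock))

theorem opF_comm (x y : C.F) :
    C.opF M x * C.opF M y - C.opF M y * C.opF M x = -(C.form x y • C.opCl M Q.clK) := by
  rw [opCl_K]
  refine (algHom_comm (on₃ M Forms C.Fock) (C.fockOp_comm x y)).trans ?_
  rw [map_neg, map_smul, map_one]

theorem opCl_opF (a : Q.Cl) (y : C.F) : C.opCl M a * C.opF M y = C.opF M y * C.opCl M a :=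
  on₂_on₃ _ _

variable [LieRingModule L M] [LieModule ℂ L M]

/-- The action of `L` on the first tensor factor. -/
def opL : L →ₗ[ℂ] Module.End ℂ (C.Feigin M) :=
  (on₁ M Forms C.Fock).toLinearMap ∘ₗ
    (LieModule.toEnd ℂ L M : L →ₗ[ℂ] Module.End ℂ M)

theorem opL_comm (x y : L) :
    C.opL M x * C.opL M y - C.opL M y * C.opL M x = C.opL M ⁅x, y⁆ := by
  have h1 : LieModule.toEnd ℂ L M x * LieModule.toEnd ℂ L M y
      - LieModule.toEnd ℂ L M y * LieModule.toEnd ℂ L M x = LieModule.toEnd ℂ L M ⁅x, y⁆ :=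
    LinearMap.ext fun m => (lie_lie x y m).symm
  exact algHom_comm (on₁ M Forms C.Fock) h1

theorem opL_opCl (x : L) (a : Q.Cl) : C.opL M x * C.opCl M a = C.opCl M a * C.opL M x :=
  on₁_on₂ _ _

theorem opL_opF (x : L) (y : C.F) : C.opL M x * C.opF M y = C.opF M y * C.opL M x :=
  on₁_on₃ _ _

/-- The action of `s(L)` on `M ⊗ Λ^{∞/2+•} L^* ⊗ 𝔉_β`. -/
def opS : C.S →ₗ[ℂ] Module.End ℂ (C.Feigin M) :=
  (C.opL M).coprod ((C.opCl M).coprod (C.opF M))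

theorem opS_apply (a : C.S) :
    C.opS M a = C.opL M a.1 + (C.opCl M a.2.1 + C.opF M a.2.2) := rfl

theorem opS_comm (a b : C.S) (h : C.opCl M a.2.1 * C.opCl M b.2.1 - C.opCl M b.2.1 * C.opCl M a.2.1
      = C.opCl M (Q.clBracket a.2.1 b.2.1)) :
    C.opS M a * C.opS M b - C.opS M b * C.opS M a = C.opS M (C.sBracket a b) := by
  rw [opS_apply, opS_apply, opS_apply, comm_sum (C.opL_opCl M _ _) (C.opL_opF M _ _)
    (C.opCl_opF M _ _) (C.opL_opCl M _ _) (C.opL_opF M _ _) (C.opCl_opF M _ _), opL_comm, h,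
    opF_comm, sBracket_apply, map_sub, map_smul, map_zero, add_zero, ← sub_eq_add_neg]

theorem opS_rel (p q : ZMod 2) (a b : C.S) (ha : a ∈ C.s.part p) (hb : b ∈ C.s.part q) :
    C.opS M a * C.opS M b - koszul p q • (C.opS M b * C.opS M a) = C.opS M (C.s.bracket a b) := by
  change a ∈ C.sPart p at ha
  change b ∈ C.sPart q at hb
  change _ = C.opS M (C.sBracket a b)
  rcases parity p with rfl | rfl
  · rw [mem_sPart_zero] at ha
    have hk : koszul 0 q = 1 := by simp [koszul]
    rw [hk, one_smul]
    exact C.opS_comm M a b (C.opCl_even M _ _ ha)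
  · rcases parity q with rfl | rfl
    · rw [mem_sPart_zero] at hb
      have hk : koszul 1 0 = 1 := by simp [koszul]
      rw [hk, one_smul]
      refine C.opS_comm M a b ?_
      have h1 := C.opCl_even M _ a.2.1 hb
      have h2 : Q.clBracket a.2.1 b.2.1 = -Q.clBracket b.2.1 a.2.1 := by
        rw [mem_clPart_zero] at hb
        ext <;> simp [clBracket_apply, hb.1, hb.2]
      rw [h2, map_neg, ← h1, neg_sub]
    · rw [mem_sPart_one] at ha hb
      have hk : koszul 1 1 = -1 := by simp [koszul]
      rw [hk, neg_one_smul, sub_neg_eq_add, opS_apply, opS_apply, opS_apply, sBracket_apply,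
        ha.1, ha.2.2, hb.1, hb.2.2, lie_zero, map_zero, map_zero, map_zero, zero_smul, sub_zero,
        zero_add, zero_add, zero_add, add_zero, add_zero, add_zero,
        C.opCl_odd M _ _ ha.2.1 hb.2.1]

/-- The representation of `U₁(s(L))` on `M ⊗ Λ^{∞/2+•} L^* ⊗ 𝔉_β`. -/
def rep : C.A →ₐ[ℂ] Module.End ℂ (C.Feigin M) :=
  C.s.liftU₁ C.sK (C.opS M) (C.opS_rel M) (by simp [opS_apply, sK, opCl_K])

end Rep

end QuasiFinite.Complement

end SemiInf

end

noncomputable section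

namespace SemiInf

open scoped TensorProduct

universe u v w

open Filter Topology UniformSpace

/-! ### Topology of the completed enveloping algebra. -/

namespace GradedLieSuper

variable {V : Type u} [AddCommGroup V] [Module ℂ V] (𝔤 : GradedLieSuper V) (K : V)

/-! An element of positive charge in the completion is determined by its superbrackets with the
contractions ι(x): if all of them vanish, so does the element (`eq_zero_of_supercommute`). Indeed a
word of positive charge is a combination of multiples of the ε(e_j^*) (`IsClifford.word_mem`). For
each j there is an operator `red` that annihilates the multiples of ε(e_j^*) and fixes whatever
supercommutes with ι(e_j) (`IsClifford.red_mult_self`, `red_eq_self`). These operators preserve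
every tail (`red_mem_tail`). Applied to an approximation of the given element, they show that it
lies in every tail, hence is zero. Uniqueness of d̄^β is then immediate from the bracket formula
[d̄^β, ι(x)] = θ̄^β(x) (`dBar_anticomm`).

The square is treated by the same principle. Reordering a double sum shows that ρ^β respects
brackets up to a constant, the cocycle γ^β (`rho₀_comm_basis`). The bracket on ϵ(F_β) contributes
-γ^β, and ϵ([x, y]) = 0 because [L, L] lies in the radical, so θ̄^β is an exact Lie algebra
homomorphism (`thetaBar_comm_thetaBar`). Bracketing [d̄^β, θ̄^β(x)] with ι(y) gives, by the Jacobi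
identity, θ̄^β([x, y]) - [θ̄^β(x), θ̄^β(y)] = 0. Since it has charge 1, [d̄^β, θ̄^β(x)] vanishes.
This is also the commutator of (d̄^β)² with ι(x), and (d̄^β)² has charge 2, so (d̄^β)² = 0.

On modules, the semi-infinite forms and the Fock module live in degrees at most 0, and U(L)_n m
vanishes for large n, so the tensor product is smooth (`isSmooth_rep`). The action of the completion
is multiplicative by continuity (`act_mul`), and the operator squares to zero because d̄^β does. -/

theorem toU₁_rel (p q : ZMod 2) (x y : V) (hx : x ∈ 𝔤.part p) (hy : y ∈ 𝔤.part q) :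
    𝔤.toU₁ K x * 𝔤.toU₁ K y - koszul p q • (𝔤.toU₁ K y * 𝔤.toU₁ K x)
      = 𝔤.toU₁ K (𝔤.bracket x y) := by
  have h := congrArg (𝔤.mkU₁ K) (𝔤.toU_rel p q x y hx hy)
  rwa [map_sub, map_smul, map_mul, map_mul] at h

theorem toU₁_K : 𝔤.toU₁ K K = 1 := by
  have h : 𝔤.mkU₁ K _ = 𝔤.mkU₁ K _ := RingQuot.mkAlgHom_rel ℂ (KRel.K_eq_one (𝔤 := 𝔤) (K := K))
  rw [map_one] at h
  exact h

theorem liftU₁_toU₁ {A : Type v} [Ring A] [Algebra ℂ A] (f : V →ₗ[ℂ] A)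
    (hf : ∀ p q x y, x ∈ 𝔤.part p → y ∈ 𝔤.part q →
      f x * f y - koszul p q • (f y * f x) = f (𝔤.bracket x y)) (hK : f K = 1) (x : V) :
    𝔤.liftU₁ K f hf hK (𝔤.toU₁ K x) = f x :=
  (RingQuot.liftAlgHom_mkAlgHom_apply ℂ (𝔤.liftU f hf) _ _).trans (𝔤.liftU_toU f hf x)

theorem toU₁_mem_degU₁ {n : ℤ} {x : V} (hx : x ∈ 𝔤.deg n) : 𝔤.toU₁ K x ∈ 𝔤.degU₁ K n := by
  refine Submodule.subset_span ⟨[(n, x)], ?_, ?_, ?_⟩ <;> simp [hx]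

theorem toU₁_mem_tail {n N : ℤ} {x : V} (hx : x ∈ 𝔤.deg n) (h : N ≤ n) :
    𝔤.toU₁ K x ∈ 𝔤.tail K N :=
  Submodule.subset_span ⟨n, h, 𝔤.toU₁_mem_degU₁ K hx⟩

theorem mul_mem_tail {N : ℤ} (a : 𝔤.U₁ K) {b : 𝔤.U₁ K} (hb : b ∈ 𝔤.tail K N) :
    a * b ∈ 𝔤.tail K N :=
  Submodule.smul_mem _ a hb

theorem smul_mem_tail {N : ℤ} (c : ℂ) {b : 𝔤.U₁ K} (hb : b ∈ 𝔤.tail K N) :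
    c • b ∈ 𝔤.tail K N := by
  rw [Algebra.smul_def]
  exact 𝔤.mul_mem_tail K _ hb

theorem tail_hasBasis :
    (𝓝 (0 : 𝔤.U₁ K)).HasBasis (fun _ : ℤ => True) fun N => (𝔤.tail K N : Set (𝔤.U₁ K)) :=
  (𝔤.tail_basis K).hasBasis_nhds_zero

instance : NonarchimedeanRing (𝔤.U₁ K) := (𝔤.tail_basis K).nonarchimedean

/-- A scalar acts as multiplication by an element of the ring, so continuity comes from the ring
topology; no topology on ℂ enters. -/
instance : ContinuousConstSMul ℂ (𝔤.U₁ K) where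
  continuous_const_smul c := by
    simp_rw [Algebra.smul_def]
    exact continuous_const_mul _

instance : UniformContinuousConstSMul ℂ (𝔤.U₁ K) where
  uniformContinuous_const_smul c :=
    uniformContinuous_addMonoidHom_of_continuous
      (f := DistribSMul.toAddMonoidHom (𝔤.U₁ K) c) (continuous_const_smul c)

/-- The canonical map into the completion as an algebra homomorphism. -/
def comHom : 𝔤.U₁ K →ₐ[ℂ] 𝔤.U₁com K :=
  { Completion.coeRingHom with commutes' := fun _ => rfl }

theorem comHom_apply (a : 𝔤.U₁ K) : 𝔤.comHom K a = (a : 𝔤.U₁com K) := rfl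

/-- The closure of the left ideal `tail N` in the completion. -/
def tailCom (N : ℤ) : AddSubgroup (𝔤.U₁com K) :=
  ((𝔤.tail K N).toAddSubgroup.map (Completion.toCompl (α := 𝔤.U₁ K))).topologicalClosure

theorem isClosed_tailCom (N : ℤ) : IsClosed (𝔤.tailCom K N : Set (𝔤.U₁com K)) :=
  AddSubgroup.isClosed_topologicalClosure _

theorem coe_mem_tailCom {N : ℤ} {a : 𝔤.U₁ K} (ha : a ∈ 𝔤.tail K N) :
    (a : 𝔤.U₁com K) ∈ 𝔤.tailCom K N :=
  subset_closure ⟨a, ha, rfl⟩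

theorem tailCom_hasBasis :
    (𝓝 (0 : 𝔤.U₁com K)).HasBasis (fun _ : ℤ => True)
      fun N => (𝔤.tailCom K N : Set (𝔤.U₁com K)) :=
  (𝔤.tail_hasBasis K).hasBasis_of_isDenseInducing Completion.isDenseInducing_coe

theorem tailCom_mem_nhds (N : ℤ) : (𝔤.tailCom K N : Set (𝔤.U₁com K)) ∈ 𝓝 (0 : 𝔤.U₁com K) :=
  (𝔤.tailCom_hasBasis K).mem_of_mem trivial

/-- The completion is Hausdorff and the closed tails form a neighbourhood basis of 0. Every
vanishing statement in the completion is reduced to this one. -/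
theorem eq_zero_of_mem_tailCom {u : 𝔤.U₁com K} (h : ∀ N, u ∈ 𝔤.tailCom K N) : u = 0 := by
  by_contra hu
  obtain ⟨N, -, hN⟩ := (𝔤.tailCom_hasBasis K).mem_iff.1
    (isOpen_compl_singleton.mem_nhds (show (0 : 𝔤.U₁com K) ∈ ({u}ᶜ : Set _) from Ne.symm hu))
  exact hN (h N) rfl

theorem exists_sub_mem_tailCom {s : Set (𝔤.U₁ K)} {u : 𝔤.U₁com K}
    (hu : u ∈ closure ((fun a : 𝔤.U₁ K => (a : 𝔤.U₁com K)) '' s)) (N : ℤ) :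
    ∃ a ∈ s, u - (a : 𝔤.U₁com K) ∈ 𝔤.tailCom K N := by
  have h : {v | u - v ∈ 𝔤.tailCom K N} ∈ 𝓝 u := by
    have hc : Tendsto (fun v => u - v) (𝓝 u) (𝓝 0) := by
      have : Continuous fun v => u - v := continuous_const.sub continuous_id
      simpa using this.tendsto u
    exact hc (𝔤.tailCom_mem_nhds K N)
  obtain ⟨_, hv, a, ha, rfl⟩ := mem_closure_iff_nhds.1 hu _ h
  exact ⟨a, ha, hv⟩

theorem map_mem_tailCom {M N : ℤ} {f : 𝔤.U₁com K → 𝔤.U₁com K} (hf : Continuous f)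
    (h : ∀ a ∈ 𝔤.tail K M, f a ∈ 𝔤.tailCom K N) {u : 𝔤.U₁com K} (hu : u ∈ 𝔤.tailCom K M) :
    f u ∈ 𝔤.tailCom K N := by
  have := map_mem_closure (t := (𝔤.tailCom K N : Set (𝔤.U₁com K))) hf hu (by
    rintro _ ⟨a, ha, rfl⟩
    exact h a ha)
  rwa [(𝔤.isClosed_tailCom K N).closure_eq] at this

/-- In a complete nonarchimedean group a family is summable as soon as it tends to 0 along the
cofinite filter. Convergence thus becomes a count of the terms outside each tail. -/
theorem summable_coe {I : Type*} {a : I → 𝔤.U₁ K} (h : ∀ N, {j | a j ∉ 𝔤.tail K N}.Finite) :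
    Summable fun j => (a j : 𝔤.U₁com K) := by
  refine NonarchimedeanAddGroup.summable_of_tendsto_cofinite_zero ?_
  rw [(𝔤.tailCom_hasBasis K).tendsto_right_iff]
  intro N _
  refine (h N).subset fun j hj hj' => hj (𝔤.coe_mem_tailCom K hj')

/-- Seen as a closed subgroup, the piece inherits stability under addition, subtraction and infinite
sums. -/
theorem comPiece_eq (g : ℤ → Submodule ℂ V) (n : ℤ) : 𝔤.comPiece K g n =
    ((wordSpan (𝔤.toU₁ K) g n).toAddSubgroup.map
      (Completion.toCompl (α := 𝔤.U₁ K))).topologicalClosure := rfl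

theorem add_mem_comPiece {g : ℤ → Submodule ℂ V} {n : ℤ} {a b : 𝔤.U₁com K}
    (ha : a ∈ 𝔤.comPiece K g n) (hb : b ∈ 𝔤.comPiece K g n) : a + b ∈ 𝔤.comPiece K g n := by
  rw [comPiece_eq] at *
  exact add_mem ha hb

theorem sub_mem_comPiece {g : ℤ → Submodule ℂ V} {n : ℤ} {a b : 𝔤.U₁com K}
    (ha : a ∈ 𝔤.comPiece K g n) (hb : b ∈ 𝔤.comPiece K g n) : a - b ∈ 𝔤.comPiece K g n := by
  rw [comPiece_eq] at *
  exact sub_mem ha hb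

theorem coe_mem_comPiece {g : ℤ → Submodule ℂ V} {n : ℤ} {a : 𝔤.U₁ K}
    (ha : a ∈ wordSpan (𝔤.toU₁ K) g n) : (a : 𝔤.U₁com K) ∈ 𝔤.comPiece K g n :=
  subset_closure ⟨a, ha, rfl⟩

theorem tsum_mem_comPiece {g : ℤ → Submodule ℂ V} {n : ℤ} {I : Type*} {a : I → 𝔤.U₁com K}
    (ha : ∀ i, a i ∈ 𝔤.comPiece K g n) : ∑' i, a i ∈ 𝔤.comPiece K g n := by
  rw [comPiece_eq] at *
  exact tsum_mem (AddSubgroup.isClosed_topologicalClosure _) ha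

end GradedLieSuper

/-! ### Spans of words with prescribed total degree. -/

theorem mul_mem_wordSpan {V : Type u} {A : Type v} [AddCommGroup V] [Module ℂ V] [Ring A]
    [Algebra ℂ A] {j : V → A} {g : ℤ → Submodule ℂ V} {m n : ℤ} {a b : A}
    (ha : a ∈ wordSpan j g m) (hb : b ∈ wordSpan j g n) : a * b ∈ wordSpan j g (m + n) := by
  have h := Submodule.mul_mem_mul ha hb
  rw [wordSpan, wordSpan, Submodule.span_mul_span] at h
  refine Submodule.span_mono ?_ h
  rintro _ ⟨_, ⟨l, hl, rfl, rfl⟩, _, ⟨l', hl', rfl, rfl⟩, rfl⟩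
  refine ⟨l ++ l', fun p hp => ?_, by simp, by simp⟩
  rcases List.mem_append.1 hp with hp | hp
  · exact hl p hp
  · exact hl' p hp

theorem mul_mem_wordSpan_of_eq {V : Type u} {A : Type v} [AddCommGroup V] [Module ℂ V] [Ring A]
    [Algebra ℂ A] {j : V → A} {g : ℤ → Submodule ℂ V} {m n k : ℤ} (h : m + n = k) {a b : A}
    (ha : a ∈ wordSpan j g m) (hb : b ∈ wordSpan j g n) : a * b ∈ wordSpan j g k :=
  h ▸ mul_mem_wordSpan ha hb

theorem one_mem_wordSpan {V : Type u} {A : Type v} [AddCommGroup V] [Module ℂ V] [Ring A]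
    [Algebra ℂ A] (j : V → A) (g : ℤ → Submodule ℂ V) : 1 ∈ wordSpan j g 0 :=
  Submodule.subset_span ⟨[], by simp, by simp, by simp⟩

theorem mem_wordSpan {V : Type u} {A : Type v} [AddCommGroup V] [Module ℂ V] [Ring A]
    [Algebra ℂ A] (j : V → A) {g : ℤ → Submodule ℂ V} {n : ℤ} {x : V} (hx : x ∈ g n) :
    j x ∈ wordSpan j g n :=
  Submodule.subset_span ⟨[(n, x)], by simp [hx], by simp, by simp⟩

/-- Induction on words by left multiplication with a generator. -/
theorem wordSpan_induction {V : Type u} {A : Type v} [AddCommGroup V] [Module ℂ V] [Ring A]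
    [Algebra ℂ A] {j : V → A} {g : ℤ → Submodule ℂ V} {P : ℤ → Submodule ℂ A} (h1 : 1 ∈ P 0)
    (hmul : ∀ m n x a, x ∈ g m → a ∈ P n → j x * a ∈ P (m + n)) {n : ℤ} {a : A}
    (ha : a ∈ wordSpan j g n) : a ∈ P n := by
  have : wordSpan j g n ≤ P n := by
    refine Submodule.span_le.2 ?_
    rintro _ ⟨l, hl, rfl, rfl⟩
    clear ha
    induction l with
    | nil => simpa using h1
    | cons p l ih =>
      simp only [List.map_cons, List.sum_cons, List.prod_cons]
      exact hmul _ _ _ _ (hl p (by simp)) (ih fun q hq => hl q (by simp [hq]))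
  exact this ha

namespace GradedLieSuper

variable {V : Type u} [AddCommGroup V] [Module ℂ V] (𝔤 : GradedLieSuper V) (K : V)

theorem mul_mem_comPiece {g : ℤ → Submodule ℂ V} {m n : ℤ} {a b : 𝔤.U₁com K}
    (ha : a ∈ 𝔤.comPiece K g m) (hb : b ∈ 𝔤.comPiece K g n) :
    a * b ∈ 𝔤.comPiece K g (m + n) := by
  refine map_mem_closure₂ (f := fun a b : 𝔤.U₁com K => a * b) continuous_mul ha hb ?_
  rintro _ ⟨a, ha, rfl⟩ _ ⟨b, hb, rfl⟩
  exact ⟨a * b, mul_mem_wordSpan ha hb, Completion.coe_mul a b⟩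

end GradedLieSuper

/-- Finite support makes the sum finite, so the linear map need not be continuous. This serves to
carry the scalar cocycle sums into the completion. -/
theorem hasSum_finite_map {I B C : Type*} [AddCommMonoid B] [TopologicalSpace B] [T2Space B]
    [Module ℂ B] [AddCommMonoid C] [TopologicalSpace C] [Module ℂ C] {f : I → B}
    (hf : (Function.support f).Finite) (φ : B →ₗ[ℂ] C) :
    HasSum (fun i => φ (f i)) (φ (∑' i, f i)) := by
  rw [tsum_eq_sum (s := hf.toFinset) fun i hi => by simpa using hi, map_sum]
  exact hasSum_sum_of_ne_finset_zero fun i hi => by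
    rw [show f i = 0 by simpa using hi, map_zero]

namespace QuasiFinite

variable {L : Type u} [LieRing L] [LieAlgebra ℂ L] (Q : QuasiFinite L)

theorem finite_edeg_Icc (m n : ℤ) : {i | m ≤ Q.edeg i ∧ Q.edeg i ≤ n}.Finite := by
  refine ((Set.finite_Icc m n).biUnion fun d _ => Q.finite_edeg d).subset fun i hi => ?_
  simpa using hi

theorem edeg_pos (i : ℤ) : 0 < Q.edeg i ↔ 0 < i := by
  have := Q.edeg_nonpos i
  omega

theorem edeg_of_repr_ne_zero {m i : ℤ} {x : L} (hx : x ∈ Q.gr m) (h : Q.e.repr x i ≠ 0) :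
    Q.edeg i = m := by
  by_contra hi
  exact h (Q.repr_eq_zero hi hx)

theorem lie_e_mem (a b : ℤ) : ⁅Q.e a, Q.e b⁆ ∈ Q.gr (Q.edeg a + Q.edeg b) :=
  Q.lie_mem _ _ _ _ (Q.e_mem a) (Q.e_mem b)

theorem estar_mem (j : ℤ) : (Q.estar j).1 ∈ Q.dualGr (-Q.edeg j) := fun m hm x hx =>
  Q.repr_eq_zero (by omega) hx

theorem estar_apply (j : ℤ) (x : L) : (Q.estar j).1 x = Q.e.repr x j := rfl

/-! ### Clifford relations and normal ordering -/

section Clifford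

variable {A : Type v} [Ring A] [Algebra ℂ A]

/-- The defining relations of `cl(L)` with `K = 1`. -/
structure IsClifford (i : L →ₗ[ℂ] A) (ε : Q.rdual →ₗ[ℂ] A) : Prop where
  ii : ∀ x y, i x * i y = -(i y * i x)
  ee : ∀ f g, ε f * ε g = -(ε g * ε f)
  ei : ∀ f x, ε f * i x = f.1 x • 1 - i x * ε f

variable (i : L →ₗ[ℂ] A) (ε : Q.rdual →ₗ[ℂ] A)

/-- The normally ordered product `:ι(z) ε(e_j^*):` for arbitrary `z`. -/
def normal (j : ℤ) : L →ₗ[ℂ] A :=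
  LinearMap.mulRight ℂ (ε (Q.estar j)) ∘ₗ i
    - if 0 < j then (Q.e.coord j).smulRight (1 : A) else 0

theorem normal_apply (j : ℤ) (z : L) : Q.normal i ε j z = i z * ε (Q.estar j)
    - (if 0 < j then Q.e.repr z j else 0) • (1 : A) := by
  unfold normal
  split_ifs <;> simp

variable {i ε} {Q}

theorem IsClifford.ei_basis (h : Q.IsClifford i ε) (j k : ℤ) :
    ε (Q.estar j) * i (Q.e k) = (if k = j then (1 : A) else 0) - i (Q.e k) * ε (Q.estar j) := by
  rw [h.ei, estar_apply, Q.e.repr_self, Finsupp.single_apply]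
  split_ifs <;> simp

/-- The constant subtracted in `normal` for j > 0 is exactly the anticommutator of ι(z) and
ε(e_j^*), so the subtraction amounts to reversing the two factors. -/
theorem IsClifford.normal_pos (h : Q.IsClifford i ε) {j : ℤ} (hj : 0 < j) (z : L) :
    Q.normal i ε j z = -(ε (Q.estar j) * i z) := by
  rw [normal_apply, if_pos hj, h.ei, estar_apply]
  abel

theorem normal_nonpos {j : ℤ} (hj : ¬ 0 < j) (z : L) :
    Q.normal i ε j z = i z * ε (Q.estar j) := by
  rw [normal_apply, if_neg hj, zero_smul, sub_zero]

/-- The two factors anticommute unless k = j, so normal ordering differs from the written order only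
for k = j > 0. This gives a form linear in the argument of ι, to which the bracket [x, e_j] can be
fed directly. -/
theorem IsClifford.normal₂_eq (h : Q.IsClifford i ε) (k j : ℤ) :
    Q.normal₂ i ε k j = Q.normal i ε j (Q.e k) := by
  unfold normal₂
  split_ifs with hkj
  · obtain ⟨rfl, hk⟩ := hkj
    rw [h.normal_pos hk]
  · rw [normal_apply, Q.e.repr_self, Finsupp.single_apply]
    have : (if 0 < j then if k = j then (1 : ℂ) else 0 else 0) = 0 := by
      split_ifs with h1 h2
      · exact absurd ⟨h2, h2 ▸ h1⟩ hkj
      · rfl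
      · rfl
    rw [this, zero_smul, sub_zero]

theorem sum_repr_smul {B : Type*} [AddCommGroup B] [Module ℂ B] (f : L →ₗ[ℂ] B) (z : L) :
    (Q.e.repr z).sum (fun k c => c • f (Q.e k)) = f z := by
  conv_rhs => rw [← Q.e.linearCombination_repr z]
  rw [Finsupp.linearCombination_apply, map_finsuppSum]
  simp

theorem IsClifford.rhoTerm_eq (h : Q.IsClifford i ε) (x : L) (j : ℤ) :
    Q.rhoTerm i ε x j = Q.normal i ε j ⁅x, Q.e j⁆ := by
  unfold rhoTerm
  simp_rw [h.normal₂_eq]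
  exact sum_repr_smul _ _

theorem IsClifford.normal_comm_i (h : Q.IsClifford i ε) (j : ℤ) (z y : L) :
    Q.normal i ε j z * i y - i y * Q.normal i ε j z = Q.e.repr y j • i z := by
  rw [normal_apply, sub_mul, mul_sub, smul_mul_assoc, mul_smul_comm, one_mul, mul_one, mul_assoc,
    h.ei, mul_sub, mul_smul_comm, mul_one, ← mul_assoc, ← mul_assoc, h.ii y z, estar_apply]
  noncomm_ring

theorem IsClifford.normal_comm_ε (h : Q.IsClifford i ε) (j l : ℤ) (z : L) :
    Q.normal i ε j z * ε (Q.estar l) - ε (Q.estar l) * Q.normal i ε j z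
      = -(Q.e.repr z l • ε (Q.estar j)) := by
  rw [normal_apply, sub_mul, mul_sub, smul_mul_assoc, mul_smul_comm, one_mul, mul_one, mul_assoc,
    ← mul_assoc (ε (Q.estar l)), h.ei (Q.estar l), sub_mul, smul_mul_assoc, one_mul, mul_assoc,
    h.ee (Q.estar l) (Q.estar j), estar_apply]
  noncomm_ring

/-- The Clifford identities are proved for an arbitrary pair of maps so that they apply alike in
U₁(cl(L)), in U₁(s(L)) and in their completions. -/
theorem IsClifford.map (h : Q.IsClifford i ε) {B : Type w} [Ring B] [Algebra ℂ B] (φ : A →ₐ[ℂ] B) :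
    Q.IsClifford (φ.toLinearMap ∘ₗ i) (φ.toLinearMap ∘ₗ ε) where
  ii x y := by simpa using congrArg φ (h.ii x y)
  ee x y := by simpa using congrArg φ (h.ee x y)
  ei x y := by simpa using congrArg φ (h.ei x y)

variable (Q) in
theorem normal_map {B : Type w} [Ring B] [Algebra ℂ B] (φ : A →ₐ[ℂ] B) (j : ℤ) (z : L) :
    Q.normal (φ.toLinearMap ∘ₗ i) (φ.toLinearMap ∘ₗ ε) j z = φ (Q.normal i ε j z) := by
  simp only [normal_apply, map_sub, map_mul, map_smul, map_one]
  rfl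

end Clifford

/-! ### The Clifford algebra `U₁(cl(L))` -/

theorem i_mem_clPart (x : L) : ((x, 0, 0) : Q.Cl) ∈ Q.clPart 1 := Q.mem_clPart_one.2 rfl

theorem ε_mem_clPart (f : Q.rdual) : ((0, f, 0) : Q.Cl) ∈ Q.clPart 1 := Q.mem_clPart_one.2 rfl

/-- Odd maps satisfying the superbracket relations of `cl(L)` satisfy the Clifford relations. -/
theorem isClifford_of_rel {A : Type v} [Ring A] [Algebra ℂ A] (f : Q.Cl →ₗ[ℂ] A)
    (hf : ∀ a ∈ Q.clPart 1, ∀ b ∈ Q.clPart 1, f a * f b + f b * f a = f (Q.clBracket a b))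
    (hK : f Q.clK = 1) :
    Q.IsClifford (f ∘ₗ LinearMap.inl ℂ _ _) (f ∘ₗ LinearMap.inr ℂ _ _ ∘ₗ LinearMap.inl ℂ _ _) where
  ii x y := by
    have h := hf _ (Q.i_mem_clPart x) _ (Q.i_mem_clPart y)
    have h0 : Q.clBracket (x, 0, 0) (y, 0, 0) = 0 := by ext <;> simp [clBracket_apply]
    rw [h0, map_zero] at h
    exact eq_neg_of_add_eq_zero_left h
  ee x y := by
    have h := hf _ (Q.ε_mem_clPart x) _ (Q.ε_mem_clPart y)
    have h0 : Q.clBracket (0, x, 0) (0, y, 0) = 0 := by ext <;> simp [clBracket_apply]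
    rw [h0, map_zero] at h
    exact eq_neg_of_add_eq_zero_left h
  ei x y := by
    have h := hf _ (Q.ε_mem_clPart x) _ (Q.i_mem_clPart y)
    have h0 : Q.clBracket (0, x, 0) (y, 0, 0) = x.1 y • Q.clK := by
      ext <;> simp [clBracket_apply, clK]
    rw [h0, map_smul, hK] at h
    exact eq_sub_of_add_eq h

theorem isClifford_cl : Q.IsClifford Q.clI Q.clE :=
  Q.isClifford_of_rel (Q.cl.toU₁ Q.clK) (fun a ha b hb => by
    have h := Q.cl.toU₁_rel Q.clK 1 1 a b ha hb
    have hk : koszul 1 1 = -1 := by simp [koszul]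
    rwa [hk, neg_one_smul, sub_neg_eq_add] at h) (Q.cl.toU₁_K Q.clK)

theorem clI_mem_tail {n N : ℤ} {x : L} (hx : x ∈ Q.gr n) (h : N ≤ n) :
    Q.clI x ∈ Q.cl.tail Q.clK N :=
  Q.cl.toU₁_mem_tail Q.clK (n := n) (Q.mem_clDeg.2 ⟨hx, zero_mem _, fun _ => rfl⟩) h

theorem clE_mem_tail {n N : ℤ} {f : Q.rdual} (hf : f.1 ∈ Q.dualGr n) (h : N ≤ n) :
    Q.clE f ∈ Q.cl.tail Q.clK N :=
  Q.cl.toU₁_mem_tail Q.clK (n := n) (Q.mem_clDeg.2 ⟨zero_mem _, hf, fun _ => rfl⟩) h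

/-- Normal ordering leaves on the right ι(z), of degree n, when j > 0, and ε(e_j^*), of degree -deg
e_j, when j ≤ 0. Since tails are left ideals, the degree of the right factor alone decides. -/
theorem normal_mem_tail {n N : ℤ} {z : L} (hz : z ∈ Q.gr n) (j : ℤ)
    (h : (0 < j ∧ N ≤ n) ∨ (j ≤ 0 ∧ N ≤ -Q.edeg j)) :
    Q.normal Q.clI Q.clE j z ∈ Q.cl.tail Q.clK N := by
  rcases h with ⟨hj, h⟩ | ⟨hj, h⟩
  · rw [Q.isClifford_cl.normal_pos hj]
    exact neg_mem (Q.cl.mul_mem_tail _ _ (Q.clI_mem_tail hz h))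
  · rw [normal_nonpos (not_lt.2 hj)]
    exact Q.cl.mul_mem_tail _ _ (Q.clE_mem_tail (Q.estar_mem j) h)

/-- The completion of `U₁(cl(L))`. -/
abbrev ClCom : Type u := Q.cl.U₁com Q.clK

/-- The map `ι` into the completion. -/
def comI : L →ₗ[ℂ] Q.ClCom := (Q.cl.comHom Q.clK).toLinearMap ∘ₗ Q.clI

/-- The map `ε` into the completion. -/
def comE : Q.rdual →ₗ[ℂ] Q.ClCom := (Q.cl.comHom Q.clK).toLinearMap ∘ₗ Q.clE

theorem isClifford_com : Q.IsClifford Q.comI Q.comE := Q.isClifford_cl.map _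

/-- The normally ordered product in the completion. -/
def nrm (j : ℤ) : L →ₗ[ℂ] Q.ClCom := Q.normal Q.comI Q.comE j

theorem nrm_coe (j : ℤ) (z : L) :
    Q.nrm j z = ((Q.normal Q.clI Q.clE j z : Q.cl.U₁ Q.clK) : Q.ClCom) :=
  Q.normal_map (Q.cl.comHom Q.clK) j z

theorem coe_rhoTerm (x : L) (j : ℤ) :
    ((Q.rhoTerm Q.clI Q.clE x j : Q.cl.U₁ Q.clK) : Q.ClCom) = Q.nrm j ⁅x, Q.e j⁆ := by
  rw [nrm_coe, Q.isClifford_cl.rhoTerm_eq]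

theorem summable_nrm (x : L) : Summable fun j : ℤ => Q.nrm j ⁅x, Q.e j⁆ := by
  have hx : x ∈ Submodule.span ℂ (Set.range Q.e) := Q.e.mem_span x
  induction hx using Submodule.span_induction with
  | zero => simp
  | add x y _ _ hx hy => simpa only [add_lie, map_add] using hx.add hy
  | smul c x _ hx => simpa only [smul_lie, map_smul] using hx.const_smul c
  | mem x hx =>
    obtain ⟨a, rfl⟩ := hx
    simp_rw [nrm_coe]
    refine Q.cl.summable_coe Q.clK fun N => ?_
    -- A term can miss the tail only if j > 0 and deg e_j < N - deg e_a, or j ≤ 0 and deg e_j > -N.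
    -- Both conditions confine the degree of e_j to a bounded interval.
    refine (Q.finite_edeg_Icc (-N) (N - Q.edeg a)).union
      (Q.finite_edeg_Icc (-N) 0) |>.union (Q.finite_edeg_Icc 0 (N - Q.edeg a)) |>.subset
        fun j hj => ?_
    by_contra h
    simp only [Set.mem_union, Set.mem_ofPred_eq, not_or, not_and_or] at h
    refine hj (Q.normal_mem_tail (Q.lie_e_mem a j) j ?_)
    have h1 := Q.edeg_nonpos j
    omega

/-- `ρ⁰(x)`, the part of `ρ^β(x)` not involving `β`. -/
def rho₀ (x : L) : Q.ClCom := ∑' j, Q.nrm j ⁅x, Q.e j⁆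

theorem hasSum_rho₀ (x : L) : HasSum (fun j => Q.nrm j ⁅x, Q.e j⁆) (Q.rho₀ x) :=
  (Q.summable_nrm x).hasSum

theorem rhoCl_eq (β : Module.Dual ℂ L) (x : L) :
    Q.rhoCl β x = Q.rho₀ x + algebraMap ℂ Q.ClCom (β x) := by
  unfold rhoCl rho
  simp_rw [coe_rhoTerm]
  rfl

/-- `ρ⁰` as a linear map. -/
def rho₀Lin : L →ₗ[ℂ] Q.ClCom where
  toFun := Q.rho₀
  map_add' x y := by
    refine (Q.hasSum_rho₀ (x + y)).unique ?_
    simpa only [add_lie, map_add] using (Q.hasSum_rho₀ x).add (Q.hasSum_rho₀ y)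
  map_smul' c x := by
    refine (Q.hasSum_rho₀ (c • x)).unique ?_
    simpa only [smul_lie, map_smul, RingHom.id_apply] using (Q.hasSum_rho₀ x).const_smul c

/-- `ρ^β` as a linear map. -/
def rhoLin (β : Module.Dual ℂ L) : L →ₗ[ℂ] Q.ClCom :=
  Q.rho₀Lin + Algebra.linearMap ℂ Q.ClCom ∘ₗ β

theorem rhoLin_apply (β : Module.Dual ℂ L) (x : L) : Q.rhoLin β x = Q.rhoCl β x :=
  (Q.rhoCl_eq β x).symm

/-- The expansion of z is finite, so no continuity of f is required. It is phrased as a series over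
ℤ to be compared termwise with genuinely infinite ones. -/
theorem hasSum_repr_smul {B : Type*} [AddCommGroup B] [Module ℂ B] [TopologicalSpace B]
    (f : L →ₗ[ℂ] B) (z : L) : HasSum (fun j => Q.e.repr z j • f (Q.e j)) (f z) := by
  rw [← sum_repr_smul (Q := Q) f z]
  exact hasSum_sum_of_ne_finset_zero fun j hj => by
    rw [Finsupp.notMem_support_iff.1 hj, zero_smul]

/-- The normal ordering constants drop out of commutators, and the j-th term contributes the j-th
coordinate of y times ι([x, e_j]). These add up to the adjoint action. -/
theorem rho₀_comm_i (x y : L) :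
    Q.rho₀ x * Q.comI y - Q.comI y * Q.rho₀ x = Q.comI ⁅x, y⁆ := by
  refine (((Q.hasSum_rho₀ x).mul_right _).sub ((Q.hasSum_rho₀ x).mul_left _)).unique ?_
  simp_rw [nrm, Q.isClifford_com.normal_comm_i]
  exact Q.hasSum_repr_smul (Q.comI ∘ₗ (LieModule.toEnd ℂ L L x : L →ₗ[ℂ] L)) y

theorem hasSum_rho₀_comm_ε (x : L) (l : ℤ) :
    HasSum (fun j => -(Q.e.repr ⁅x, Q.e j⁆ l • Q.comE (Q.estar j)))
      (Q.rho₀ x * Q.comE (Q.estar l) - Q.comE (Q.estar l) * Q.rho₀ x) := by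
  have := ((Q.hasSum_rho₀ x).mul_right (Q.comE (Q.estar l))).sub
    ((Q.hasSum_rho₀ x).mul_left (Q.comE (Q.estar l)))
  simpa only [nrm, Q.isClifford_com.normal_comm_ε] using this

/-! ### The cocycle on basis elements -/

/-- The coefficient of `ι` of the `l`-th basis vector in `[x, e_j]`. -/
abbrev adCoeff (x : L) (l j : ℤ) : ℂ := Q.e.repr ⁅x, Q.e j⁆ l

theorem edeg_of_adCoeff {a l j : ℤ} (h : Q.adCoeff (Q.e a) l j ≠ 0) :
    Q.edeg l = Q.edeg a + Q.edeg j :=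
  Q.edeg_of_repr_ne_zero (Q.lie_e_mem a j) h

/-- The summands of the Japanese cocycle. -/
def cocycleTerm (x y : L) (p : ℤ × ℤ) : ℂ :=
  ((if 0 < p.1 then 1 else 0) - (if 0 < p.2 then 1 else 0))
    * (Q.adCoeff x p.1 p.2 * Q.adCoeff y p.2 p.1)

/-- A nonzero term needs exactly one positive index, while the degrees of the two basis vectors
differ by deg e_a. Both degrees are therefore at most |deg e_a| in absolute value. -/
theorem finite_cocycleTerm (a b : ℤ) :
    (Function.support (Q.cocycleTerm (Q.e a) (Q.e b))).Finite := by
  refine ((Q.finite_edeg_Icc (-|Q.edeg a|) |Q.edeg a|).prod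
    (Q.finite_edeg_Icc (-|Q.edeg a|) |Q.edeg a|)).subset fun p hp => ?_
  have h := left_ne_zero_of_mul hp
  have h1 := Q.edeg_of_adCoeff (left_ne_zero_of_mul (right_ne_zero_of_mul hp))
  have h2 := Q.edeg_pos p.1
  have h3 := Q.edeg_pos p.2
  have h4 := le_abs_self (Q.edeg a)
  have h5 := neg_abs_le (Q.edeg a)
  have h6 : ¬ (0 < p.1 ↔ 0 < p.2) := fun h6 => h (by simp [h6])
  simp only [Set.mem_prod, Set.mem_ofPred_eq]
  omega

/-- Unconditional summability of this double family is what permits the exchange of summations in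
the computation of [ρ(x), ρ(y)]. -/
theorem summable_cross (a b : ℤ) : Summable fun p : ℤ × ℤ =>
    Q.adCoeff (Q.e a) p.1 p.2 • Q.nrm p.2 ⁅Q.e b, Q.e p.1⁆ := by
  have : ∀ p : ℤ × ℤ, Q.adCoeff (Q.e a) p.1 p.2 • Q.nrm p.2 ⁅Q.e b, Q.e p.1⁆ =
      ((Q.adCoeff (Q.e a) p.1 p.2 • Q.normal Q.clI Q.clE p.2 ⁅Q.e b, Q.e p.1⁆ : Q.cl.U₁ Q.clK) :
        Q.ClCom) := fun p => by rw [Completion.coe_smul, nrm_coe]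
  simp_rw [this]
  refine Q.cl.summable_coe Q.clK fun N => ?_
  -- Outside the tail, the degree at p.2 is bounded by |N| + |deg e_a| + |deg e_b|; the degree at
  -- p.1 exceeds it by deg e_a, whence the second |deg e_a|.
  set B := |N| + |Q.edeg a| + |Q.edeg a| + |Q.edeg b|
  refine ((Q.finite_edeg_Icc (-B) B).prod (Q.finite_edeg_Icc (-B) B)).subset fun p hp => ?_
  by_contra h
  refine hp ?_
  by_cases h0 : Q.adCoeff (Q.e a) p.1 p.2 = 0
  · rw [h0, zero_smul]
    exact zero_mem _
  have h1 := Q.edeg_of_adCoeff h0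
  refine Q.cl.smul_mem_tail Q.clK _ (Q.normal_mem_tail (Q.lie_e_mem b p.1) p.2 ?_)
  have h2 := Q.edeg_pos p.2
  simp only [Set.mem_prod, Set.mem_ofPred_eq] at h
  have h3 := neg_abs_le (Q.edeg a)
  have h4 := neg_abs_le (Q.edeg b)
  have h5 := le_abs_self (Q.edeg a)
  have h6 := le_abs_self N
  have h7 := neg_abs_le N
  have h8 := le_abs_self (Q.edeg b)
  omega

/-- The value of the cocycle on basis elements. -/
def cocycle (a b : ℤ) : ℂ := ∑' p, Q.cocycleTerm (Q.e a) (Q.e b) p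

theorem hasSum_cocycle (a b : ℤ) :
    HasSum (Q.cocycleTerm (Q.e a) (Q.e b)) (Q.cocycle a b) :=
  (summable_of_hasFiniteSupport (Q.finite_cocycleTerm a b)).hasSum

/-- Leibniz rule: ρ(x) acts on the ι factor by the adjoint action, which is moved to the left side,
and on the ε factor by the coadjoint action, which is left as a series. The products are not yet
normally ordered. -/
theorem rho₀_comm_nrm (x y : L) (l : ℤ) :
    HasSum (fun j => -(Q.adCoeff x l j • (Q.comI ⁅y, Q.e l⁆ * Q.comE (Q.estar j))))
      (Q.rho₀ x * Q.nrm l ⁅y, Q.e l⁆ - Q.nrm l ⁅y, Q.e l⁆ * Q.rho₀ x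
        - Q.comI ⁅x, ⁅y, Q.e l⁆⁆ * Q.comE (Q.estar l)) := by
  have h := (Q.hasSum_rho₀_comm_ε x l).mul_left (Q.comI ⁅y, Q.e l⁆)
  simp only [mul_neg, mul_smul_comm] at h
  have h1 := Q.rho₀_comm_i x ⁅y, Q.e l⁆
  have h2 : Q.rho₀ x * Q.nrm l ⁅y, Q.e l⁆ - Q.nrm l ⁅y, Q.e l⁆ * Q.rho₀ x
      - Q.comI ⁅x, ⁅y, Q.e l⁆⁆ * Q.comE (Q.estar l) = Q.comI ⁅y, Q.e l⁆ *
        (Q.rho₀ x * Q.comE (Q.estar l) - Q.comE (Q.estar l) * Q.rho₀ x) := by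
    rw [← h1, nrm, normal_apply]
    simp only [mul_sub, sub_mul, mul_smul_comm, smul_mul_assoc, mul_one, one_mul, mul_assoc]
    abel
  rw [h2]
  exact h

theorem comI_mul_comE (z : L) (j : ℤ) : Q.comI z * Q.comE (Q.estar j) =
    Q.nrm j z + algebraMap ℂ Q.ClCom (if 0 < j then Q.e.repr z j else 0) := by
  rw [nrm, normal_apply, Algebra.algebraMap_eq_smul_one, sub_add_cancel]

/-- Writing x = e_a and y = e_b, the l-th term of ρ(y) is differentiated by ρ(x) and the result is
normally ordered again. The coadjoint contributions sum to minus the terms of [y, [x, ·]], which by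
the Jacobi identity turns [x, [y, ·]] into [[x, y], ·]. What remains is ρ([x, y]) and the reordering
constants, which form the cocycle. -/
theorem rho₀_comm_basis (a b : ℤ) :
    Q.rho₀ (Q.e a) * Q.rho₀ (Q.e b) - Q.rho₀ (Q.e b) * Q.rho₀ (Q.e a)
      = Q.rho₀ ⁅Q.e a, Q.e b⁆ + algebraMap ℂ Q.ClCom (Q.cocycle a b) := by
  set x := Q.e a with hx
  set y := Q.e b with hy
  have hG := Q.summable_cross a b
  set G : ℤ × ℤ → Q.ClCom := fun p => Q.adCoeff x p.1 p.2 • Q.nrm p.2 ⁅y, Q.e p.1⁆ with hGdef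
  have hrow : ∀ l, HasSum (fun j => G (l, j)) (∑' j, G (l, j)) := fun l => (hG.prod_factor l).hasSum
  have hS1 := hG.hasSum.prod_fiberwise hrow
  -- Summing over the first index instead of the second reassembles the vector [x, e_l] from its
  -- coordinates, so the same double sum acquires a second evaluation.
  have hS2 : HasSum (fun l => Q.nrm l ⁅y, ⁅x, Q.e l⁆⁆) (∑' p, G p) := by
    refine ((Equiv.prodComm ℤ ℤ).hasSum_iff.2 hG.hasSum).prod_fiberwise fun l => ?_
    exact Q.hasSum_repr_smul (Q.nrm l ∘ₗ (LieModule.toEnd ℂ L L y : L →ₗ[ℂ] L)) ⁅x, Q.e l⁆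
  have hfin := Q.finite_cocycleTerm a b
  have hsm := summable_of_hasFiniteSupport (L := .unconditional _) hfin
  have hcrow : ∀ l, HasSum (fun j => algebraMap ℂ Q.ClCom (Q.cocycleTerm x y (l, j)))
      (algebraMap ℂ Q.ClCom (∑' j, Q.cocycleTerm x y (l, j))) := fun l =>
    (hasSum_finite_map (hfin.preimage (f := fun j => (l, j)) (by
      intro j _ k _ h; exact (Prod.mk.inj h).2)) (Algebra.linearMap ℂ Q.ClCom))
  have hc : HasSum (fun l => algebraMap ℂ Q.ClCom (∑' j, Q.cocycleTerm x y (l, j)))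
      (algebraMap ℂ Q.ClCom (Q.cocycle a b)) :=
    (hasSum_finite_map hfin (Algebra.linearMap ℂ Q.ClCom)).prod_fiberwise hcrow
  have key : ∀ l, Q.rho₀ x * Q.nrm l ⁅y, Q.e l⁆ - Q.nrm l ⁅y, Q.e l⁆ * Q.rho₀ x
      = -(∑' j, G (l, j)) + algebraMap ℂ Q.ClCom (∑' j, Q.cocycleTerm x y (l, j))
        + (Q.nrm l ⁅⁅x, y⁆, Q.e l⁆ + Q.nrm l ⁅y, ⁅x, Q.e l⁆⁆) := by
    intro l
    have h1 := Q.rho₀_comm_nrm x y l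
    have h2 := Q.hasSum_repr_smul ((Algebra.linearMap ℂ Q.ClCom) ∘ₗ
      (if 0 < l then Q.e.coord l else 0) ∘ₗ (LieModule.toEnd ℂ L L x : L →ₗ[ℂ] L)) ⁅y, Q.e l⁆
    -- Reordering the (l, j) coadjoint product costs a constant carrying the cutoff at j, while the
    -- adjoint product costs one carrying the cutoff at l. Only their difference is finitely
    -- supported over all pairs, so the cocycle term is introduced here and the cutoff at l is
    -- returned through `h2`.
    have h3 := (((hrow l).neg).add (hcrow l)).sub h2
    have h4 := h1.unique (h3.congr_fun fun j => ?_)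
    · rw [sub_eq_iff_eq_add.1 h4, comI_mul_comE, lie_lie x y, map_sub]
      have : (Algebra.linearMap ℂ Q.ClCom ∘ₗ (if 0 < l then Q.e.coord l else 0) ∘ₗ
          (LieModule.toEnd ℂ L L x : L →ₗ[ℂ] L)) ⁅y, Q.e l⁆ = algebraMap ℂ Q.ClCom
          (if 0 < l then Q.e.repr ⁅x, ⁅y, Q.e l⁆⁆ l else 0) := by
        split_ifs <;> simp
      rw [this]
      abel
    · rw [comI_mul_comE, hGdef]
      have : (Algebra.linearMap ℂ Q.ClCom ∘ₗ (if 0 < l then Q.e.coord l else 0) ∘ₗ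
          (LieModule.toEnd ℂ L L x : L →ₗ[ℂ] L)) (Q.e j) = algebraMap ℂ Q.ClCom
          (if 0 < l then Q.adCoeff x l j else 0) := by
        split_ifs <;> simp
      rw [this]
      simp only [cocycleTerm, Algebra.algebraMap_eq_smul_one, smul_add, smul_smul]
      match_scalars
      · ring
      · split_ifs <;> simp [mul_comm]
  have hl : HasSum (fun l => Q.rho₀ x * Q.nrm l ⁅y, Q.e l⁆ - Q.nrm l ⁅y, Q.e l⁆ * Q.rho₀ x)
      (Q.rho₀ x * Q.rho₀ y - Q.rho₀ y * Q.rho₀ x) :=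
    ((Q.hasSum_rho₀ y).mul_left _).sub ((Q.hasSum_rho₀ y).mul_right _)
  simp_rw [key] at hl
  refine (hl.unique ((hS1.neg.add hc).add ((Q.hasSum_rho₀ ⁅x, y⁆).add hS2))).trans ?_
  abel

/-- The explicit form `γ^β` as a bilinear map. -/
def gammaForm (β : Module.Dual ℂ L) : L →ₗ[ℂ] L →ₗ[ℂ] ℂ :=
  Q.e.constr ℂ (fun a => Q.e.constr ℂ fun b => Q.cocycle a b)
    - (LieModule.toEnd ℂ L L : L →ₗ[ℂ] L →ₗ[ℂ] L).compr₂ β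

theorem gammaForm_basis (β : Module.Dual ℂ L) (a b : ℤ) :
    Q.gammaForm β (Q.e a) (Q.e b) = Q.cocycle a b - β ⁅Q.e a, Q.e b⁆ := by
  simp [gammaForm]

/-- Exchanging the two summation indices reverses the difference of the step functions and leaves
the product of coefficients unchanged. -/
theorem cocycle_skew (a b : ℤ) : Q.cocycle a b = -Q.cocycle b a := by
  refine (Q.hasSum_cocycle a b).unique ?_
  have h := ((Equiv.prodComm ℤ ℤ).hasSum_iff.2 (Q.hasSum_cocycle b a)).neg
  refine h.congr_fun fun p => ?_
  change _ = -(((if 0 < p.2 then 1 else 0) - (if 0 < p.1 then 1 else 0))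
    * (Q.adCoeff (Q.e b) p.2 p.1 * Q.adCoeff (Q.e a) p.1 p.2))
  rw [cocycleTerm]
  ring

theorem cocycle_eq_zero {a b : ℤ} (h : Q.edeg a + Q.edeg b ≠ 0) : Q.cocycle a b = 0 := by
  refine (Q.hasSum_cocycle a b).unique ?_
  refine hasSum_zero.congr_fun fun p => ?_
  by_contra h0
  have h1 := right_ne_zero_of_mul h0
  have h2 := Q.edeg_of_adCoeff (left_ne_zero_of_mul h1)
  have h3 := Q.edeg_of_adCoeff (right_ne_zero_of_mul h1)
  omega

/-- The explicit form `γ^β`. -/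
def gammaExplicit (β : Module.Dual ℂ L) (hβ : β ∈ Q.dualGr 0) : Q.Form where
  form := Q.gammaForm β
  alt x := by
    have h : Q.gammaForm β = -(Q.gammaForm β).flip := by
      refine Q.e.ext fun a => Q.e.ext fun b => ?_
      rw [LinearMap.neg_apply, LinearMap.neg_apply, LinearMap.flip_apply, gammaForm_basis,
        gammaForm_basis, cocycle_skew, ← lie_skew, map_neg]
      ring
    have h1 := LinearMap.congr_fun (LinearMap.congr_fun h x) x
    rw [LinearMap.neg_apply, LinearMap.neg_apply, LinearMap.flip_apply] at h1
    exact self_eq_neg.1 h1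
  deg m n hmn x hx y hy := by
    rw [← LinearMap.sum_repr_mul_repr_mul Q.e Q.e]
    refine Finset.sum_eq_zero fun a ha => Finset.sum_eq_zero fun b hb => ?_
    have ha := Q.edeg_of_repr_ne_zero hx (Finsupp.mem_support_iff.1 ha)
    have hb := Q.edeg_of_repr_ne_zero hy (Finsupp.mem_support_iff.1 hb)
    dsimp only
    rw [gammaForm_basis, Q.cocycle_eq_zero (by omega),
      hβ _ (by omega) _ (Q.lie_e_mem a b)]
    simp

/-- Both sides are bilinear, so basis vectors suffice. The scalars β(x) and β(y) are central, and β
enters only through ρ^β([x, y]), as -β([x, y]). -/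
theorem isGamma_explicit (β : Module.Dual ℂ L) (hβ : β ∈ Q.dualGr 0) :
    Q.IsGamma β (Q.gammaExplicit β hβ) := by
  have h : (LinearMap.mul ℂ Q.ClCom).compl₁₂ (Q.rhoLin β) (Q.rhoLin β)
      - ((LinearMap.mul ℂ Q.ClCom).compl₁₂ (Q.rhoLin β) (Q.rhoLin β)).flip
      - (LieModule.toEnd ℂ L L : L →ₗ[ℂ] L →ₗ[ℂ] L).compr₂ (Q.rhoLin β)
      = (Q.gammaForm β).compr₂ (Algebra.linearMap ℂ Q.ClCom) := by
    refine Q.e.ext fun a => Q.e.ext fun b => ?_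
    have h1 := Q.rho₀_comm_basis a b
    simp only [LinearMap.sub_apply, LinearMap.compl₁₂_apply, LinearMap.flip_apply,
      LinearMap.mul_apply', LinearMap.compr₂_apply, rhoLin_apply, rhoCl_eq, gammaForm_basis,
      Algebra.linearMap_apply, map_sub, LieHom.coe_toLinearMap, LieModule.toEnd_apply_apply,
      mul_add, add_mul]
    rw [sub_eq_iff_eq_add] at h1
    rw [h1, Algebra.commutes (β (Q.e a)), Algebra.commutes (β (Q.e b)),
      Algebra.commutes (β (Q.e b)) (algebraMap ℂ Q.ClCom (β (Q.e a)))]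
    abel
  intro x y
  have h2 := LinearMap.congr_fun (LinearMap.congr_fun h x) y
  simp only [LinearMap.sub_apply, LinearMap.compl₁₂_apply, LinearMap.flip_apply,
      LinearMap.mul_apply', LinearMap.compr₂_apply, rhoLin_apply] at h2
  exact h2

/-- `gamma` is a chosen witness, and the explicit form serves only to show that one exists. Later
arguments use this property and the fields of `Form`, never the explicit formula. -/
theorem isGamma_gamma (β : Module.Dual ℂ L) (hβ : β ∈ Q.dualGr 0) :
    Q.IsGamma β (Q.gamma β) := by
  have h : ∃ g, Q.IsGamma β g := ⟨_, Q.isGamma_explicit β hβ⟩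
  rw [gamma, dif_pos h]
  exact h.choose_spec

end QuasiFinite

/-- The Koszul sign is 1 when one argument is even; splitting the other into its two parities
removes the homogeneity assumption on it. -/
theorem GradedLieSuper.toU₁_rel_even {V : Type u} [AddCommGroup V] [Module ℂ V]
    (𝔤 : GradedLieSuper V) (K : V) {x : V} (hx : x ∈ 𝔤.part 0) (y : V) :
    𝔤.toU₁ K x * 𝔤.toU₁ K y - 𝔤.toU₁ K y * 𝔤.toU₁ K x = 𝔤.toU₁ K (𝔤.bracket x y) := by
  have hy : y ∈ 𝔤.part 0 ⊔ 𝔤.part 1 := 𝔤.isCompl_part.sup_eq_top ▸ Submodule.mem_top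
  obtain ⟨a, ha, b, hb, rfl⟩ := Submodule.mem_sup.1 hy
  have h0 := 𝔤.toU₁_rel K 0 0 x a hx ha
  have h1 := 𝔤.toU₁_rel K 0 1 x b hx hb
  have hk : ∀ q, koszul 0 q = 1 := fun q => by simp [koszul]
  rw [hk, one_smul] at h0 h1
  rw [map_add, map_add, map_add, mul_add, add_mul, ← h0, ← h1]
  abel

namespace QuasiFinite

variable {L : Type u} [LieRing L] [LieAlgebra ℂ L] (Q : QuasiFinite L)

theorem Form.skew {Q : QuasiFinite L} (g : Q.Form) (x y : L) : g.form x y = -g.form y x := by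
  have h := g.alt (x + y)
  simp only [map_add, LinearMap.add_apply, g.alt, zero_add, add_zero] at h
  linear_combination h

namespace Complement

variable {Q} {β : Module.Dual ℂ L} (C : Q.Complement β)

/-! ### Relations in `U₁(s(L))` -/

theorem clA_rel (p q : ZMod 2) (a b : Q.Cl) (ha : a ∈ Q.clPart p) (hb : b ∈ Q.clPart q) :
    C.clA a * C.clA b - koszul p q • (C.clA b * C.clA a) = C.clA (Q.clBracket a b) := by
  have hmem : ∀ {p : ZMod 2} {a : Q.Cl}, a ∈ Q.clPart p → ((0, a, 0) : C.S) ∈ C.sPart p := by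
    intro p a ha
    rcases parity p with rfl | rfl
    · exact C.mem_sPart_zero.2 ha
    · exact C.mem_sPart_one.2 ⟨rfl, ha, rfl⟩
  have h := C.s.toU₁_rel C.sK p q (0, a, 0) (0, b, 0) (hmem ha) (hmem hb)
  have hb : C.s.bracket (0, a, 0) (0, b, 0) = (0, Q.clBracket a b, 0) := by
    change C.sBracket _ _ = _
    simp [sBracket_apply]
  rwa [hb] at h

theorem clA_K : C.clA Q.clK = 1 := C.s.toU₁_K C.sK

theorem isClifford_s : Q.IsClifford C.iot C.eps :=
  Q.isClifford_of_rel C.clA (fun a ha b hb => by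
    have h := C.clA_rel 1 1 a b ha hb
    have hk : koszul 1 1 = -1 := by simp [koszul]
    rwa [hk, neg_one_smul, sub_neg_eq_add] at h) C.clA_K

theorem even_rel (x : L) (f : C.F) (y : C.S) :
    C.s.toU₁ C.sK (x, 0, f) * C.s.toU₁ C.sK y - C.s.toU₁ C.sK y * C.s.toU₁ C.sK (x, 0, f)
      = C.s.toU₁ C.sK (C.sBracket (x, 0, f) y) :=
  C.s.toU₁_rel_even C.sK (C.mem_sPart_zero.2 (zero_mem _)) y

theorem ell_clA (x : L) (a : Q.Cl) : Commute (C.ell x) (C.clA a) := by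
  have h := C.even_rel x 0 (0, a, 0)
  have hb : C.sBracket (x, 0, 0) (0, a, 0) = 0 := by simp [sBracket_apply]
  rw [hb, map_zero, sub_eq_zero] at h
  exact h

theorem gho_clA (x : L) (a : Q.Cl) : Commute (C.gho x) (C.clA a) := by
  have h := C.even_rel 0 (C.proj x) (0, a, 0)
  have hb : C.sBracket (0, 0, C.proj x) (0, a, 0) = 0 := by simp [sBracket_apply]
  rw [hb, map_zero, sub_eq_zero] at h
  exact h

theorem ell_gho (x y : L) : Commute (C.ell x) (C.gho y) := by
  have h := C.even_rel x 0 (0, 0, C.proj y)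
  have hb : C.sBracket (x, 0, 0) (0, 0, C.proj y) = 0 := by simp [sBracket_apply]
  rw [hb, map_zero, sub_eq_zero] at h
  exact h

theorem ell_ell (x y : L) : C.ell x * C.ell y - C.ell y * C.ell x = C.ell ⁅x, y⁆ := by
  have h := C.even_rel x 0 (y, 0, 0)
  have hb : C.sBracket (x, 0, 0) (y, 0, 0) = (⁅x, y⁆, 0, 0) := by simp [sBracket_apply]
  rwa [hb] at h

theorem sub_proj_mem (x : L) : x - (C.proj x : L) ∈ (Q.gamma β).radical := by
  rw [← Submodule.projectionOnto_apply_eq_zero_iff C.isCompl, map_sub,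
    Submodule.projectionOnto_apply_left]
  exact sub_self _

/-- Replacing a vector by its projection changes it by an element of the radical, which the form
does not see. -/
theorem form_proj (x y : L) : C.form (C.proj x) (C.proj y) = (Q.gamma β).form x y := by
  have h1 : ∀ z ∈ (Q.gamma β).radical, ∀ w, (Q.gamma β).form z w = 0 := fun z hz w => by
    have : (Q.gamma β).form z = 0 := hz
    rw [this, LinearMap.zero_apply]
  have h2 := h1 _ (C.sub_proj_mem x) (C.proj y)
  have h3 := h1 _ (C.sub_proj_mem y) x
  rw [map_sub, LinearMap.sub_apply] at h2 h3
  rw [form_apply, (Q.gamma β).skew x y]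
  rw [(Q.gamma β).skew x] at h2
  linear_combination -h2 + h3

theorem proj_eq_zero {x : L} (hx : x ∈ (Q.gamma β).radical) : C.proj x = 0 :=
  (Submodule.projectionOnto_apply_eq_zero_iff C.isCompl).2 hx

theorem gho_gho (x y : L) : C.gho x * C.gho y - C.gho y * C.gho x
    = -((Q.gamma β).form x y • 1) := by
  have h := C.even_rel 0 (C.proj x) (0, 0, C.proj y)
  have hb : C.sBracket (0, 0, C.proj x) (0, 0, C.proj y)
      = -((Q.gamma β).form x y • C.sK) := by
    ext <;> simp [sBracket_apply, C.form_proj, sK]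
  rw [hb, map_neg, map_smul, C.s.toU₁_K] at h
  exact h

/-! ### Transfer from `U₁(cl(L))` to `U₁(s(L))` -/

/-- The inclusion `U₁(cl(L)) → U₁(s(L))`. -/
def incl : Q.cl.U₁ Q.clK →ₐ[ℂ] C.A := Q.cl.liftU₁ Q.clK C.clA C.clA_rel C.clA_K

theorem incl_toU₁ (a : Q.Cl) : C.incl (Q.cl.toU₁ Q.clK a) = C.clA a :=
  Q.cl.liftU₁_toU₁ Q.clK C.clA C.clA_rel C.clA_K a

theorem clA_deg {n : ℤ} {a : Q.Cl} (ha : a ∈ Q.clDeg n) : ((0, a, 0) : C.S) ∈ C.s.deg n :=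
  ⟨zero_mem _, ha, zero_mem _⟩

theorem incl_degU₁ {n : ℤ} {a : Q.cl.U₁ Q.clK} (ha : a ∈ Q.cl.degU₁ Q.clK n) :
    C.incl a ∈ C.s.degU₁ C.sK n := by
  refine wordSpan_induction (P := fun n => (C.s.degU₁ C.sK n).comap C.incl.toLinearMap) ?_ ?_ ha
  · change C.incl 1 ∈ C.s.degU₁ C.sK 0
    rw [map_one]
    exact one_mem_wordSpan _ _
  · intro m n x b hx hb
    change C.incl (_ * _) ∈ C.s.degU₁ C.sK (m + n)
    rw [map_mul, incl_toU₁]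
    exact mul_mem_wordSpan (C.s.toU₁_mem_degU₁ C.sK (C.clA_deg hx)) hb

/-- The inclusion preserves degrees and carries left multiples to left multiples. Hence it is
continuous and extends to the completions, so the identities for ρ^β transfer to U₁(s(L))^com. -/
theorem incl_tail {N : ℤ} {a : Q.cl.U₁ Q.clK} (ha : a ∈ Q.cl.tail Q.clK N) :
    C.incl a ∈ C.s.tail C.sK N := by
  unfold GradedLieSuper.tail at ha
  induction ha using Submodule.span_induction with
  | mem a ha =>
    obtain ⟨n, hn, ha⟩ := ha
    exact Submodule.subset_span ⟨n, hn, C.incl_degU₁ ha⟩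
  | zero => simp
  | add a b _ _ ha hb => rw [map_add]; exact add_mem ha hb
  | smul c a _ ha => rw [smul_eq_mul, map_mul]; exact C.s.mul_mem_tail C.sK _ ha

theorem continuous_incl : Continuous (C.incl : Q.cl.U₁ Q.clK →+* C.A) := by
  refine continuous_of_continuousAt_zero (C.incl : Q.cl.U₁ Q.clK →+* C.A) ?_
  rw [ContinuousAt, map_zero, (C.s.tail_hasBasis C.sK).tendsto_right_iff]
  intro N _
  exact (Q.cl.tail_hasBasis Q.clK).mem_iff.2 ⟨N, trivial, fun a ha => C.incl_tail ha⟩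

/-- The continuous map `U₁(cl(L))^com → U₁(s(L))^com`. -/
def inclCom : Q.ClCom →+* C.Acom :=
  Completion.mapRingHom (C.incl : Q.cl.U₁ Q.clK →+* C.A) C.continuous_incl

theorem inclCom_coe (a : Q.cl.U₁ Q.clK) : C.inclCom a = (C.incl a : C.Acom) :=
  Completion.mapRingHom_coe C.continuous_incl a

theorem continuous_inclCom : Continuous C.inclCom := Completion.continuous_map

theorem incl_algebraMap (c : ℂ) : C.inclCom (algebraMap ℂ Q.ClCom c) = algebraMap ℂ C.Acom c := by
  refine (C.inclCom_coe (algebraMap ℂ _ c)).trans ?_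
  rw [AlgHom.commutes]
  rfl

theorem incl_clI (x : L) : C.incl (Q.clI x) = C.iot x := C.incl_toU₁ _

theorem incl_clE (f : Q.rdual) : C.incl (Q.clE f) = C.eps f := C.incl_toU₁ _

theorem incl_rhoTerm (x : L) (j : ℤ) :
    C.incl (Q.rhoTerm Q.clI Q.clE x j) = Q.rhoTerm C.iot C.eps x j := by
  rw [Q.isClifford_cl.rhoTerm_eq, C.isClifford_s.rhoTerm_eq, normal_apply, normal_apply, map_sub,
    map_mul, map_smul, map_one, incl_clI, incl_clE]

/-- The map `ι` into the completion. -/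
def sI : L →ₗ[ℂ] C.Acom := (C.s.comHom C.sK).toLinearMap ∘ₗ C.iot

/-- The map `ε` into the completion. -/
def sE : Q.rdual →ₗ[ℂ] C.Acom := (C.s.comHom C.sK).toLinearMap ∘ₗ C.eps

/-- The map `L → U₁(s(L))` into the completion. -/
def sL : L →ₗ[ℂ] C.Acom := (C.s.comHom C.sK).toLinearMap ∘ₗ C.ell

/-- The map `ϵ` into the completion. -/
def sG : L →ₗ[ℂ] C.Acom := (C.s.comHom C.sK).toLinearMap ∘ₗ C.gho

theorem isClifford_sCom : Q.IsClifford C.sI C.sE := C.isClifford_s.map _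

theorem coe_normal (j : ℤ) (z : L) :
    ((Q.normal C.iot C.eps j z : C.A) : C.Acom) = Q.normal C.sI C.sE j z :=
  (Q.normal_map (C.s.comHom C.sK) j z).symm

theorem hasSum_rhoTerm (x : L) :
    HasSum (fun j => ((Q.rhoTerm C.iot C.eps x j : C.A) : C.Acom)) (C.inclCom (Q.rho₀ x)) := by
  have h := (Q.hasSum_rho₀ x).map C.inclCom C.continuous_inclCom
  refine h.congr_fun fun j => ?_
  rw [Function.comp_apply, ← coe_rhoTerm, inclCom_coe, incl_rhoTerm]

theorem hasSum_normal (x : L) :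
    HasSum (fun j => Q.normal C.sI C.sE j ⁅x, Q.e j⁆) (C.inclCom (Q.rho₀ x)) := by
  refine (C.hasSum_rhoTerm x).congr_fun fun j => ?_
  rw [C.isClifford_s.rhoTerm_eq, coe_normal]

theorem rho_eq (x : L) : Q.rho C.iot C.eps β x = C.inclCom (Q.rhoCl β x) := by
  rw [rho, (C.hasSum_rhoTerm x).tsum_eq, rhoCl_eq, map_add, incl_algebraMap]
  rfl

/-- `ρ^β(x)` in `U₁(s(L))^com`. -/
def sR : L →ₗ[ℂ] C.Acom where
  toFun x := C.inclCom (Q.rhoCl β x)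
  map_add' x y := by rw [← rhoLin_apply, ← rhoLin_apply, ← rhoLin_apply, map_add, map_add]
  map_smul' c x := by
    rw [← rhoLin_apply, ← rhoLin_apply, map_smul, Algebra.smul_def, map_mul, incl_algebraMap,
      ← Algebra.smul_def, RingHom.id_apply]

theorem sR_apply (x : L) : C.sR x = C.inclCom (Q.rho₀ x) + algebraMap ℂ C.Acom (β x) := by
  change C.inclCom (Q.rhoCl β x) = _
  rw [rhoCl_eq, map_add, incl_algebraMap]

theorem thetaBar_eq (x : L) : C.thetaBar x = C.sL x + C.sR x + C.sG x := by
  rw [thetaBar, rho_eq]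
  rfl

theorem sR_comm_sR (hβ : β ∈ Q.dualGr 0) (x y : L) : C.sR x * C.sR y - C.sR y * C.sR x
    = C.sR ⁅x, y⁆ + algebraMap ℂ C.Acom ((Q.gamma β).form x y) := by
  have h := congrArg C.inclCom (Q.isGamma_gamma β hβ x y)
  rw [map_sub, map_sub, map_mul, map_mul, sub_eq_iff_eq_add'] at h
  refine h.trans ?_
  congr 1
  exact C.incl_algebraMap _

theorem inclCom_comI (x : L) : C.inclCom (Q.comI x) = C.sI x :=
  (C.inclCom_coe _).trans (congrArg _ (C.incl_clI x))

theorem sR_comm_sI (x y : L) : C.sR x * C.sI y - C.sI y * C.sR x = C.sI ⁅x, y⁆ := by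
  have h := congrArg C.inclCom (Q.rho₀_comm_i x y)
  rw [map_sub, map_mul, map_mul, inclCom_comI, inclCom_comI] at h
  rw [sR_apply, add_mul, mul_add, Algebra.commutes, add_sub_add_right_eq_sub, h]

/-- An element commuting with all ι and ε commutes with each term of the series, and multiplication
is continuous. -/
theorem commute_sR {a : C.Acom} (hI : ∀ x, Commute a (C.sI x)) (hE : ∀ f, Commute a (C.sE f))
    (x : L) : Commute a (C.sR x) := by
  rw [sR_apply]
  refine Commute.add_right ?_ (Algebra.commute_algebraMap_right _ _)
  refine ((C.hasSum_normal x).mul_left a).unique ?_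
  refine ((C.hasSum_normal x).mul_right a).congr_fun fun j => ?_
  rw [normal_apply]
  exact ((hI _).mul_right (hE _)).sub_right ((Commute.one_right a).smul_right _)

theorem commute_sL_sI (x y : L) : Commute (C.sL x) (C.sI y) :=
  (C.ell_clA x _).map (C.s.comHom C.sK)

theorem commute_sL_sE (x : L) (f : Q.rdual) : Commute (C.sL x) (C.sE f) :=
  (C.ell_clA x _).map (C.s.comHom C.sK)

theorem commute_sG_sI (x y : L) : Commute (C.sG x) (C.sI y) :=
  (C.gho_clA x _).map (C.s.comHom C.sK)

theorem commute_sG_sE (x : L) (f : Q.rdual) : Commute (C.sG x) (C.sE f) :=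
  (C.gho_clA x _).map (C.s.comHom C.sK)

theorem commute_sL_sG (x y : L) : Commute (C.sL x) (C.sG y) :=
  (C.ell_gho x y).map (C.s.comHom C.sK)

theorem sL_comm_sL (x y : L) : C.sL x * C.sL y - C.sL y * C.sL x = C.sL ⁅x, y⁆ := by
  have h := congrArg (C.s.comHom C.sK) (C.ell_ell x y)
  rwa [map_sub, map_mul, map_mul] at h

theorem sG_comm_sG (x y : L) : C.sG x * C.sG y - C.sG y * C.sG x
    = -algebraMap ℂ C.Acom ((Q.gamma β).form x y) := by
  have h := congrArg (C.s.comHom C.sK) (C.gho_gho x y)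
  rw [map_sub, map_mul, map_mul, map_neg, map_smul, map_one, ← Algebra.algebraMap_eq_smul_one] at h
  exact h

theorem thetaBar_comm_sI (x y : L) :
    C.thetaBar x * C.sI y - C.sI y * C.thetaBar x = C.sI ⁅x, y⁆ := by
  rw [thetaBar_eq, add_mul, add_mul, mul_add, mul_add, (C.commute_sL_sI x y).eq,
    (C.commute_sG_sI x y).eq, ← C.sR_comm_sI x y]
  abel

/-- The three summands commute with each other. The anomaly +γ of ρ^β is cancelled by the bracket -γ
on ϵ(F_β), and the ϵ term missing on the left vanishes on the right because [x, y] lies in the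
radical. -/
theorem thetaBar_comm_thetaBar (hβ : β ∈ Q.dualGr 0)
    (hL : ∀ x y : L, ⁅x, y⁆ ∈ (Q.gamma β).radical) (x y : L) :
    C.thetaBar x * C.thetaBar y - C.thetaBar y * C.thetaBar x = C.thetaBar ⁅x, y⁆ := by
  have hG : C.sG ⁅x, y⁆ = 0 := by
    simp only [sG, gho, LinearMap.comp_apply, C.proj_eq_zero (hL x y), map_zero]
  have hLR : ∀ x y, C.sL x * C.sR y = C.sR y * C.sL x := fun x y =>
    C.commute_sR (C.commute_sL_sI x) (C.commute_sL_sE x) y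
  have hGR : ∀ x y, C.sG x * C.sR y = C.sR y * C.sG x := fun x y =>
    C.commute_sR (C.commute_sG_sI x) (C.commute_sG_sE x) y
  rw [thetaBar_eq, thetaBar_eq, thetaBar_eq, hG, add_zero, add_assoc, add_assoc,
    comm_sum (hLR x y) (C.commute_sL_sG x y) (hGR y x).symm (hLR y x)
      (C.commute_sL_sG y x) (hGR x y).symm, C.sL_comm_sL, C.sR_comm_sR hβ, C.sG_comm_sG]
  abel

end Complement
end QuasiFinite

namespace QuasiFinite

variable {L : Type u} [LieRing L] [LieAlgebra ℂ L] (Q : QuasiFinite L)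

/-! ### The cubic term and homogeneity of the projection to F_β. -/

section Cubic

variable {A : Type v} [Ring A] [Algebra ℂ A] {i : L →ₗ[ℂ] A} {ε : Q.rdual →ₗ[ℂ] A}
variable {Q}

/-- For k > 0 and j ≤ 0 both factors are annihilation operators and anticommute, so ι(e_k) may be
written on the right for every j, matching the convention of `normal₃`. -/
theorem IsClifford.normal_e_pos (h : Q.IsClifford i ε) {k : ℤ} (hk : 0 < k) (j : ℤ) :
    Q.normal i ε j (Q.e k) = -(ε (Q.estar j) * i (Q.e k)) := by
  by_cases hj : 0 < j
  · exact h.normal_pos hj _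
  · rw [normal_nonpos hj, h.ei_basis, if_neg (by omega)]
    abel

theorem normal_e_nonpos {k : ℤ} (hk : ¬ 0 < k) (j : ℤ) :
    Q.normal i ε j (Q.e k) = i (Q.e k) * ε (Q.estar j) := by
  rw [normal_apply, Q.e.repr_self, Finsupp.single_apply]
  have : (if 0 < j then if k = j then (1 : ℂ) else 0 else 0) = 0 := by
    split_ifs with h1 h2
    · omega
    · rfl
    · rfl
  rw [this, zero_smul, sub_zero]

theorem IsClifford.ee_i (h : Q.IsClifford i ε) (j l : ℤ) (x : L) :
    ε (Q.estar j) * ε (Q.estar l) * i x = i x * (ε (Q.estar j) * ε (Q.estar l))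
      + Q.e.repr x l • ε (Q.estar j) - Q.e.repr x j • ε (Q.estar l) := by
  rw [mul_assoc, h.ei, mul_sub, ← mul_assoc, h.ei, estar_apply, estar_apply]
  simp only [mul_smul_comm, sub_mul, smul_mul_assoc, one_mul, mul_one, mul_assoc]
  abel

/-- Bracketing with ι(x) contracts one of the two ε factors. The position of ι(e_k) depends only on
the sign of k, so the remaining quadratic product is already normally ordered and no constant
appears. -/
theorem IsClifford.normal₃_anticomm (h : Q.IsClifford i ε) (k j l : ℤ) (x : L) :
    Q.normal₃ i ε k j l * i x + i x * Q.normal₃ i ε k j l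
      = Q.e.repr x l • Q.normal i ε j (Q.e k) - Q.e.repr x j • Q.normal i ε l (Q.e k) := by
  unfold normal₃
  split_ifs with hk
  · rw [h.normal_e_pos hk, h.normal_e_pos hk, mul_assoc, h.ii, mul_neg, ← mul_assoc, h.ee_i]
    simp only [add_mul, sub_mul, smul_mul_assoc, smul_neg, mul_assoc]
    abel
  · rw [normal_e_nonpos hk, normal_e_nonpos hk, mul_assoc (i (Q.e k)), mul_assoc, h.ee_i,
      ← mul_assoc (i x) (i (Q.e k)), h.ii x (Q.e k)]
    simp only [mul_add, mul_sub, mul_smul_comm, mul_assoc, neg_mul]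
    abel

theorem IsClifford.cubicTerm_anticomm (h : Q.IsClifford i ε) (j l : ℤ) (x : L) :
    Q.cubicTerm i ε j l * i x + i x * Q.cubicTerm i ε j l
      = Q.e.repr x l • Q.normal i ε j ⁅Q.e j, Q.e l⁆
        - Q.e.repr x j • Q.normal i ε l ⁅Q.e j, Q.e l⁆ := by
  unfold cubicTerm
  rw [← sum_repr_smul (Q.normal i ε j), ← sum_repr_smul (Q.normal i ε l)]
  simp only [Finsupp.sum, Finset.sum_mul, Finset.mul_sum, Finset.smul_sum]
  rw [← Finset.sum_add_distrib, ← Finset.sum_sub_distrib]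
  refine Finset.sum_congr rfl fun k _ => ?_
  rw [smul_mul_assoc, mul_smul_comm, ← smul_add, h.normal₃_anticomm, smul_sub, smul_comm,
    smul_comm (Q.e.repr x j)]

end Cubic

/-- The form has degree 0, so a vector of L_k detects only the component in degree -k; each
homogeneous component of a radical vector is therefore radical. -/
theorem Form.radical_graded {Q : QuasiFinite L} (g : Q.Form) :
    g.radical ≤ ⨆ n, g.radical ⊓ Q.gr n := by
  intro x hx
  have hx' : x ∈ ⨆ n, Q.gr n := Q.internal.submodule_iSup_eq_top ▸ Submodule.mem_top
  obtain ⟨f, hf, rfl⟩ := (Submodule.mem_iSup_iff_exists_finsupp _ _).1 hx'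
  refine sum_mem fun n _ => Submodule.mem_iSup_of_mem n ⟨?_, hf n⟩
  refine Q.ext_of_gr fun k y hy => ?_
  by_cases hnk : n + k = 0
  · have h : g.form (∑ m ∈ f.support, f m) = 0 := hx
    have h1 := LinearMap.congr_fun h y
    rw [map_sum, LinearMap.sum_apply, Finset.sum_eq_single n] at h1
    · exact h1
    · intro m _ hm
      exact g.deg m k (by omega) _ (hf m) _ hy
    · intro hn
      rw [Finsupp.notMem_support_iff.1 hn, map_zero, LinearMap.zero_apply]
  · exact g.deg n k hnk _ (hf n) _ hy

/-- A decomposition into graded subspaces is compatible with the homogeneous components. -/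
theorem gr_le_sup {Q : QuasiFinite L} {F R : Submodule ℂ L} (hF : F ≤ ⨆ n, F ⊓ Q.gr n)
    (hR : R ≤ ⨆ n, R ⊓ Q.gr n) (h : F ⊔ R = ⊤) (m : ℤ) :
    Q.gr m ≤ (F ⊓ Q.gr m) ⊔ (R ⊓ Q.gr m) := by
  intro x hx
  have hx' : x ∈ ⨆ n, (F ⊓ Q.gr n) ⊔ (R ⊓ Q.gr n) := by
    rw [iSup_sup_eq]
    exact (sup_le_sup hF hR) (h ▸ Submodule.mem_top)
  -- The part outside degree m is both in L_m and in the sum of the other components, hence zero by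
  -- independence.
  rw [iSup_split_single _ m] at hx'
  obtain ⟨y, hy, z, hz, rfl⟩ := Submodule.mem_sup.1 hx'
  have hy' : y ∈ Q.gr m := (sup_le inf_le_right inf_le_right : _ ≤ Q.gr m) hy
  have hz' : z ∈ ⨆ n, ⨆ (_ : n ≠ m), Q.gr n :=
    (iSup₂_mono fun n _ => (sup_le inf_le_right inf_le_right : _ ≤ Q.gr n) :
      (⨆ n, ⨆ (_ : n ≠ m), (F ⊓ Q.gr n) ⊔ (R ⊓ Q.gr n)) ≤ _) hz
  have h0 : z = 0 := (Submodule.disjoint_def.1 (Q.internal.submodule_iSupIndep m)) z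
    ((Submodule.add_mem_iff_right _ hy').1 hx) hz'
  rw [h0, add_zero]
  exact hy

namespace Complement

variable {Q} {β : Module.Dual ℂ L} (C : Q.Complement β)

theorem proj_mem {m : ℤ} {x : L} (hx : x ∈ Q.gr m) : C.proj x ∈ C.FDeg m := by
  obtain ⟨f, hf, r, hr, rfl⟩ := Submodule.mem_sup.1
    (gr_le_sup C.graded (Q.gamma β).radical_graded C.isCompl.sup_eq_top m hx)
  rw [map_add, C.proj_eq_zero hr.1, add_zero]
  have : C.proj f = ⟨f, hf.1⟩ := Submodule.projectionOnto_apply_left C.isCompl ⟨f, hf.1⟩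
  rw [this]
  exact hf.2

/-! ### Convergence of the series -/

theorem iot_mem_tail {n N : ℤ} {x : L} (hx : x ∈ Q.gr n) (h : N ≤ n) :
    C.iot x ∈ C.s.tail C.sK N :=
  C.s.toU₁_mem_tail C.sK (C.clA_deg (Q.mem_clDeg.2 ⟨hx, zero_mem _, fun _ => rfl⟩)) h

theorem eps_mem_tail {j N : ℤ} (h : N ≤ -Q.edeg j) : C.eps (Q.estar j) ∈ C.s.tail C.sK N :=
  C.s.toU₁_mem_tail C.sK
    (C.clA_deg (Q.mem_clDeg.2 ⟨zero_mem _, Q.estar_mem j, fun _ => rfl⟩)) h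

theorem ell_mem_tail {n N : ℤ} {x : L} (hx : x ∈ Q.gr n) (h : N ≤ n) :
    C.ell x ∈ C.s.tail C.sK N :=
  C.s.toU₁_mem_tail C.sK (n := n) ⟨hx, zero_mem _, zero_mem _⟩ h

theorem gho_mem_tail {n N : ℤ} {x : L} (hx : x ∈ Q.gr n) (h : N ≤ n) :
    C.gho x ∈ C.s.tail C.sK N :=
  C.s.toU₁_mem_tail C.sK (n := n) ⟨zero_mem _, zero_mem _, C.proj_mem hx⟩ h

/-- The factors commute, so either may stand on the right: ε(e_j^*) has high degree when deg e_j is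
very negative, and a(e_j) when it is large. -/
theorem summable_linear {a : L →ₗ[ℂ] C.A} (ha : ∀ x f, Commute (a x) (C.eps f))
    (htail : ∀ {n N : ℤ} {x : L}, x ∈ Q.gr n → N ≤ n → a x ∈ C.s.tail C.sK N) :
    Summable fun j : ℤ => ((a (Q.e j) * C.eps (Q.estar j) : C.A) : C.Acom) := by
  refine C.s.summable_coe C.sK fun N => ?_
  refine (Q.finite_edeg_Icc (-N) N).subset fun j hj => ?_
  by_contra h
  simp only [Set.mem_ofPred_eq, not_and_or] at h
  refine hj ?_
  rcases h with h | h
  · exact C.s.mul_mem_tail C.sK _ (C.eps_mem_tail (by omega))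
  · rw [ha]
    exact C.s.mul_mem_tail C.sK _ (htail (Q.e_mem j) (by omega))

theorem summable_ell :
    Summable fun j : ℤ => ((C.ell (Q.e j) * C.eps (Q.estar j) : C.A) : C.Acom) :=
  C.summable_linear (fun x _ => C.ell_clA x _) C.ell_mem_tail

theorem summable_gho :
    Summable fun j : ℤ => ((C.eps (Q.estar j) * C.gho (Q.e j) : C.A) : C.Acom) := by
  have := C.summable_linear (fun x _ => C.gho_clA x _) C.gho_mem_tail
  refine this.congr fun j => ?_
  exact congrArg (fun a : C.A => (a : C.Acom)) (C.gho_clA (Q.e j) _).eq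

/-- One of the three factors has degree at least N and can be brought to the right without
contraction. Otherwise, for k ≤ 0, both degrees exceed -N with sum at most 0. For k > 0 the sum is
below N, and an index equal to k forces the other degree to be 0. All these cases stay within 2|N|.
-/
theorem normal₃_mem_tail {j l k N : ℤ} (hk : Q.edeg k = Q.edeg j + Q.edeg l)
    (h : ¬ (|Q.edeg j| ≤ 2 * |N| ∧ |Q.edeg l| ≤ 2 * |N|)) :
    Q.normal₃ C.iot C.eps k j l ∈ C.s.tail C.sK N := by
  have hS := C.isClifford_s
  have hN := neg_abs_le N
  have hN' := le_abs_self N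
  have h0 := Q.edeg_pos k
  rw [abs_le, abs_le] at h
  unfold normal₃
  split_ifs with hk0
  · by_cases hkN : N ≤ Q.edeg k
    · exact C.s.mul_mem_tail C.sK _ (C.iot_mem_tail (Q.e_mem k) hkN)
    by_cases hl : k ≠ l ∧ N ≤ -Q.edeg l
    · rw [mul_assoc, hS.ei_basis, if_neg hl.1, zero_sub, mul_neg, ← mul_assoc]
      exact neg_mem (C.s.mul_mem_tail C.sK _ (C.eps_mem_tail hl.2))
    by_cases hj : k ≠ j ∧ N ≤ -Q.edeg j
    · rw [hS.ee, neg_mul, mul_assoc, hS.ei_basis, if_neg hj.1, zero_sub, mul_neg, ← mul_assoc]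
      exact neg_mem (neg_mem (C.s.mul_mem_tail C.sK _ (C.eps_mem_tail hj.2)))
    exfalso
    by_cases h1 : k = l
    · subst h1; omega
    by_cases h2 : k = j
    · subst h2; omega
    omega
  · by_cases hl : N ≤ -Q.edeg l
    · exact C.s.mul_mem_tail C.sK _ (C.eps_mem_tail hl)
    by_cases hj : N ≤ -Q.edeg j
    · rw [mul_assoc, hS.ee, mul_neg, ← mul_assoc]
      exact neg_mem (C.s.mul_mem_tail C.sK _ (C.eps_mem_tail hj))
    omega

theorem summable_cubic : Summable fun p : {p : ℤ × ℤ // p.1 < p.2} =>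
    ((Q.cubicTerm C.iot C.eps p.1.1 p.1.2 : C.A) : C.Acom) := by
  refine C.s.summable_coe C.sK fun N => ?_
  refine ((((Q.finite_edeg_Icc (-(2 * |N|)) (2 * |N|)).prod
    (Q.finite_edeg_Icc (-(2 * |N|)) (2 * |N|)))).preimage
      (Subtype.val_injective (p := fun p : ℤ × ℤ => p.1 < p.2)).injOn).subset fun p hp => ?_
  by_contra h
  refine hp (sum_mem fun k hk => C.s.smul_mem_tail C.sK _ (C.normal₃_mem_tail
    (Q.edeg_of_repr_ne_zero (Q.lie_e_mem _ _) (Finsupp.mem_support_iff.1 hk)) fun h' => h ?_))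
  rw [abs_le, abs_le] at h'
  exact h'

theorem seriesConverge : C.SeriesConverge :=
  ⟨fun x => (Q.summable_nrm x).congr fun j => (Q.coe_rhoTerm x j).symm, fun x => (C.hasSum_rhoTerm x).summable, C.summable_ell,
    C.summable_cubic, C.summable_gho⟩

/-! ### The bracket of `d̄^β` with `ι(x)` -/

theorem sE_sI_add (f : Q.rdual) (x : L) : C.sE f * C.sI x + C.sI x * C.sE f = f.1 x • 1 := by
  rw [C.isClifford_sCom.ei]
  abel

/-- Contraction with ι(x) replaces ε(e_j^*) by the j-th coordinate of x, and the series collapses to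
the expansion of a(x). It is applied to both L and ϵ. -/
theorem linear_anticomm (a : L →ₗ[ℂ] C.Acom) (ha : ∀ x y, Commute (a x) (C.sI y)) (x : L)
    {D : C.Acom} (hD : HasSum (fun j => a (Q.e j) * C.sE (Q.estar j)) D) :
    D * C.sI x + C.sI x * D = a x := by
  refine ((hD.mul_right _).add (hD.mul_left _)).unique ?_
  refine (Q.hasSum_repr_smul a x).congr_fun fun j => ?_
  rw [← mul_assoc, ← (ha _ _).eq, mul_assoc, mul_assoc, ← mul_add, sE_sI_add, mul_smul_comm,
    mul_one, estar_apply]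

/-- The pair `{a, b}` in increasing order. -/
def orderedPair (a : ℤ) (b : {b : ℤ // b ≠ a}) : {p : ℤ × ℤ // p.1 < p.2} :=
  if h : b.1 < a then ⟨(b.1, a), h⟩
  else ⟨(a, b.1), lt_of_le_of_ne (not_lt.1 h) (Ne.symm b.2)⟩

theorem orderedPair_injective (a : ℤ) : Function.Injective (orderedPair a) := by
  rintro ⟨b, hb⟩ ⟨c, hc⟩ h
  have h1 := congrArg (fun p : {p : ℤ × ℤ // p.1 < p.2} => p.1.1 + p.1.2) h
  refine Subtype.ext ?_
  unfold orderedPair at h1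
  split_ifs at h1 <;> dsimp only at h1 ⊢ <;> omega

/-- Only pairs containing a survive contraction with ι(e_a). Whichever index comes first,
antisymmetry of the bracket makes the pair {a, b} contribute -:ι([e_a, e_b]) ε(e_b^*):, so the
unordered pairs reproduce the single sum defining ρ. -/
theorem cubic_anticomm (a : ℤ) {D : C.Acom} (hD : HasSum (fun p : {p : ℤ × ℤ // p.1 < p.2} =>
      ((Q.cubicTerm C.iot C.eps p.1.1 p.1.2 : C.A) : C.Acom)) D) :
    D * C.sI (Q.e a) + C.sI (Q.e a) * D = -C.inclCom (Q.rho₀ (Q.e a)) := by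
  set f : {p : ℤ × ℤ // p.1 < p.2} → C.Acom := fun p =>
    Q.e.repr (Q.e a) p.1.2 • Q.normal C.sI C.sE p.1.1 ⁅Q.e p.1.1, Q.e p.1.2⁆
        - Q.e.repr (Q.e a) p.1.1 • Q.normal C.sI C.sE p.1.2 ⁅Q.e p.1.1, Q.e p.1.2⁆ with hf
  have h1 : HasSum f (D * C.sI (Q.e a) + C.sI (Q.e a) * D) := by
    refine ((hD.mul_right _).add (hD.mul_left _)).congr_fun fun p => ?_
    have := congrArg (C.s.comHom C.sK) (C.isClifford_s.cubicTerm_anticomm p.1.1 p.1.2 (Q.e a))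
    rw [map_add, map_mul, map_mul, map_sub, map_smul, map_smul, C.s.comHom_apply, C.s.comHom_apply,
      C.s.comHom_apply, C.s.comHom_apply, coe_normal, coe_normal] at this
    exact this.symm
  have h0 : ∀ p ∉ Set.range (orderedPair a), f p = 0 := by
    rintro ⟨⟨j, l⟩, hjl⟩ hp
    have hjl' : j < l := hjl
    have hj : a ≠ j := by
      rintro rfl
      refine hp ⟨⟨l, by omega⟩, ?_⟩
      rw [orderedPair, dif_neg (by dsimp only; omega)]
    have hl : a ≠ l := by
      rintro rfl
      refine hp ⟨⟨j, by omega⟩, ?_⟩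
      rw [orderedPair, dif_pos (by dsimp only; omega)]
    simp [hf, Finsupp.single_apply, hj, hl]
  have h2 := ((orderedPair_injective a).hasSum_iff h0).2 h1
  have h3 : ∀ b : {b : ℤ // b ≠ a}, f (orderedPair a b)
      = -Q.normal C.sI C.sE b.1 ⁅Q.e a, Q.e b.1⁆ := by
    rintro ⟨b, hb⟩
    rw [hf, orderedPair]
    split_ifs with h
    · simp only [Q.e.repr_self, Finsupp.single_apply, if_true, if_neg (Ne.symm hb)]
      rw [one_smul, zero_smul, sub_zero, ← lie_skew, map_neg]
    · simp only [Q.e.repr_self, Finsupp.single_apply, if_true, if_neg (Ne.symm hb)]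
      rw [one_smul, zero_smul, zero_sub]
  refine h2.unique ?_
  have h4 := (C.hasSum_normal (Q.e a)).neg
  -- The index b = a, absent from the pairs, contributes nothing since [e_a, e_a] = 0.
  have h5 : Function.support (fun j => -Q.normal C.sI C.sE j ⁅Q.e a, Q.e j⁆) ⊆ {b | b ≠ a} := by
    rintro b hb rfl
    simp at hb
  refine ((hasSum_subtype_iff_of_support_subset h5).2 h4).congr_fun fun b => ?_
  exact h3 b

theorem dBar_anticomm (hβ : β ∈ Q.dualGr 0) (x : L) :
    C.dBar hβ * C.sI x + C.sI x * C.dBar hβ = C.thetaBar x := by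
  -- Both sides are linear in x, and the contraction of the cubic series was computed on basis
  -- vectors. The term ε(β) supplies the scalar β(x) of ρ^β.
  have h : LinearMap.mulLeft ℂ (C.dBar hβ) ∘ₗ C.sI + LinearMap.mulRight ℂ (C.dBar hβ) ∘ₗ C.sI
      = C.sL + C.sR + C.sG := by
    refine Q.e.ext fun a => ?_
    change C.dBar hβ * C.sI (Q.e a) + C.sI (Q.e a) * C.dBar hβ
      = C.sL (Q.e a) + C.sR (Q.e a) + C.sG (Q.e a)
    have h1 := C.linear_anticomm C.sL C.commute_sL_sI (Q.e a)
      (D := ∑' j : ℤ, ((C.ell (Q.e j) * C.eps (Q.estar j) : C.A) : C.Acom))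
      (C.summable_ell.hasSum.congr_fun fun j => (map_mul (C.s.comHom C.sK) _ _).symm)
    have h2 := C.linear_anticomm C.sG C.commute_sG_sI (Q.e a)
      (D := ∑' j : ℤ, ((C.eps (Q.estar j) * C.gho (Q.e j) : C.A) : C.Acom))
      (C.summable_gho.hasSum.congr_fun fun j => by
        rw [(C.commute_sG_sE _ _).eq]
        exact (map_mul (C.s.comHom C.sK) _ _).symm)
    have h3 := C.cubic_anticomm a C.summable_cubic.hasSum
    have h4 := C.sE_sI_add ⟨β, Submodule.mem_iSup_of_mem 0 hβ⟩ (Q.e a)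
    rw [← h1, ← h2, sR_apply, eq_neg_iff_add_eq_zero.1 h3 |> eq_neg_of_add_eq_zero_right,
      Algebra.algebraMap_eq_smul_one, ← h4, dBar, d]
    change (_ - _ + C.sE _ + _) * _ + _ * (_ - _ + C.sE _ + _) = _
    simp only [add_mul, sub_mul, mul_add, mul_sub]
    abel
  rw [thetaBar_eq]
  exact LinearMap.congr_fun h x

/-! ### Charges -/

theorem ell_charge (x : L) : C.ell x ∈ wordSpan (C.s.toU₁ C.sK) C.charge 0 :=
  mem_wordSpan (j := C.s.toU₁ C.sK) ⟨by simp, zero_mem _, zero_mem _⟩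

theorem gho_charge (x : L) : C.gho x ∈ wordSpan (C.s.toU₁ C.sK) C.charge 0 :=
  mem_wordSpan (j := C.s.toU₁ C.sK) ⟨zero_mem _, zero_mem _, by simp⟩

theorem iot_charge (x : L) : C.iot x ∈ wordSpan (C.s.toU₁ C.sK) C.charge (-1) :=
  mem_wordSpan (j := C.s.toU₁ C.sK) ⟨zero_mem _, ⟨by simp, zero_mem _⟩, zero_mem _⟩

theorem eps_charge (f : Q.rdual) : C.eps f ∈ wordSpan (C.s.toU₁ C.sK) C.charge 1 :=
  mem_wordSpan (j := C.s.toU₁ C.sK)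
    ⟨zero_mem _, ⟨zero_mem _, by simp, zero_mem _⟩, zero_mem _⟩

theorem normal₃_charge (k j l : ℤ) :
    Q.normal₃ C.iot C.eps k j l ∈ wordSpan (C.s.toU₁ C.sK) C.charge 1 := by
  have hi := C.iot_charge (Q.e k)
  have hj := C.eps_charge (Q.estar j)
  have hl := C.eps_charge (Q.estar l)
  have h2 : (1 : ℤ) + 1 = 2 := by norm_num
  have h1 : (2 : ℤ) + -1 = 1 := by norm_num
  have h0 : (-1 : ℤ) + 1 = 0 := by norm_num
  have h01 : (0 : ℤ) + 1 = 1 := by norm_num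
  unfold normal₃
  split_ifs
  · exact mul_mem_wordSpan_of_eq h1 (mul_mem_wordSpan_of_eq h2 hj hl) hi
  · exact mul_mem_wordSpan_of_eq h01 (mul_mem_wordSpan_of_eq h0 hi hj) hl

theorem dBar_charge (hβ : β ∈ Q.dualGr 0) : C.dBar hβ ∈ C.chargeCom 1 := by
  have hcoe : ∀ {a : C.A}, a ∈ wordSpan (C.s.toU₁ C.sK) C.charge 1 →
      (a : C.Acom) ∈ C.chargeCom 1 := fun ha => C.s.coe_mem_comPiece C.sK ha
  refine C.s.add_mem_comPiece C.sK (C.s.add_mem_comPiece C.sK (C.s.sub_mem_comPiece C.sK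
    (C.s.tsum_mem_comPiece C.sK fun j => hcoe ?_) (C.s.tsum_mem_comPiece C.sK fun p => hcoe ?_))
    (hcoe (C.eps_charge _))) (C.s.tsum_mem_comPiece C.sK fun j => hcoe ?_)
  · exact mul_mem_wordSpan_of_eq (zero_add 1) (C.ell_charge _) (C.eps_charge _)
  · exact sum_mem fun k _ => Submodule.smul_mem _ _ (C.normal₃_charge k _ _)
  · exact mul_mem_wordSpan_of_eq (add_zero 1) (C.eps_charge _) (C.gho_charge _)

theorem thetaBar_charge (x : L) : C.thetaBar x ∈ C.chargeCom 0 := by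
  have hcoe : ∀ {a : C.A}, a ∈ wordSpan (C.s.toU₁ C.sK) C.charge 0 →
      (a : C.Acom) ∈ C.chargeCom 0 := fun ha => C.s.coe_mem_comPiece C.sK ha
  have hsc : ∀ c : ℂ, algebraMap ℂ C.A c ∈ wordSpan (C.s.toU₁ C.sK) C.charge 0 := fun c => by
    rw [Algebra.algebraMap_eq_smul_one]
    exact Submodule.smul_mem _ _ (one_mem_wordSpan _ _)
  refine C.s.add_mem_comPiece C.sK (C.s.add_mem_comPiece C.sK (hcoe (C.ell_charge x)) ?_)
    (hcoe (C.gho_charge x))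
  refine C.s.add_mem_comPiece C.sK (C.s.tsum_mem_comPiece C.sK fun j => hcoe ?_) (hcoe (hsc _))
  rw [C.isClifford_s.rhoTerm_eq, normal_apply]
  exact sub_mem (mul_mem_wordSpan_of_eq (neg_add_cancel 1) (C.iot_charge _) (C.eps_charge _))
    (Submodule.smul_mem _ _ (one_mem_wordSpan _ _))

end Complement
end QuasiFinite

namespace QuasiFinite

variable {L : Type u} [LieRing L] [LieAlgebra ℂ L] (Q : QuasiFinite L)

/-! ### Projecting away the operators ε(e_j^*). -/

section Reduction

variable {A : Type v} [Ring A] [Algebra ℂ A] (i : L →ₗ[ℂ] A) (ε : Q.rdual →ₗ[ℂ] A) (σ : ℂ)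

/-- The supercommutator with `ι(e_j)`, where `σ` is the sign of the second argument. -/
def adI (j : ℤ) : A →ₗ[ℂ] A :=
  LinearMap.mulLeft ℂ (i (Q.e j)) - σ • LinearMap.mulRight ℂ (i (Q.e j))

/-- The projection removing `ε(e_j^*)`, written to the left for `j > 0` and to the right for
`j ≤ 0`. -/
def red (j : ℤ) : A →ₗ[ℂ] A :=
  if 0 < j then LinearMap.id - LinearMap.mulLeft ℂ (ε (Q.estar j)) ∘ₗ Q.adI i σ j
  else LinearMap.id + σ • LinearMap.mulRight ℂ (ε (Q.estar j)) ∘ₗ Q.adI i σ j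

/-- The composition of the projections `red` over a list. -/
def reds : List ℤ → A →ₗ[ℂ] A
  | [] => LinearMap.id
  | j :: l => reds l ∘ₗ Q.red i ε σ j

/-- The subspace `ε(e_j^*) A` for `j > 0` and `A ε(e_j^*)` for `j ≤ 0`. -/
def mult (j : ℤ) : Submodule ℂ A :=
  if 0 < j then LinearMap.range (LinearMap.mulLeft ℂ (ε (Q.estar j)))
  else LinearMap.range (LinearMap.mulRight ℂ (ε (Q.estar j)))

variable {i ε σ} {Q}

theorem red_pos {j : ℤ} (hj : 0 < j) (u : A) : Q.red i ε σ j u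
    = u - ε (Q.estar j) * (i (Q.e j) * u - σ • (u * i (Q.e j))) := by
  rw [red, if_pos hj]
  rfl

theorem red_nonpos {j : ℤ} (hj : ¬ 0 < j) (u : A) : Q.red i ε σ j u
    = u + σ • ((i (Q.e j) * u - σ • (u * i (Q.e j))) * ε (Q.estar j)) := by
  rw [red, if_neg hj]
  rfl

theorem mem_mult_pos {j : ℤ} (hj : 0 < j) {u : A} :
    u ∈ Q.mult ε j ↔ ∃ b, ε (Q.estar j) * b = u := by
  rw [mult, if_pos hj]
  rfl

theorem mem_mult_nonpos {j : ℤ} (hj : ¬ 0 < j) {u : A} :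
    u ∈ Q.mult ε j ↔ ∃ b, b * ε (Q.estar j) = u := by
  rw [mult, if_neg hj]
  rfl

theorem red_eq_self {j : ℤ} {u : A} (h : i (Q.e j) * u = σ • (u * i (Q.e j))) :
    Q.red i ε σ j u = u := by
  by_cases hj : 0 < j
  · rw [red_pos hj, h, sub_self, mul_zero, sub_zero]
  · rw [red_nonpos hj, h, sub_self, zero_mul, smul_zero, add_zero]

theorem IsClifford.e_sq (h : Q.IsClifford i ε) (j : ℤ) : ε (Q.estar j) * ε (Q.estar j) = 0 := by
  have := h.ee (Q.estar j) (Q.estar j)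
  have h2 : (2 : ℂ) • (ε (Q.estar j) * ε (Q.estar j)) = 0 := by
    rw [two_smul]
    nth_rw 1 [this]
    exact neg_add_cancel _
  exact (smul_eq_zero.1 h2).resolve_left two_ne_zero

/-- With ε = ε(e_j^*) and ι = ι(e_j), the reason is ε² = 0 together with ει + ιε = 1, which give ειε
= ε. -/
theorem IsClifford.red_mult_self (h : Q.IsClifford i ε) (hσ : σ * σ = 1) {j : ℤ} {u : A}
    (hu : u ∈ Q.mult ε j) : Q.red i ε σ j u = 0 := by
  have h1 := h.ei_basis j j
  rw [if_pos rfl] at h1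
  by_cases hj : 0 < j
  · obtain ⟨b, rfl⟩ := (mem_mult_pos hj).1 hu
    rw [red_pos hj, mul_sub, mul_smul_comm, mul_assoc (ε _) b, ← mul_assoc (ε _) (ε _),
      h.e_sq, zero_mul, smul_zero, sub_zero, ← mul_assoc, ← mul_assoc, h1, sub_mul, sub_mul,
      mul_assoc (i _) (ε _) (ε _), h.e_sq]
    simp
  · obtain ⟨b, rfl⟩ := (mem_mult_nonpos hj).1 hu
    rw [red_nonpos hj, sub_mul, smul_sub, smul_mul_assoc, smul_smul, hσ, one_smul, mul_assoc (i _),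
      mul_assoc b, h.e_sq, mul_assoc b, h1, mul_assoc b, sub_mul, mul_assoc (i _) (ε _) (ε _),
      h.e_sq]
    simp

/-- Both ι(e_j) and ε(e_j^*) anticommute with ε(e_k^*) for k ≠ j, so the latter can be pulled back
out to its side. Multiples already annihilated by one projection thus do not obstruct the next. -/
theorem IsClifford.red_mult_of_ne (h : Q.IsClifford i ε) {j k : ℤ} (hjk : j ≠ k)
    {u : A} (hu : u ∈ Q.mult ε k) : Q.red i ε σ j u ∈ Q.mult ε k := by
  have h1 := h.ei_basis k j
  rw [if_neg hjk, zero_sub] at h1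
  have h1' : i (Q.e j) * ε (Q.estar k) = -(ε (Q.estar k) * i (Q.e j)) := by rw [h1, neg_neg]
  have h2 := h.ee (Q.estar j) (Q.estar k)
  have h2' := h.ee (Q.estar k) (Q.estar j)
  by_cases hk : 0 < k
  · obtain ⟨b, rfl⟩ := (mem_mult_pos hk).1 hu
    rw [mem_mult_pos hk]
    by_cases hj : 0 < j
    · rw [red_pos hj]
      refine ⟨b - ε (Q.estar j) * (i (Q.e j) * b + σ • (b * i (Q.e j))), ?_⟩
      simp only [mul_sub, mul_add, mul_smul_comm, ← mul_assoc, h2']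
      rw [mul_assoc (ε (Q.estar j)) (i _) (ε _), h1']
      simp only [neg_mul, mul_neg, mul_assoc, smul_neg]
      abel
    · rw [red_nonpos hj]
      refine ⟨b + σ • ((-(i (Q.e j) * b) - σ • (b * i (Q.e j))) * ε (Q.estar j)), ?_⟩
      simp only [sub_mul, mul_sub, mul_add, mul_smul_comm, smul_mul_assoc, ← mul_assoc, h1']
      simp only [neg_mul, mul_neg, mul_assoc]
  · obtain ⟨b, rfl⟩ := (mem_mult_nonpos hk).1 hu
    rw [mem_mult_nonpos hk]
    by_cases hj : 0 < j
    · rw [red_pos hj]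
      refine ⟨b - ε (Q.estar j) * (i (Q.e j) * b + σ • (b * i (Q.e j))), ?_⟩
      simp only [sub_mul, add_mul, mul_sub, mul_add, mul_smul_comm, smul_mul_assoc, mul_assoc, h1']
      simp only [mul_neg, smul_neg]
      abel
    · rw [red_nonpos hj]
      refine ⟨b + σ • ((-(i (Q.e j) * b) - σ • (b * i (Q.e j))) * ε (Q.estar j)), ?_⟩
      simp only [sub_mul, add_mul, smul_mul_assoc, mul_assoc, neg_mul, h2]
      rw [← mul_assoc (ε (Q.estar k)) (i _), h1]
      simp only [neg_mul, mul_neg, mul_assoc, neg_neg]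

theorem IsClifford.reds_eq_zero (h : Q.IsClifford i ε) (hσ : σ * σ = 1)
    (l : List ℤ) {u : A} (hu : u ∈ (⨆ j ∈ l, Q.mult ε j)) : Q.reds i ε σ l u = 0 := by
  induction l generalizing u with
  | nil => simpa [reds] using hu
  | cons j l ih =>
    refine ih (u := Q.red i ε σ j u) ?_
    have h1 : (⨆ k ∈ j :: l, Q.mult ε k) ≤
        (⨆ k ∈ l, Q.mult ε k).comap (Q.red i ε σ j) := by
      refine iSup₂_le fun k hk v hv => ?_
      by_cases hjk : j = k
      · subst hjk
        change Q.red i ε σ j v ∈ ⨆ k ∈ l, Q.mult ε k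
        rw [h.red_mult_self hσ hv]
        exact zero_mem _
      · have hk' : k ∈ l := (List.mem_cons.1 hk).resolve_left (Ne.symm hjk)
        exact Submodule.mem_iSup_of_mem k (Submodule.mem_iSup_of_mem hk' (h.red_mult_of_ne hjk hv))
    exact h1 hu

/-! ### Words of positive charge -/

variable (Q i ε) in
/-- Generators with their charges. -/
inductive Gen : ℤ → A → Prop
  | even (a : A) (ha : ∀ f, Commute a (ε f)) : Gen 0 a
  | i (x : L) : Gen (-1) (i x)
  | e (j : ℤ) : Gen 1 (ε (Q.estar j))

/-- Moving ε(e_j^*) past a generator costs a scalar factor and a constant. The constant appears only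
for ι(x), whose charge -1 offsets that of ε(e_j^*), so deleting both preserves the total charge. -/
theorem IsClifford.gen_comm (h : Q.IsClifford i ε) {m : ℤ} {g : A} (hg : Q.Gen i ε m g) (j : ℤ) :
    ∃ s c : ℂ, ε (Q.estar j) * g = s • (g * ε (Q.estar j)) + c • 1 ∧
      g * ε (Q.estar j) = s • (ε (Q.estar j) * g) + c • 1 ∧ (c ≠ 0 → m = -1) := by
  cases hg with
  | even _ ha => exact ⟨1, 0, by simp [(ha _).eq], by simp [(ha _).eq], by simp⟩
  | i x =>
    refine ⟨-1, Q.e.repr x j, ?_, ?_, fun _ => rfl⟩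
    · rw [h.ei, estar_apply]; simp; abel
    · rw [h.ei, estar_apply]; simp
  | e k =>
    refine ⟨-1, 0, ?_, ?_, by simp⟩
    · rw [h.ee]; simp
    · rw [h.ee]; simp

/-- A word of positive charge contains some ε(e_j^*), which is moved to the left end if j > 0 and to
the right end otherwise. The corrections are shorter words of the same charge, handled by induction
on the length. -/
theorem IsClifford.word_mem (h : Q.IsClifford i ε) {n : ℤ} (hn : 0 < n) (N : ℕ) :
    ∀ l : List (ℤ × A), l.length = N → (∀ p ∈ l, Q.Gen i ε p.1 p.2) →
      (l.map Prod.fst).sum = n → (l.map Prod.snd).prod ∈ ⨆ j, Q.mult ε j := by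
  induction N using Nat.strong_induction_on with
  | _ N ih =>
  -- The distinguished ε(e_j^*) is kept outside the two lists; the 1 added to the length and to the
  -- charge accounts for it.
  have hpos : ∀ (j : ℤ), 0 < j → ∀ (l r : List (ℤ × A)), l.length + r.length + 1 = N →
      (∀ p ∈ l ++ r, Q.Gen i ε p.1 p.2) → ((l ++ r).map Prod.fst).sum + 1 = n →
      (l.map Prod.snd).prod * ε (Q.estar j) * (r.map Prod.snd).prod ∈ ⨆ j, Q.mult ε j := by
    intro j hj l
    induction l using List.reverseRecOn with
    | nil =>
      intro r _ _ _
      refine Submodule.mem_iSup_of_mem j ((mem_mult_pos hj).2 ⟨(r.map Prod.snd).prod, ?_⟩)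
      simp
    | append_singleton l g ihl =>
      intro r hlen hgen hsum
      obtain ⟨s, c, -, hc, hm⟩ := h.gen_comm (hgen g (by simp)) j
      have e : ((l ++ [g]).map Prod.snd).prod * ε (Q.estar j) * (r.map Prod.snd).prod
          = s • ((l.map Prod.snd).prod * ε (Q.estar j) * ((g :: r).map Prod.snd).prod)
            + c • ((l ++ r).map Prod.snd).prod := by
        simp only [List.map_append, List.prod_append, List.map_cons, List.map_nil, List.prod_cons,
          List.prod_nil, mul_one]
        rw [mul_assoc _ g.2, hc]
        simp only [mul_add, add_mul, mul_smul_comm, smul_mul_assoc, mul_one, mul_assoc]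
      rw [e]
      refine add_mem (Submodule.smul_mem _ _ (ihl (g :: r) ?_ ?_ ?_)) ?_
      · simp at hlen ⊢; omega
      · simpa using hgen
      · simpa using hsum
      · by_cases hc0 : c = 0
        · rw [hc0, zero_smul]; exact zero_mem _
        refine Submodule.smul_mem _ _ (ih (l ++ r).length ?_ _ rfl ?_ ?_)
        · simp at hlen ⊢; omega
        · exact fun p hp => hgen p (by
            simp only [List.mem_append] at hp ⊢
            tauto)
        · have := hm hc0
          simp at hsum ⊢
          omega
  have hneg : ∀ (j : ℤ), ¬ 0 < j → ∀ (r l : List (ℤ × A)), l.length + r.length + 1 = N →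
      (∀ p ∈ l ++ r, Q.Gen i ε p.1 p.2) → ((l ++ r).map Prod.fst).sum + 1 = n →
      (l.map Prod.snd).prod * ε (Q.estar j) * (r.map Prod.snd).prod ∈ ⨆ j, Q.mult ε j := by
    intro j hj r
    induction r with
    | nil =>
      intro l _ _ _
      refine Submodule.mem_iSup_of_mem j ((mem_mult_nonpos hj).2 ⟨(l.map Prod.snd).prod, ?_⟩)
      simp
    | cons g r ihr =>
      intro l hlen hgen hsum
      obtain ⟨s, c, hc, -, hm⟩ := h.gen_comm (hgen g (by simp)) j
      have e : (l.map Prod.snd).prod * ε (Q.estar j) * ((g :: r).map Prod.snd).prod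
          = s • (((l ++ [g]).map Prod.snd).prod * ε (Q.estar j) * (r.map Prod.snd).prod)
            + c • ((l ++ r).map Prod.snd).prod := by
        simp only [List.map_append, List.prod_append, List.map_cons, List.map_nil, List.prod_cons,
          List.prod_nil, mul_one]
        rw [mul_assoc, ← mul_assoc (ε _), hc]
        simp only [mul_add, add_mul, mul_smul_comm, smul_mul_assoc, one_mul, mul_assoc]
      rw [e]
      refine add_mem (Submodule.smul_mem _ _ (ihr (l ++ [g]) ?_ ?_ ?_)) ?_
      · simp at hlen ⊢; omega
      · simpa using hgen
      · simpa using hsum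
      · by_cases hc0 : c = 0
        · rw [hc0, zero_smul]; exact zero_mem _
        refine Submodule.smul_mem _ _ (ih (l ++ r).length ?_ _ rfl ?_ ?_)
        · simp at hlen ⊢; omega
        · exact fun p hp => hgen p (by
            simp only [List.mem_append, List.mem_cons] at hp ⊢
            tauto)
        · have := hm hc0
          simp at hsum ⊢
          omega
  intro l hlen hgen hsum
  obtain ⟨p, hp, hp0⟩ : ∃ p ∈ l, 0 < p.1 := by
    by_contra! hall
    have : (l.map Prod.fst).sum ≤ 0 := by
      refine (List.sum_le_card_nsmul _ 0 ?_).trans (by simp)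
      simpa using fun a b h => hall (a, b) h
    omega
  obtain ⟨l₁, l₂, rfl⟩ := List.append_of_mem hp
  have hp1 := hgen p hp
  obtain ⟨m, g⟩ := p
  cases hp1 with
  | even a ha => exact absurd hp0 (by simp)
  | i x => exact absurd hp0 (by simp)
  | e j =>
    have h1 : l₁.length + l₂.length + 1 = N := by simp at hlen; omega
    have h2 : ∀ p ∈ l₁ ++ l₂, Q.Gen i ε p.1 p.2 := fun p hp => hgen p (by
      simp only [List.mem_append, List.mem_cons] at hp ⊢
      tauto)
    have h3 : ((l₁ ++ l₂).map Prod.fst).sum + 1 = n := by simp at hsum ⊢; omega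
    have h4 : (((l₁ ++ (1, ε (Q.estar j)) :: l₂).map Prod.snd).prod
        = (l₁.map Prod.snd).prod * ε (Q.estar j) * (l₂.map Prod.snd).prod) := by
      simp [mul_assoc]
    change (List.map Prod.snd (l₁ ++ (1, ε (Q.estar j)) :: l₂)).prod ∈ _
    rw [h4]
    by_cases hj : 0 < j
    · exact hpos j hj l₁ l₂ h1 h2 h3
    · exact hneg j hj l₂ l₁ h1 h2 h3

end Reduction

/-! ### Vanishing criterion, uniqueness of d̄^β and its square. -/

namespace Complement

variable {Q} {β : Module.Dual ℂ L} (C : Q.Complement β)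

theorem toU₁_mem_span_gen {n : ℤ} {v : C.S} (hv : v ∈ C.charge n) :
    C.s.toU₁ C.sK v ∈ Submodule.span ℂ {a | Q.Gen C.iot C.eps n a} := by
  obtain ⟨x, ⟨y, f, c⟩, z⟩ := v
  obtain ⟨hx, ⟨hy, hf, hc⟩, hz⟩ := hv
  dsimp only at hx hy hf hc hz
  rw [SetLike.mem_coe, mem_scalarDeg] at hc
  by_cases h0 : n = 0
  · subst h0
    have hy0 : y = 0 := by simpa using hy
    have hf0 : f = 0 := by simpa using hf
    subst hy0 hf0
    refine Submodule.subset_span (Gen.even _ fun g => ?_)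
    have h := C.s.toU₁_rel_even C.sK (x := (x, (0, 0, c), z))
      (C.mem_sPart_zero.2 (Q.mem_clPart_zero.2 ⟨rfl, rfl⟩)) (0, (0, g, 0), 0)
    have hb : C.s.bracket (x, (0, 0, c), z) (0, (0, g, 0), 0) = 0 := by
      change C.sBracket _ _ = 0
      simp [sBracket_apply, clBracket_apply]
    rw [hb, map_zero, sub_eq_zero] at h
    exact h
  have hx0 : x = 0 := by simpa [h0] using hx
  have hz0 : z = 0 := by simpa [h0] using hz
  have hc0 : c = 0 := hc h0
  subst hx0 hz0 hc0
  by_cases h1 : n = 1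
  · subst h1
    have hy0 : y = 0 := by simpa using hy
    subst hy0
    -- An element of the restricted dual has finitely many nonzero coordinates, so it is a finite
    -- combination of the e_j^*.
    have hf' : f = (Q.coords f).sum fun j c => c • Q.estar j := by
      refine Subtype.ext (Q.e.ext fun k => ?_)
      rw [Finsupp.sum, Submodule.coe_sum, LinearMap.sum_apply]
      simp only [Submodule.coe_smul, LinearMap.smul_apply, estar_apply, Q.e.repr_self,
        Finsupp.single_apply, smul_eq_mul, mul_ite, mul_one, mul_zero]
      rw [Finset.sum_ite_eq, ← coords_apply]
      split_ifs with h
      · rfl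
      · exact Finsupp.notMem_support_iff.1 h
    change C.eps f ∈ _
    rw [hf', map_finsuppSum]
    refine sum_mem fun j _ => ?_
    dsimp only
    rw [map_smul]
    exact Submodule.smul_mem _ _ (Submodule.subset_span (Gen.e j))
  have hf0 : f = 0 := by simpa [h1] using hf
  subst hf0
  by_cases h2 : n = -1
  · subst h2
    exact Submodule.subset_span (Gen.i y)
  have hy0 : y = 0 := by simpa [h2] using hy
  subst hy0
  have : ((0, (0, 0, 0), 0) : C.S) = 0 := rfl
  rw [this, map_zero]
  exact zero_mem _

theorem wordSpan_le_mult {n : ℤ} (hn : 0 < n) {a : C.A}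
    (ha : a ∈ wordSpan (C.s.toU₁ C.sK) C.charge n) : a ∈ ⨆ j, Q.mult C.eps j := by
  set W : ℤ → Submodule ℂ C.A := fun n => Submodule.span ℂ {a | ∃ l : List (ℤ × C.A),
    (∀ p ∈ l, Q.Gen C.iot C.eps p.1 p.2) ∧ (l.map Prod.fst).sum = n ∧ a = (l.map Prod.snd).prod}
  have h : a ∈ W n := by
    refine wordSpan_induction (P := W) (Submodule.subset_span ⟨[], by simp, by simp, by simp⟩) ?_ ha
    intro m k x b hx hb
    have h := Submodule.mul_mem_mul (C.toU₁_mem_span_gen hx) hb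
    rw [Submodule.span_mul_span] at h
    refine Submodule.span_mono ?_ h
    rintro _ ⟨g, hg, _, ⟨l, hl, rfl, rfl⟩, rfl⟩
    exact ⟨(m, g) :: l, by simpa using ⟨hg, fun a b h => hl (a, b) h⟩, by simp, by simp⟩
  refine (Submodule.span_le.2 ?_ : W n ≤ _) h
  rintro _ ⟨l, hl, hs, rfl⟩
  exact C.isClifford_s.word_mem hn _ l rfl hl hs

theorem coe_red (σ : ℂ) (j : ℤ) (a : C.A) :
    ((Q.red C.iot C.eps σ j a : C.A) : C.Acom) = Q.red C.sI C.sE σ j (a : C.Acom) := by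
  have h := C.s.comHom_apply C.sK
  rw [← h, ← h]
  by_cases hj : 0 < j
  · rw [red_pos hj, red_pos hj]
    simp only [map_sub, map_mul, map_smul]
    rfl
  · rw [red_nonpos hj, red_nonpos hj]
    simp only [map_sub, map_add, map_mul, map_smul]
    rfl

theorem coe_reds (σ : ℂ) (l : List ℤ) (a : C.A) :
    ((Q.reds C.iot C.eps σ l a : C.A) : C.Acom) = Q.reds C.sI C.sE σ l (a : C.Acom) := by
  induction l generalizing a with
  | nil => rfl
  | cons j l ih =>
    refine (ih _).trans ?_
    rw [coe_red]
    rfl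

theorem continuous_red (σ : ℂ) (j : ℤ) :
    Continuous fun u : C.Acom => Q.red C.sI C.sE σ j u := by
  have h : Continuous fun u : C.Acom => C.sI (Q.e j) * u - σ • (u * C.sI (Q.e j)) :=
    (continuous_const_mul _).sub ((continuous_mul_const _).const_smul σ)
  by_cases hj : 0 < j
  · simp_rw [red_pos hj]
    exact continuous_id.sub (h.const_mul _)
  · simp_rw [red_nonpos hj]
    exact continuous_id.add ((h.mul_const _).const_smul σ)

/-- Left multiplication is harmless. On the right, ι(e_j) alone occurs only for j > 0 and ε(e_j^*)
alone only for j ≤ 0, both of nonnegative degree, while the pair has degree 0. The choice of sides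
in `red` therefore loses nothing in N, however many projections are composed. -/
theorem red_mem_tail (σ : ℂ) (j : ℤ) {N : ℤ} {a : C.A} (ha : a ∈ C.s.tail C.sK N) :
    Q.red C.iot C.eps σ j a ∈ C.s.tail C.sK N := by
  have hdI : ((0, (Q.e j, 0, 0), 0) : C.S) ∈ C.s.deg (Q.edeg j) :=
    C.clA_deg (Q.mem_clDeg.2 ⟨Q.e_mem j, zero_mem _, fun _ => rfl⟩)
  have hdE : ((0, (0, Q.estar j, 0), 0) : C.S) ∈ C.s.deg (-Q.edeg j) :=
    C.clA_deg (Q.mem_clDeg.2 ⟨zero_mem _, Q.estar_mem j, fun _ => rfl⟩)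
  have hI : ∀ M, a ∈ C.s.tail C.sK (M - Q.edeg j) → a * C.iot (Q.e j) ∈ C.s.tail C.sK M :=
    fun M h => C.s.tail_mul C.sK M _ _ hdI a h
  have hE : ∀ b M, b ∈ C.s.tail C.sK (M + Q.edeg j) →
      b * C.eps (Q.estar j) ∈ C.s.tail C.sK M := fun b M h =>
    C.s.tail_mul C.sK M _ _ hdE b (by rwa [sub_neg_eq_add])
  have hp := Q.edeg_pos j
  by_cases hj : 0 < j
  · rw [red_pos hj]
    refine sub_mem ha (C.s.mul_mem_tail C.sK _ (sub_mem (C.s.mul_mem_tail C.sK _ ha)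
      (C.s.smul_mem_tail C.sK _ (hI N (C.s.tail_anti C.sK (by omega) ha)))))
  · rw [red_nonpos hj, sub_mul, smul_mul_assoc]
    refine add_mem ha (C.s.smul_mem_tail C.sK _ (sub_mem (hE _ _ (C.s.mul_mem_tail C.sK _
      (C.s.tail_anti C.sK (by omega) ha))) (C.s.smul_mem_tail C.sK _ (hE _ _ (hI _ ?_)))))
    rwa [add_sub_cancel_right]

theorem reds_mem_tailCom (σ : ℂ) {N : ℤ} (l : List ℤ) {u : C.Acom}
    (hu : u ∈ C.s.tailCom C.sK N) : Q.reds C.sI C.sE σ l u ∈ C.s.tailCom C.sK N := by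
  induction l generalizing u with
  | nil => exact hu
  | cons j l ih =>
    refine ih (u := Q.red C.sI C.sE σ j u) ?_
    refine C.s.map_mem_tailCom C.sK (C.continuous_red σ j) (fun a ha => ?_) hu
    rw [← coe_red]
    exact C.s.coe_mem_tailCom C.sK (C.red_mem_tail σ j ha)

theorem reds_eq_self {σ : ℂ} {u : C.Acom} (hu : ∀ x, C.sI x * u = σ • (u * C.sI x))
    (l : List ℤ) : Q.reds C.sI C.sE σ l u = u := by
  induction l with
  | nil => rfl
  | cons j l ih =>
    change Q.reds C.sI C.sE σ l (Q.red C.sI C.sE σ j u) = u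
    rw [red_eq_self (hu _), ih]

/-- An element of positive charge which supercommutes with all `ι(x)` vanishes. -/
theorem eq_zero_of_supercommute {n : ℤ} (hn : 0 < n) {σ : ℂ} (hσ : σ * σ = 1) {u : C.Acom}
    (hu : u ∈ C.chargeCom n) (hI : ∀ x, C.sI x * u = σ • (u * C.sI x)) : u = 0 := by
  refine C.s.eq_zero_of_mem_tailCom C.sK fun N => ?_
  obtain ⟨a, ha, hua⟩ := C.s.exists_sub_mem_tailCom C.sK hu N
  -- The approximation involves only finitely many ε(e_j^*), so a finite list of projections
  -- annihilates it.
  obtain ⟨s, hs⟩ := Submodule.mem_iSup_iff_exists_finset.1 (C.wordSpan_le_mult hn ha)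
  have h0 : Q.reds C.iot C.eps σ s.toList a = 0 :=
    C.isClifford_s.reds_eq_zero hσ s.toList (by simpa using hs)
  have h1 := C.reds_mem_tailCom σ s.toList hua
  -- The projections fix u, kill its approximation and keep the error in the tail, so u itself lies
  -- in the tail.
  rw [map_sub, C.reds_eq_self hI, ← coe_reds, h0, Completion.coe_zero, sub_zero] at h1
  exact h1

theorem dBar_unique (hβ : β ∈ Q.dualGr 0) {u : C.Acom} (hu : u ∈ C.chargeCom 1)
    (h : ∀ x : L, u * C.sI x + C.sI x * u = C.thetaBar x) : u = C.dBar hβ := by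
  rw [← sub_eq_zero]
  refine C.eq_zero_of_supercommute one_pos (σ := -1) (by norm_num)
    (C.s.sub_mem_comPiece C.sK hu (C.dBar_charge hβ)) fun x => ?_
  have h1 := h x
  rw [← C.dBar_anticomm hβ x] at h1
  rw [neg_one_smul, eq_neg_iff_add_eq_zero, mul_sub, sub_mul]
  rw [← sub_eq_zero] at h1
  rw [← h1]
  abel

theorem dBar_comm_thetaBar (hβ : β ∈ Q.dualGr 0)
    (hL : ∀ x y : L, ⁅x, y⁆ ∈ (Q.gamma β).radical) (x : L) :
    C.dBar hβ * C.thetaBar x - C.thetaBar x * C.dBar hβ = 0 := by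
  have h1 : C.dBar hβ * C.thetaBar x ∈ C.chargeCom (1 + 0) :=
    C.s.mul_mem_comPiece C.sK (C.dBar_charge hβ) (C.thetaBar_charge x)
  have h2 : C.thetaBar x * C.dBar hβ ∈ C.chargeCom (0 + 1) :=
    C.s.mul_mem_comPiece C.sK (C.thetaBar_charge x) (C.dBar_charge hβ)
  rw [add_zero] at h1
  rw [zero_add] at h2
  refine C.eq_zero_of_supercommute one_pos (σ := -1) (by norm_num)
    (C.s.sub_mem_comPiece C.sK h1 h2) fun y => ?_
  rw [neg_one_smul, eq_neg_iff_add_eq_zero]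
  have a1 := C.dBar_anticomm hβ y
  have a2 := C.dBar_anticomm hβ ⁅x, y⁆
  have a3 := C.thetaBar_comm_sI x y
  have a4 := C.thetaBar_comm_thetaBar hβ hL x y
  set D := C.dBar hβ
  set t := C.thetaBar x
  set i := C.sI y
  -- Super Jacobi identity for two odd elements and one even element.
  have e : i * (D * t - t * D) + (D * t - t * D) * i
      = (D * i + i * D) * t - t * (D * i + i * D) + (D * (t * i - i * t) + (t * i - i * t) * D) := by
    noncomm_ring
  rw [e, a1, a3, a2, ← a4]
  abel

/-- The commutator of d̄² with ι(x) is [d̄, [d̄, ι(x)]] = [d̄, θ̄(x)] = 0. Here d̄² is even of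
charge 2, so the criterion is used with σ = 1. -/
theorem dBar_sq (hβ : β ∈ Q.dualGr 0) (hL : ∀ x y : L, ⁅x, y⁆ ∈ (Q.gamma β).radical) :
    C.dBar hβ * C.dBar hβ = 0 := by
  refine C.eq_zero_of_supercommute (n := 1 + 1) (by norm_num) (σ := 1) (by norm_num)
    (C.s.mul_mem_comPiece C.sK (C.dBar_charge hβ) (C.dBar_charge hβ)) fun x => ?_
  have h1 := C.dBar_anticomm hβ x
  have h2 := C.dBar_comm_thetaBar hβ hL x
  rw [← h1] at h2
  rw [one_smul, eq_comm, ← sub_eq_zero, ← h2]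
  noncomm_ring

end Complement
end QuasiFinite

namespace GradedLieSuper

variable {V : Type u} [AddCommGroup V] [Module ℂ V] (𝔤 : GradedLieSuper V) (K : V)

/-! ### The action of the completion on smooth modules -/

section Act

variable {W : Type v} [AddCommGroup W] [Module ℂ W] {Φ : 𝔤.U₁ K →ₐ[ℂ] Module.End ℂ W}

theorem tail_kills {N : ℤ} {x : W} (h : ∀ n, N ≤ n → ∀ a ∈ 𝔤.degU₁ K n, Φ a x = 0)
    {a : 𝔤.U₁ K} (ha : a ∈ 𝔤.tail K N) : Φ a x = 0 := by
  unfold tail at ha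
  induction ha using Submodule.span_induction with
  | mem a ha => obtain ⟨n, hn, ha⟩ := ha; exact h n hn a ha
  | zero => simp
  | add a b _ _ ha hb => rw [map_add, LinearMap.add_apply, ha, hb, add_zero]
  | smul c a _ ha => rw [smul_eq_mul, map_mul, Module.End.mul_apply, ha, map_zero]

/-- Smoothness says that a whole tail annihilates x, so the orbit map is constant on its cosets.
This makes the extension defining `act` meaningful. -/
theorem uniformContinuous_orbit (hΦ : 𝔤.IsSmooth K Φ) (x : W) :
    @UniformContinuous _ W _ ⊥ fun b : 𝔤.U₁ K => Φ b x := by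
  let _ : UniformSpace W := ⊥
  obtain ⟨N, hN⟩ := hΦ x
  rw [UniformContinuous, uniformity_eq_comap_nhds_zero (𝔤.U₁ K)]
  have hW : uniformity W = 𝓟 SetRel.id := rfl
  rw [hW, tendsto_principal]
  refine ((𝔤.tail_hasBasis K).comap _).mem_iff.2 ⟨N, trivial, fun p hp => ?_⟩
  have h := 𝔤.tail_kills K hN hp
  rw [map_sub, LinearMap.sub_apply, sub_eq_zero] at h
  exact h.symm

theorem act_coe (hΦ : 𝔤.IsSmooth K Φ) (b : 𝔤.U₁ K) (x : W) :
    𝔤.act K Φ (b : 𝔤.U₁com K) x = Φ b x := by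
  let _ : UniformSpace W := ⊥
  have _ : DiscreteTopology W := ⟨rfl⟩
  exact Completion.extension_coe (𝔤.uniformContinuous_orbit K hΦ x) b

theorem continuous_act (x : W) :
    @Continuous _ W _ (⊥ : UniformSpace W).toTopologicalSpace
      fun a : 𝔤.U₁com K => 𝔤.act K Φ a x := by
  let _ : UniformSpace W := ⊥
  have _ : DiscreteUniformity W := ⟨rfl⟩
  exact Completion.continuous_extension

theorem act_mul (hΦ : 𝔤.IsSmooth K Φ) (a b : 𝔤.U₁com K) (x : W) :
    𝔤.act K Φ (a * b) x = 𝔤.act K Φ a (𝔤.act K Φ b x) := by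
  let _ : UniformSpace W := ⊥
  have _ : DiscreteTopology W := ⟨rfl⟩
  have hc : ∀ x, Continuous fun a : 𝔤.U₁com K => 𝔤.act K Φ a x := 𝔤.continuous_act K
  induction b using Completion.induction_on with
  | hp =>
    -- The action of a fixed a is continuous on W merely because W is discrete.
    exact isClosed_eq ((hc x).comp (continuous_const_mul a))
      ((continuous_of_discreteTopology (f := 𝔤.act K Φ a)).comp (hc x))
  | ih b =>
    rw [𝔤.act_coe K hΦ]
    induction a using Completion.induction_on with
    | hp => exact isClosed_eq ((hc x).comp (continuous_mul_const _)) (hc _)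
    | ih a =>
      rw [← Completion.coe_mul, 𝔤.act_coe K hΦ, 𝔤.act_coe K hΦ, map_mul]
      rfl

/-- An element of degree n sends T k into T (n + k), which is zero for large n. The family T need
not exhaust W, so it may be adapted to the vector x. -/
theorem exists_kills_of_graded (T : ℤ → Submodule ℂ W)
    (hT : ∀ m n s, s ∈ 𝔤.deg m → ∀ w ∈ T n, Φ (𝔤.toU₁ K s) w ∈ T (m + n)) {N : ℤ}
    (hN : ∀ n, N ≤ n → T n = ⊥) {k : ℤ} {x : W} (hx : x ∈ T k) :
    ∃ N : ℤ, ∀ n, N ≤ n → ∀ a ∈ 𝔤.degU₁ K n, Φ a x = 0 := by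
  refine ⟨N - k, fun n hn a ha => ?_⟩
  have h : a ∈ (T (n + k)).comap (LinearMap.applyₗ x ∘ₗ Φ.toLinearMap) := by
    refine wordSpan_induction
      (P := fun n => (T (n + k)).comap (LinearMap.applyₗ x ∘ₗ Φ.toLinearMap)) ?_ ?_ ha
    · change Φ 1 x ∈ T (0 + k)
      rwa [map_one, zero_add]
    · intro m n s b hs hb
      change Φ (_ * b) x ∈ T (m + n + k)
      rw [map_mul, add_assoc]
      exact hT _ _ _ hs _ hb
  rw [hN _ (by omega)] at h
  exact h

end Act

theorem mem_iSup_wordSpan (a : 𝔤.U) : a ∈ ⨆ n, wordSpan 𝔤.toU 𝔤.deg n := by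
  obtain ⟨t, rfl⟩ := RingQuot.mkAlgHom_surjective ℂ 𝔤.Rel a
  change 𝔤.mkU t ∈ _
  induction t using TensorAlgebra.induction with
  | algebraMap r =>
    rw [AlgHom.commutes, Algebra.algebraMap_eq_smul_one]
    exact Submodule.mem_iSup_of_mem 0 (Submodule.smul_mem _ _ (one_mem_wordSpan _ _))
  | ι x =>
    have hx : x ∈ ⨆ n, 𝔤.deg n := 𝔤.deg_internal.submodule_iSup_eq_top ▸ Submodule.mem_top
    have h := Submodule.mem_map_of_mem (f := 𝔤.toU) hx
    rw [Submodule.map_iSup] at h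
    refine (iSup_mono fun n => ?_ : _ ≤ ⨆ n, wordSpan 𝔤.toU 𝔤.deg n) h
    rintro _ ⟨y, hy, rfl⟩
    exact mem_wordSpan _ hy
  | mul a b ha hb =>
    rw [map_mul]
    have h := Submodule.mul_mem_mul ha hb
    rw [Submodule.iSup_mul] at h
    refine (iSup_le fun m => ?_ : _ ≤ ⨆ n, wordSpan 𝔤.toU 𝔤.deg n) h
    rw [Submodule.mul_iSup]
    refine iSup_le fun n => Submodule.mul_le.2 fun x hx y hy => ?_
    exact Submodule.mem_iSup_of_mem (m + n) (mul_mem_wordSpan hx hy)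
  | add a b ha hb => rw [map_add]; exact add_mem ha hb

end GradedLieSuper

namespace QuasiFinite

variable {L : Type u} [LieRing L] [LieAlgebra ℂ L] (Q : QuasiFinite L)

/-! ### The grading of the semi-infinite forms -/

/-- The degree of a semi-infinite monomial, normalised to vanish on the vacuum. -/
def energy (S : Maya) : ℤ :=
  ∑ i ∈ S.2.2.toFinset, Q.edeg i - ∑ i ∈ S.2.1.toFinset, Q.edeg i

theorem energy_nonpos (S : Maya) : Q.energy S ≤ 0 := by
  have h1 : ∑ i ∈ S.2.2.toFinset, Q.edeg i ≤ 0 := Finset.sum_nonpos fun i hi =>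
    (Q.edeg_nonpos i).2 (by simpa using (S.2.2.mem_toFinset.1 hi).1)
  have h2 : 0 ≤ ∑ i ∈ S.2.1.toFinset, Q.edeg i := Finset.sum_nonneg fun i hi =>
    ((Q.edeg_pos i).2 (by simpa using (S.2.1.mem_toFinset.1 hi).2)).le
  unfold energy
  omega

/-- Inserting j adds a positive index when j > 0 and fills a hole when j ≤ 0. The two sums in
`energy` carry opposite signs, so the change is -deg e_j in both cases. -/
theorem energy_ins {S : Maya} {j : ℤ} (hj : j ∉ S.1) :
    Q.energy (S.ins j) = Q.energy S - Q.edeg j := by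
  unfold energy
  by_cases h : 0 < j
  · have h1 : (S.ins j).2.2.toFinset = S.2.2.toFinset := by
      ext i
      simp only [Set.Finite.mem_toFinset, Set.mem_sdiff, Set.mem_Iic, S.mem_ins, not_or]
      constructor
      · exact fun h => ⟨h.1, h.2.2⟩
      · exact fun h' => ⟨h'.1, by omega, h'.2⟩
    have h2 : (S.ins j).2.1.toFinset = insert j S.2.1.toFinset := by
      ext i
      simp only [Set.Finite.mem_toFinset, Set.mem_inter_iff, Set.mem_Ioi, S.mem_ins,
        Finset.mem_insert]
      constructor
      · rintro ⟨h | h, h'⟩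
        · exact Or.inl h
        · exact Or.inr ⟨h, h'⟩
      · rintro (rfl | h')
        · exact ⟨Or.inl rfl, h⟩
        · exact ⟨Or.inr h'.1, h'.2⟩
    rw [h1, h2, Finset.sum_insert (by simp [hj])]
    ring
  · have h1 : (S.ins j).2.1.toFinset = S.2.1.toFinset := by
      ext i
      simp only [Set.Finite.mem_toFinset, Set.mem_inter_iff, Set.mem_Ioi, S.mem_ins]
      constructor
      · rintro ⟨rfl | h', h''⟩
        · exact absurd h'' h
        · exact ⟨h', h''⟩
      · exact fun h' => ⟨Or.inr h'.1, h'.2⟩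
    have h2 : S.2.2.toFinset = insert j (S.ins j).2.2.toFinset := by
      ext i
      simp only [Set.Finite.mem_toFinset, Set.mem_sdiff, Set.mem_Iic, S.mem_ins,
        Finset.mem_insert, not_or]
      constructor
      · intro h'
        by_cases hij : i = j
        · exact Or.inl hij
        · exact Or.inr ⟨h'.1, hij, h'.2⟩
      · rintro (rfl | h')
        · exact ⟨by omega, hj⟩
        · exact ⟨h'.1, h'.2.2⟩
    rw [h1, h2, Finset.sum_insert (by simp [S.mem_ins])]
    ring

theorem energy_del {S : Maya} {j : ℤ} (hj : j ∈ S.1) :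
    Q.energy (S.del j) = Q.energy S + Q.edeg j := by
  have h := Q.energy_ins (S := S.del j) (j := j) fun h => (S.mem_del.1 h).2 rfl
  rw [S.ins_del hj] at h
  omega

/-- The semi-infinite forms of degree `n`. -/
def formsDeg (n : ℤ) : Submodule ℂ Forms :=
  Submodule.span ℂ {a | ∃ S : Maya, Q.energy S = n ∧ a = mono S 1}

theorem mono_mem_formsDeg (S : Maya) (c : ℂ) : mono S c ∈ Q.formsDeg (Q.energy S) := by
  have h : mono S c = c • mono S 1 := by rw [smul_mono, mul_one]
  rw [h]
  exact Submodule.smul_mem _ _ (Submodule.subset_span ⟨S, rfl, rfl⟩)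

theorem formsDeg_eq_bot {n : ℤ} (hn : 0 < n) : Q.formsDeg n = ⊥ := by
  rw [eq_bot_iff]
  refine Submodule.span_le.2 ?_
  rintro _ ⟨S, hS, -⟩
  have := Q.energy_nonpos S
  omega

theorem mem_iSup_formsDeg (x : Forms) : x ∈ ⨆ n, Q.formsDeg n := by
  refine Finsupp.induction_linear (motive := fun x : Maya →₀ ℂ => (id x : Forms) ∈
    ⨆ n, Q.formsDeg n) x (zero_mem _) (fun x y hx hy => add_mem hx hy) fun S c => ?_
  exact Submodule.mem_iSup_of_mem _ (Q.mono_mem_formsDeg S c)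

theorem map_formsDeg {m n : ℤ} (f : Module.End ℂ Forms)
    (hf : ∀ S, f (mono S 1) ∈ Q.formsDeg (m + Q.energy S)) {x : Forms} (hx : x ∈ Q.formsDeg n) :
    f x ∈ Q.formsDeg (m + n) := by
  refine (Submodule.span_le.2 ?_ : Q.formsDeg n ≤ (Q.formsDeg (m + n)).comap f) hx
  rintro _ ⟨S, rfl, rfl⟩
  exact hf S

theorem con_formsDeg (j n : ℤ) {x : Forms} (hx : x ∈ Q.formsDeg n) :
    con j x ∈ Q.formsDeg (Q.edeg j + n) := by
  refine Q.map_formsDeg _ (fun S => ?_) hx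
  by_cases hj : j ∈ S.1
  · rw [con_mem hj, add_comm, ← Q.energy_del hj]
    exact Q.mono_mem_formsDeg _ _
  · rw [con_not hj]
    exact zero_mem _

theorem ext_formsDeg (j n : ℤ) {x : Forms} (hx : x ∈ Q.formsDeg n) :
    ext j x ∈ Q.formsDeg (-Q.edeg j + n) := by
  refine Q.map_formsDeg _ (fun S => ?_) hx
  by_cases hj : j ∈ S.1
  · rw [ext_mem hj]
    exact zero_mem _
  · rw [ext_not hj, neg_add_eq_sub, ← Q.energy_ins hj]
    exact Q.mono_mem_formsDeg _ _

theorem clOp_formsDeg {m n : ℤ} {a : Q.Cl} (ha : a ∈ Q.clDeg m) {x : Forms}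
    (hx : x ∈ Q.formsDeg n) : Q.clOp a x ∈ Q.formsDeg (m + n) := by
  rw [mem_clDeg] at ha
  rw [clOp_apply]
  refine add_mem ?_ (add_mem ?_ ?_)
  · rw [conOp, LinearMap.comp_apply, Finsupp.linearCombination_apply, Finsupp.sum,
      LinearMap.sum_apply]
    refine sum_mem fun k hk => ?_
    rw [← Q.edeg_of_repr_ne_zero ha.1 (Finsupp.mem_support_iff.1 hk)]
    exact Submodule.smul_mem _ _ (Q.con_formsDeg k n hx)
  · rw [extOp, LinearMap.comp_apply, Finsupp.linearCombination_apply, Finsupp.sum,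
      LinearMap.sum_apply]
    refine sum_mem fun k hk => ?_
    have hk' : -Q.edeg k = m := by
      by_contra h
      exact Finsupp.mem_support_iff.1 hk (ha.2.1 _ (by omega) _ (Q.e_mem k))
    rw [← hk']
    exact Submodule.smul_mem _ _ (Q.ext_formsDeg k n hx)
  · by_cases hm : m = 0
    · rw [hm, zero_add]
      exact Submodule.smul_mem _ _ hx
    · rw [ha.2.2 hm, zero_smul]
      exact zero_mem _

namespace Complement

variable {Q} {β : Module.Dual ℂ L} (C : Q.Complement β)

/-! ### The grading of the Fock module -/

theorem heis_toU_comm (a b : C.F × ℂ) :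
    C.heis.toU a * C.heis.toU b = C.heis.toU b * C.heis.toU a + C.heis.toU (C.heis.bracket a b) := by
  have h := C.heis.toU_rel 0 0 a b (by simp [heis]) (by simp [heis])
  have hk : koszul 0 0 = 1 := by simp [koszul]
  rw [hk, one_smul] at h
  exact sub_eq_iff_eq_add'.1 h

/-- A word of positive degree has a letter of positive degree, which is moved to the right end,
where it generates a multiple in the ideal. Each commutator merges two letters into their bracket,
giving a shorter word of the same degree. -/
theorem word_mem_fockIdeal {n : ℤ} (hn : 0 < n) (N : ℕ) :
    ∀ l : List (ℤ × (C.F × ℂ)), l.length = N → (∀ p ∈ l, p.2 ∈ C.heis.deg p.1) →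
      (l.map Prod.fst).sum = n → (l.map fun p => C.heis.toU p.2).prod ∈ C.fockIdeal := by
  induction N using Nat.strong_induction_on with
  | _ N ih =>
  have key : ∀ (p : ℤ × (C.F × ℂ)), 0 < p.1 → ∀ (r l : List (ℤ × (C.F × ℂ))),
      (l ++ p :: r).length = N → (∀ q ∈ l ++ p :: r, q.2 ∈ C.heis.deg q.1) →
      ((l ++ p :: r).map Prod.fst).sum = n →
      ((l ++ p :: r).map fun q => C.heis.toU q.2).prod ∈ C.fockIdeal := by
    intro p hp r
    induction r with
    | nil =>
      intro l _ hdeg _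
      obtain ⟨m, f, t⟩ := p
      have h : ((f, t) : C.F × ℂ) ∈ C.heis.deg m := hdeg (m, f, t) (by simp)
      -- K sits in degree 0, so a letter of positive degree has no K component.
      have ht : t = 0 := mem_scalarDeg.1 h.2 hp.ne'
      subst ht
      simp only [List.map_append, List.prod_append, List.map_cons, List.map_nil, List.prod_cons,
        List.prod_nil, mul_one]
      exact Submodule.smul_mem _ _ (Submodule.subset_span (Or.inl ⟨m, hp, f, h.1, rfl⟩))
    | cons g r ihr =>
      intro l hlen hdeg hsum
      have e : ((l ++ p :: g :: r).map fun q => C.heis.toU q.2).prod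
          = (((l ++ [g]) ++ p :: r).map fun q => C.heis.toU q.2).prod
            + ((l ++ (p.1 + g.1, C.heis.bracket p.2 g.2) :: r).map fun q => C.heis.toU q.2).prod := by
        simp only [List.map_append, List.prod_append, List.map_cons, List.map_nil, List.prod_cons,
          List.prod_nil, mul_one]
        rw [← mul_assoc (C.heis.toU p.2), C.heis_toU_comm]
        simp only [add_mul, mul_add, mul_assoc]
      rw [e]
      refine add_mem (ihr (l ++ [g]) ?_ ?_ ?_) (ih (N - 1) ?_ _ ?_ ?_ ?_)
      · simpa [add_assoc, add_comm, add_left_comm] using hlen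
      · intro q hq
        refine hdeg q ?_
        simp only [List.mem_append, List.mem_cons, List.not_mem_nil, or_false] at hq ⊢
        tauto
      · rw [← hsum]
        simp only [List.map_append, List.sum_append, List.map_cons, List.map_nil, List.sum_cons,
          List.sum_nil]
        ring
      · simp only [List.length_append, List.length_cons] at hlen
        omega
      · simp only [List.length_append, List.length_cons] at hlen ⊢
        omega
      · intro q hq
        simp only [List.mem_append, List.mem_cons] at hq
        rcases hq with hq | rfl | hq
        · exact hdeg q (by simp [hq])
        · exact C.heis.bracket_deg _ _ _ _ (hdeg p (by simp)) (hdeg g (by simp))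
        · exact hdeg q (by simp [hq])
      · rw [← hsum]
        simp only [List.map_append, List.sum_append, List.map_cons, List.sum_cons]
        ring
  intro l hlen hdeg hsum
  obtain ⟨p, hp, hp0⟩ : ∃ p ∈ l, 0 < p.1 := by
    by_contra! hall
    have : (l.map Prod.fst).sum ≤ 0 := by
      refine (List.sum_le_card_nsmul _ 0 ?_).trans (by simp)
      intro x hx
      obtain ⟨p, hp, rfl⟩ := List.mem_map.1 hx
      exact hall p hp
    omega
  obtain ⟨l₁, l₂, rfl⟩ := List.append_of_mem hp
  exact key p hp0 l₂ l₁ hlen hdeg hsum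

/-- The class in the Fock module of an element of the enveloping algebra. -/
def fockMk : C.heis.U →ₗ[ℂ] C.Fock := C.fockIdeal.mkQ.restrictScalars ℂ

theorem fockMk_surjective : Function.Surjective C.fockMk := C.fockIdeal.mkQ_surjective

/-- The component of degree `n` of the Fock module. -/
def fockDeg (n : ℤ) : Submodule ℂ C.Fock := (wordSpan C.heis.toU C.heis.deg n).map C.fockMk

theorem fockDeg_eq_bot {n : ℤ} (hn : 0 < n) : C.fockDeg n = ⊥ := by
  rw [fockDeg, eq_bot_iff, Submodule.map_le_iff_le_comap]
  refine Submodule.span_le.2 ?_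
  rintro _ ⟨l, hl, hs, rfl⟩
  exact (Submodule.Quotient.mk_eq_zero C.fockIdeal).2 (C.word_mem_fockIdeal hn _ l rfl hl hs)

theorem mem_iSup_fockDeg (x : C.Fock) : x ∈ ⨆ n, C.fockDeg n := by
  obtain ⟨a, rfl⟩ := C.fockMk_surjective x
  simp only [fockDeg]
  rw [← Submodule.map_iSup]
  exact Submodule.mem_map_of_mem (C.heis.mem_iSup_wordSpan a)

theorem fockOp_fockDeg {m n : ℤ} {f : C.F} (hf : f ∈ C.FDeg m) {x : C.Fock}
    (hx : x ∈ C.fockDeg n) : C.fockOp (f, 0) x ∈ C.fockDeg (m + n) := by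
  obtain ⟨a, ha, rfl⟩ := hx
  have hd : ((f, 0) : C.F × ℂ) ∈ C.heis.deg m := ⟨hf, zero_mem _⟩
  exact ⟨C.heis.toU (f, 0) * a, mul_mem_wordSpan (mem_wordSpan _ hd) ha, rfl⟩

/-! ### Smoothness of `M ⊗ Λ^{∞/2+•} L^* ⊗ 𝔉_β` -/

section Rep

variable (M : Type w) [AddCommGroup M] [Module ℂ M]

/-- The pure tensor `m ⊗ x ⊗ z`. -/
def pure₃ : M →ₗ[ℂ] Forms →ₗ[ℂ] C.Fock →ₗ[ℂ] C.Feigin M :=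
  LinearMap.mk₂ ℂ (fun m x => TensorProduct.mk ℂ M (Forms ⊗[ℂ] C.Fock) m ∘ₗ
      TensorProduct.mk ℂ Forms C.Fock x)
    (fun _ _ _ => by rw [map_add]; rfl) (fun _ _ _ => by rw [map_smul]; rfl)
    (fun _ _ _ => by rw [map_add]; exact LinearMap.comp_add _ _ _)
    (fun _ _ _ => by rw [map_smul]; exact LinearMap.comp_smul _ _ _)

theorem pure₃_induction {P : C.Feigin M → Prop} (hadd : ∀ x y, P x → P y → P (x + y))
    (hp : ∀ m x z, P (C.pure₃ M m x z)) (v : C.Feigin M) : P v := by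
  refine TensorProduct.induction_on (motive := fun v : M ⊗[ℂ] (Forms ⊗[ℂ] C.Fock) =>
    P (id v : C.Feigin M)) v ?_ ?_ (fun x y hx hy => hadd _ _ hx hy)
  · have := hp 0 0 0
    rwa [map_zero] at this
  · intro m y
    induction y using TensorProduct.induction_on with
    | zero =>
      have := hp m 0 0
      rw [map_zero] at this
      rwa [TensorProduct.tmul_zero]
    | tmul x z => exact hp m x z
    | add x y hx hy =>
      rw [TensorProduct.tmul_add]
      exact hadd _ _ hx hy

variable [LieRingModule L M] [LieModule ℂ L M]

theorem rep_toU₁ (a : C.S) : C.rep M (C.s.toU₁ C.sK a) = C.opS M a :=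
  C.s.liftU₁_toU₁ C.sK (C.opS M) _ _ a

theorem opS_pure₃ (a : C.S) (m : M) (x : Forms) (z : C.Fock) :
    C.opS M a (C.pure₃ M m x z) = C.pure₃ M ⁅a.1, m⁆ x z
      + (C.pure₃ M m (Q.clOp a.2.1 x) z + C.pure₃ M m x (C.fockOp (a.2.2, 0) z)) := rfl

/-- The translates of `m` by `U(L)_n`. -/
def orbitDeg (m : M) (n : ℤ) : Submodule ℂ M :=
  (wordSpan (UniversalEnvelopingAlgebra.ι ℂ : L → UniversalEnvelopingAlgebra ℂ L) Q.gr n).map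
    (LinearMap.applyₗ m ∘ₗ
      (UniversalEnvelopingAlgebra.lift ℂ (LieModule.toEnd ℂ L M)).toLinearMap)

theorem lie_mem_orbitDeg {m : M} {k n : ℤ} {x : L} (hx : x ∈ Q.gr k) {y : M}
    (hy : y ∈ orbitDeg (Q := Q) M m n) : ⁅x, y⁆ ∈ orbitDeg (Q := Q) M m (k + n) := by
  obtain ⟨a, ha, rfl⟩ := hy
  refine ⟨_, mul_mem_wordSpan (mem_wordSpan _ hx) ha, ?_⟩
  change UniversalEnvelopingAlgebra.lift ℂ (LieModule.toEnd ℂ L M) (_ * a) m = _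
  rw [map_mul, UniversalEnvelopingAlgebra.lift_ι_apply]
  rfl

theorem self_mem_orbitDeg (m : M) : m ∈ orbitDeg (Q := Q) M m 0 := by
  refine ⟨1, one_mem_wordSpan _ _, ?_⟩
  change UniversalEnvelopingAlgebra.lift ℂ (LieModule.toEnd ℂ L M) 1 m = m
  rw [map_one]
  rfl

/-- The grading of the submodule generated by `m ⊗ Λ^{∞/2+•} L^* ⊗ 𝔉_β`. -/
def tripleDeg (m : M) (n : ℤ) : Submodule ℂ (C.Feigin M) :=
  Submodule.span ℂ {v | ∃ a b c : ℤ, a + b + c = n ∧ ∃ m' ∈ orbitDeg (Q := Q) M m a,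
    ∃ x ∈ Q.formsDeg b, ∃ z ∈ C.fockDeg c, v = C.pure₃ M m' x z}

theorem opS_tripleDeg (m : M) {k n : ℤ} {a : C.S} (ha : a ∈ C.s.deg k) {v : C.Feigin M}
    (hv : v ∈ C.tripleDeg M m n) : C.opS M a v ∈ C.tripleDeg M m (k + n) := by
  refine (Submodule.span_le.2 ?_ :
    C.tripleDeg M m n ≤ (C.tripleDeg M m (k + n)).comap (C.opS M a)) hv
  rintro _ ⟨p, q, r, rfl, m', hm, x, hx, z, hz, rfl⟩
  change C.opS M a _ ∈ C.tripleDeg M m _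
  rw [opS_pure₃]
  refine add_mem ?_ (add_mem ?_ ?_)
  · exact Submodule.subset_span ⟨k + p, q, r, by ring, _, lie_mem_orbitDeg M ha.1 hm, _, hx, _, hz,
      rfl⟩
  · exact Submodule.subset_span ⟨p, k + q, r, by ring, _, hm, _, Q.clOp_formsDeg ha.2.1 hx, _, hz,
      rfl⟩
  · exact Submodule.subset_span ⟨p, q, k + r, by ring, _, hm, _, hx, _,
      C.fockOp_fockDeg ha.2.2 hz, rfl⟩

/-- If three degrees sum to at least N, then the first is at least N or one of the other two is
positive, and in each case the corresponding factor is zero. -/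
theorem tripleDeg_eq_bot {m : M} {N : ℤ} (hN : ∀ n, N ≤ n → orbitDeg (Q := Q) M m n = ⊥) {n : ℤ}
    (hn : N ≤ n) : C.tripleDeg M m n = ⊥ := by
  rw [eq_bot_iff]
  refine Submodule.span_le.2 ?_
  rintro _ ⟨p, q, r, hs, m', hm, x, hx, z, hz, rfl⟩
  change _ = _
  by_cases hp : N ≤ p
  · rw [hN p hp, Submodule.mem_bot] at hm
    rw [hm, map_zero, LinearMap.zero_apply, LinearMap.zero_apply]
  by_cases hq : 0 < q
  · rw [Q.formsDeg_eq_bot hq, Submodule.mem_bot] at hx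
    rw [hx, map_zero, LinearMap.zero_apply]
  · rw [C.fockDeg_eq_bot (by omega), Submodule.mem_bot] at hz
    rw [hz, map_zero]

/-- M carries no grading, so for a pure tensor starting with m only the translates U(L)_n m are
used, with m in degree 0. Smoothness of M bounds these degrees above, and the other two factors have
degrees at most 0. -/
theorem isSmooth_rep (hM : Q.IsSmoothModule M) : C.s.IsSmooth C.sK (C.rep M) := by
  have hadd : ∀ x y : C.Feigin M,
      (∃ N : ℤ, ∀ n, N ≤ n → ∀ a ∈ C.s.degU₁ C.sK n, C.rep M a x = 0) →
      (∃ N : ℤ, ∀ n, N ≤ n → ∀ a ∈ C.s.degU₁ C.sK n, C.rep M a y = 0) →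
      ∃ N : ℤ, ∀ n, N ≤ n → ∀ a ∈ C.s.degU₁ C.sK n, C.rep M a (x + y) = 0 := by
    rintro x y ⟨N, hN⟩ ⟨N', hN'⟩
    refine ⟨max N N', fun n hn a ha => ?_⟩
    rw [map_add, hN n (by omega) a ha, hN' n (by omega) a ha, add_zero]
  have hzero : ∃ N : ℤ, ∀ n, N ≤ n → ∀ a ∈ C.s.degU₁ C.sK n, C.rep M a 0 = 0 :=
    ⟨0, fun _ _ _ _ => map_zero _⟩
  refine C.pure₃_induction M hadd fun m x z => ?_
  obtain ⟨N, hN⟩ := hM m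
  have hbot : ∀ n, N ≤ n → orbitDeg (Q := Q) M m n = ⊥ := fun n hn => by
    rw [eq_bot_iff]
    rintro _ ⟨a, ha, rfl⟩
    exact hN n hn a ha
  have hx := Q.mem_iSup_formsDeg x
  have hz := C.mem_iSup_fockDeg z
  induction hx using Submodule.iSup_induction' with
  | zero => rw [map_zero, LinearMap.zero_apply]; exact hzero
  | add x y _ _ hx hy => rw [map_add, LinearMap.add_apply]; exact hadd _ _ hx hy
  | mem b x hx =>
    induction hz using Submodule.iSup_induction' with
    | zero => rw [map_zero]; exact hzero
    | add z z' _ _ hz hz' => rw [map_add]; exact hadd _ _ hz hz'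
    | mem c z hz =>
      refine C.s.exists_kills_of_graded C.sK (C.tripleDeg M m) (fun k n s hs v hv => ?_)
        (N := N) (fun n hn => C.tripleDeg_eq_bot M hbot hn) (k := 0 + b + c)
        (Submodule.subset_span ⟨0, b, c, rfl, m, self_mem_orbitDeg M m, x, hx, z, hz, rfl⟩)
      rw [rep_toU₁]
      exact C.opS_tripleDeg M m hs hv

end Rep

end Complement

end QuasiFinite

end SemiInf

end

/-- Let `L` be a quasi-finite graded Lie algebra with adapted basis, `β ∈ L_0^*`, and `F_β` (part
of `C`) a graded complement of `ker γ^β`. If `[L, L] ⊆ ker γ^β`, then `γ^β` and all the series are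
well defined, `(d̄^β)² = 0`, and `d̄^β` is the unique element of charge degree `1` in
`U₁(s(L))^com` whose (super)bracket with each `ι(x)` is `θ̄^β(x)`; both entries of that bracket
being odd, it is the anticommutator. For every smooth `L`-module `M`, the representation on
`M ⊗ Λ^{∞/2+•} L^* ⊗ 𝔉_β` is smooth, so `d̄^β` acts on it, and this operator squares to zero. -/
theorem theorem2 {L : Type*} [LieRing L] [LieAlgebra ℂ L] (Q : SemiInf.QuasiFinite L)
    (β : Module.Dual ℂ L) (hβ : β ∈ Q.dualGr 0) (C : Q.Complement β)
    (hL : ∀ x y : L, ⁅x, y⁆ ∈ (Q.gamma β).radical) :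
    Q.IsGamma β (Q.gamma β) ∧ C.SeriesConverge ∧
    C.dBar hβ * C.dBar hβ = 0 ∧
    (C.dBar hβ ∈ C.chargeCom 1 ∧
      ∀ x : L, C.dBar hβ * (C.iot x : C.Acom) + (C.iot x : C.Acom) * C.dBar hβ = C.thetaBar x) ∧
    (∀ u ∈ C.chargeCom 1,
      (∀ x : L, u * (C.iot x : C.Acom) + (C.iot x : C.Acom) * u = C.thetaBar x) →
        u = C.dBar hβ) ∧
    ∀ (M : Type*) [AddCommGroup M] [Module ℂ M] [LieRingModule L M] [LieModule ℂ L M],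
      Q.IsSmoothModule M →
        C.s.IsSmooth C.sK (C.rep M) ∧
        ∀ v : C.Feigin M,
          C.s.act C.sK (C.rep M) (C.dBar hβ) (C.s.act C.sK (C.rep M) (C.dBar hβ) v) = 0 := by
  refine ⟨Q.isGamma_gamma β hβ, C.seriesConverge, C.dBar_sq hβ hL,
    ⟨C.dBar_charge hβ, C.dBar_anticomm hβ⟩, fun u hu h => C.dBar_unique hβ hu h,
    fun M _ _ _ _ hM => ⟨C.isSmooth_rep M hM, fun v => ?_⟩⟩
  -- The square of the operator is the action of d̄², which is zero.
  rw [← C.s.act_mul C.sK (C.isSmooth_rep M hM), C.dBar_sq hβ hL, ← UniformSpace.Completion.coe_zero,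
    C.s.act_coe C.sK (C.isSmooth_rep M hM), map_zero, LinearMap.zero_apply]
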